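/- Let $\mathbb F$ be a finite field, and write $|x|$ for the Hamming weight of a vector $x$. An optimization problem consists of a set of instances, a set $Sol(x)$ of feasible solutions for every instance $x$, a measure $\mu(x,y)\in\mathbb N=\{0,1,2,\dots\}$ for $y\in Sol(x)$, and a criterion, min or max; $\mu^*(x)$ denotes the measure of the optimal solutions of $x$, if there are any. Its *constructive problem* is: given an instance $x$ that has an optimal solution, compute an optimal solution and its measure. Its *evaluation problem* is: given such an $x$, compute $\mu^*(x)$. Its *decision problem* is: given an instance $x$ and a positive integer $t$ (in binary), decide whether $\mu^*(x)$ exists and $\mu^*(x)\le t$ (for min), respectively $\mu^*(x)\ge t$ (for max). The problem is an *NPO problem* if (i) its set of instances is recognizable in polynomial time; (ii) there is a polynomial $p$ such that all feasible solutions of every instance $x$ have size at most $p(|x|)$ (here $|x|$ is the size of $x$), and for every string $y$ of size at most $p(|x|)$ it is decidable in polynomial time whether $y$ is a feasible solution of $x$; (iii) the measure function is computable in polynomial time. Two problems are *polynomial-time Turing-equivalent* if each of them is solved, in time polynomial in the size of the instance, by an oracle program that may use any oracle that answers all instances of the other one correctly; an oracle call costs one step plus the lengths of query and answer. Consider the following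 minimization problems over $\mathbb F$, whose measure is the Hamming weight. * MIN-CWP: an instance is a matrix $A\in\mathcal M_{m,n}(\mathbb F)$ of full row rank, i.e. of rank $m$, with a vector $b\in\mathbb F^m$; the feasible solutions are the $x\in\mathbb F^n$ with $Ax=b$. * MIN-SWP: an instance is a matrix $A\in\mathcal M_{m,n}(\mathbb F)$ of full row rank; the feasible solutions are the $x\in\mathbb F^n$ with $Ax=0$. * MIN-SWP$^{\neq 0}$: as MIN-SWP, but the feasible solutions are the nonzero $x\in\mathbb F^n$ with $Ax=0$. Let CWP be the question, given $A$, $b$ and a positive integer $t$, whether some $x\in\mathbb F^n$ satisfies $Ax=b$ and $|x|\le t$; let SWP be the question, given $A$ and $t$, whether some $x\in\mathbb F^n$ satisfies $Ax=0$ and $|x|\le t$; and let SWP$^{\neq0}$ be the question whether some nonzero $x$ does so. Then: 1. MIN-CWP, MIN-SWP and MIN-SWP$^{\neq 0}$ are NPO problems. 2. CWP, restricted to matrices of full row rank, is the decision problem of MIN-CWP; in the same sense SWP is the decision problem of MIN-SWP, and SWP$^{\neq 0}$ is that of MIN-SWP$^{\neq 0}$. 3. For each of MIN-CWP, MIN-SWP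 and MIN-SWP$^{\neq 0}$, its constructive, evaluation and decision problems are pairwise polynomial-time Turing-equivalent. -/

import Mathlib

namespace CosetWeight

universe u

/-! ### Oracle programs with a step count

A program works on finitely many stacks of symbols from an alphabet `Γ` (finite in all uses), i.e.
it is a multi-stack machine with a structured finite control. Every unit of time changes at most
one stack by one symbol, except that an oracle call is charged for the query and for the answer. -/

/-- Oracle programs over the alphabet `Γ`; stacks are numbered by natural numbers. -/
inductive Prog (Γ : Type u) : Type u
  | skip : Prog Γ
  /-- push the symbol `a` on stack `r` -/
  | push (r : ℕ) (a : Γ) : Prog Γ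
  /-- remove the top symbol of stack `r`, if there is one -/
  | pop (r : ℕ) : Prog Γ
  | seq (c d : Prog Γ) : Prog Γ
  /-- read the top of stack `r` (`none` if it is empty) and continue accordingly -/
  | branch (r : ℕ) (k : Option Γ → Prog Γ) : Prog Γ
  /-- run the body as long as the top of stack `r` passes the test -/
  | loop (r : ℕ) (test : Option Γ → Bool) (body : Prog Γ) : Prog Γ
  /-- replace the content of stack `s` by the oracle's answer to the content of stack `r` -/
  | query (r s : ℕ) : Prog Γ

/-- `Exec O c σ t σ'`: with oracle `O`, the program `c` started on the stacks `σ` halts after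
exactly `t` steps with the stacks `σ'`. -/
inductive Exec {Γ : Type u} (O : List Γ → List Γ) :
    Prog Γ → (ℕ → List Γ) → ℕ → (ℕ → List Γ) → Prop
  | skip (σ : ℕ → List Γ) : Exec O Prog.skip σ 1 σ
  | push (r : ℕ) (a : Γ) (σ : ℕ → List Γ) :
      Exec O (Prog.push r a) σ 1 (Function.update σ r (a :: σ r))
  | pop (r : ℕ) (σ : ℕ → List Γ) :
      Exec O (Prog.pop r) σ 1 (Function.update σ r (σ r).tail)
  | seq {c d : Prog Γ} {σ σ₁ σ₂ : ℕ → List Γ} {t₁ t₂ : ℕ} :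
      Exec O c σ t₁ σ₁ → Exec O d σ₁ t₂ σ₂ → Exec O (Prog.seq c d) σ (t₁ + t₂) σ₂
  | branch {r : ℕ} {k : Option Γ → Prog Γ} {σ σ₁ : ℕ → List Γ} {t : ℕ} :
      Exec O (k (σ r).head?) σ t σ₁ → Exec O (Prog.branch r k) σ (t + 1) σ₁
  | loopDone {r : ℕ} {test : Option Γ → Bool} {c : Prog Γ} {σ : ℕ → List Γ} :
      test (σ r).head? = false → Exec O (Prog.loop r test c) σ 1 σ
  | loopStep {r : ℕ} {test : Option Γ → Bool} {c : Prog Γ} {σ σ₁ σ₂ : ℕ → List Γ} {t₁ t₂ : ℕ} :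
      test (σ r).head? = true → Exec O c σ t₁ σ₁ → Exec O (Prog.loop r test c) σ₁ t₂ σ₂ →
      Exec O (Prog.loop r test c) σ (t₁ + t₂ + 1) σ₂
  | query (r s : ℕ) (σ : ℕ → List Γ) :
      Exec O (Prog.query r s) σ ((σ r).length + (O (σ r)).length + 1)
        (Function.update σ s (O (σ r)))

/-- With oracle `O` and input `w` (on stack `0`, all other stacks empty), the program `c` halts
within `T` steps with output `v` on stack `0`. -/
def Outputs {Γ : Type u} (O : List Γ → List Γ) (c : Prog Γ) (w : List Γ) (T : ℕ) (v : List Γ) :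
    Prop :=
  ∃ (t : ℕ) (σ : ℕ → List Γ),
    Exec O c (Function.update (fun _ => []) 0 w) t σ ∧ t ≤ T ∧ σ 0 = v

/-- The oracle that answers every query with the empty string: programs that run with it are
programs without an oracle. -/
def noOracle {Γ : Type u} : List Γ → List Γ := fun _ => []

/-! ### Computational problems on strings and polynomial-time Turing reductions -/

/-- A computational problem: `R w v` means that `v` is a correct answer to the instance `w`.
The instances are the strings that have a correct answer. -/
abbrev StringProblem (Γ : Type u) := List Γ → List Γ → Prop

/-- The oracle `O` gives a correct answer to every instance of `R` (and anything otherwise). -/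
def Solves {Γ : Type u} (O : List Γ → List Γ) (R : StringProblem Γ) : Prop :=
  ∀ w, (∃ v, R w v) → R w (O w)

/-- `R` is polynomial-time Turing-reducible to `S`: one oracle program with one polynomial time
bound solves `R` with the help of any oracle that solves `S`. -/
def PolyTuringReducible {Γ : Type u} (R S : StringProblem Γ) : Prop :=
  ∃ (c : Prog Γ) (p : Polynomial ℕ), ∀ O : List Γ → List Γ, Solves O S →
    ∀ w, (∃ v, R w v) → ∃ v, R w v ∧ Outputs O c w (p.eval w.length) v

def PolyTuringEquivalent {Γ : Type u} (R S : StringProblem Γ) : Prop :=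
  PolyTuringReducible R S ∧ PolyTuringReducible S R

/-! ### The alphabet -/

/-- The alphabet: the elements of `K`, the two bits, and two punctuation marks. -/
inductive Sym (K : Type u) : Type u
  | elt (a : K) : Sym K
  | bit (b : Bool) : Sym K
  | comma : Sym K
  | hash : Sym K

/-- The encoding `w#v` of a pair of strings, used where `w` does not contain `#`. -/
def pair {K : Type u} (w v : List (Sym K)) : List (Sym K) := w ++ Sym.hash :: v

/-- Binary representation of a natural number, least significant bit first. -/
def encNat {K : Type u} (n : ℕ) : List (Sym K) := n.bits.map Sym.bit

open Classical in
/-- The string `1` if `P` holds and the string `0` otherwise. -/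
noncomputable def encProp {K : Type u} (P : Prop) : List (Sym K) := [Sym.bit (decide P)]

/-- The language `L` is decidable in polynomial time. -/
def PolyTimeDecidable {K : Type u} (L : Set (List (Sym K))) : Prop :=
  ∃ (c : Prog (Sym K)) (p : Polynomial ℕ), ∀ w,
    Outputs noOracle c w (p.eval w.length) (encProp (w ∈ L))

/-! ### Optimization problems -/

inductive Goal
  | min
  | max

/-- An optimization problem, with its instances and solutions encoded over `Sym K`. -/
structure OptProblem (K : Type u) where
  /-- instances -/
  Inst : Type u
  /-- the objects among which the solutions of an instance are sought -/
  Cand : Inst → Type u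
  /-- feasible solutions -/
  Sol : ∀ x, Set (Cand x)
  /-- measure function; only its values on feasible solutions matter -/
  measure : ∀ x, Cand x → ℕ
  opt : Goal
  encInst : Inst → List (Sym K)
  encCand : ∀ x, Cand x → List (Sym K)
  encInst_injective : Function.Injective encInst
  encCand_injective : ∀ x, Function.Injective (encCand x)
  hash_notMem_encInst : ∀ x, Sym.hash ∉ encInst x
  hash_notMem_encCand : ∀ x y, Sym.hash ∉ encCand x y

namespace OptProblem

variable {K : Type u}

/-- The set of optimal solutions. -/
def OptSol (A : OptProblem K) (x : A.Inst) : Set (A.Cand x) :=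
  match A.opt with
  | Goal.min => {y | y ∈ A.Sol x ∧ ∀ z ∈ A.Sol x, A.measure x y ≤ A.measure x z}
  | Goal.max => {y | y ∈ A.Sol x ∧ ∀ z ∈ A.Sol x, A.measure x z ≤ A.measure x y}

/-- `v` is the value of the optimal solutions of `x` (in particular there is one). -/
def IsOptValue (A : OptProblem K) (x : A.Inst) (v : ℕ) : Prop :=
  ∃ y ∈ A.OptSol x, A.measure x y = v

/-- The predicate of the decision problem. It is false if `x` has no optimal solution. -/
def Decides (A : OptProblem K) (x : A.Inst) (t : ℕ) : Prop :=
  match A.opt with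
  | Goal.min => ∃ v, A.IsOptValue x v ∧ v ≤ t
  | Goal.max => ∃ v, A.IsOptValue x v ∧ t ≤ v

/-- Given an instance (that has an optimal solution), compute an optimal solution and its
measure. -/
def constructive (A : OptProblem K) : StringProblem (Sym K) := fun w v =>
  ∃ x, w = A.encInst x ∧ ∃ y ∈ A.OptSol x, v = pair (A.encCand x y) (encNat (A.measure x y))

/-- Given an instance (that has an optimal solution), compute the optimal value. -/
def evaluation (A : OptProblem K) : StringProblem (Sym K) := fun w v =>
  ∃ x, w = A.encInst x ∧ ∃ n, A.IsOptValue x n ∧ v = encNat n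

/-- Given an instance `x` and a positive integer `t`, decide `A.Decides x t`. -/
def decision (A : OptProblem K) : StringProblem (Sym K) := fun w v =>
  ∃ x t, 0 < t ∧ w = pair (A.encInst x) (encNat t) ∧ v = encProp (A.Decides x t)

/-- The class NPO. -/
structure IsNPO (A : OptProblem K) : Prop where
  recognizable : PolyTimeDecidable (Set.range A.encInst)
  solutions : ∃ p : Polynomial ℕ,
    (∀ x, ∀ y ∈ A.Sol x, (A.encCand x y).length ≤ p.eval (A.encInst x).length) ∧
    ∃ (c : Prog (Sym K)) (q : Polynomial ℕ), ∀ (x : A.Inst) (s : List (Sym K)),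
      s.length ≤ p.eval (A.encInst x).length →
      Outputs noOracle c (pair (A.encInst x) s) (q.eval (pair (A.encInst x) s).length)
        (encProp (∃ y ∈ A.Sol x, A.encCand x y = s))
  measure_computable : ∃ (c : Prog (Sym K)) (q : Polynomial ℕ), ∀ x, ∀ y ∈ A.Sol x,
    Outputs noOracle c (pair (A.encInst x) (A.encCand x y))
      (q.eval (pair (A.encInst x) (A.encCand x y)).length) (encNat (A.measure x y))

/-- The constructive, evaluation and decision problems of `A` are pairwise polynomial-time
Turing-equivalent. -/
def AllTuringEquivalent (A : OptProblem K) : Prop :=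
  PolyTuringEquivalent A.constructive A.evaluation ∧
  PolyTuringEquivalent A.evaluation A.decision ∧
  PolyTuringEquivalent A.constructive A.decision

end OptProblem

/-! ### Coset weight and subspace weight problems -/

section Problems

variable {F : Type u}

/-- Coset weight problem: is there a solution of `A x = b` of Hamming weight at most `t`? -/
def CWP [Field F] [DecidableEq F] {m n : ℕ} (A : Matrix (Fin m) (Fin n) F) (b : Fin m → F)
    (t : ℕ) : Prop :=
  ∃ x : Fin n → F, A.mulVec x = b ∧ hammingNorm x ≤ t

/-- Subspace weight problem: is there a solution of `A x = 0` of Hamming weight at most `t`? -/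
def SWP [Field F] [DecidableEq F] {m n : ℕ} (A : Matrix (Fin m) (Fin n) F) (t : ℕ) : Prop :=
  ∃ x : Fin n → F, A.mulVec x = 0 ∧ hammingNorm x ≤ t

/-- Subspace weight problem with the zero solution excluded. -/
def SWPNonzero [Field F] [DecidableEq F] {m n : ℕ} (A : Matrix (Fin m) (Fin n) F) (t : ℕ) :
    Prop :=
  ∃ x : Fin n → F, x ≠ 0 ∧ A.mulVec x = 0 ∧ hammingNorm x ≤ t

/-- A matrix of full row rank together with a right-hand side. -/
structure CosetInstance (F : Type u) [Field F] where
  m : ℕ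
  n : ℕ
  A : Matrix (Fin m) (Fin n) F
  b : Fin m → F
  full_rank : A.rank = m

/-- A matrix of full row rank. -/
structure SubspaceInstance (F : Type u) [Field F] where
  m : ℕ
  n : ℕ
  A : Matrix (Fin m) (Fin n) F
  full_rank : A.rank = m

/-- A vector is written as the list of its coordinates. -/
def encVec {n : ℕ} (x : Fin n → F) : List (Sym F) := (List.ofFn x).map Sym.elt

/-- A matrix is written as its number of columns in unary and a comma, followed by its rows, each
row ending with a comma. -/
def encMatrix {m n : ℕ} (A : Matrix (Fin m) (Fin n) F) : List (Sym F) :=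
  List.replicate n (Sym.bit true) ++ Sym.comma ::
    (List.ofFn fun i => encVec (A i) ++ [Sym.comma]).flatten

theorem encVec_injective {n : ℕ} : Function.Injective (encVec : (Fin n → F) → List (Sym F)) := by
  intro x y h
  have hi : Function.Injective (Sym.elt : F → Sym F) := fun a b hab => by injection hab
  exact List.ofFn_injective (hi.list_map h)

theorem length_encVec {n : ℕ} (x : Fin n → F) : (encVec x).length = n := by simp [encVec]

theorem hash_notMem_encVec {n : ℕ} (x : Fin n → F) : Sym.hash ∉ encVec x := by simp [encVec]

theorem hash_notMem_encMatrix {m n : ℕ} (A : Matrix (Fin m) (Fin n) F) :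
    Sym.hash ∉ encMatrix A := by
  simp [encMatrix, encVec, List.mem_ofFn]

theorem length_encMatrix {m n : ℕ} (A : Matrix (Fin m) (Fin n) F) :
    (encMatrix A).length = n + (m * (n + 1) + 1) := by
  simp [encMatrix, List.length_flatten, List.map_ofFn, Function.comp_def, length_encVec]

theorem encMatrix_inj {m n : ℕ} {A B : Matrix (Fin m) (Fin n) F}
    (h : encMatrix A = encMatrix B) : A = B := by
  have h1 := (List.append_inj h rfl).2
  injection h1 with _ h2
  have h3 := (List.eq_iff_flatten_eq).2 ⟨h2, by
    simp [List.map_ofFn, Function.comp_def, length_encVec]⟩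
  have h4 := List.ofFn_injective h3
  funext i
  exact encVec_injective (List.append_inj_left' (congrFun h4 i) rfl)

/-- Numbers of columns and rows can be read off by counting symbols. -/
theorem dims_of_encMatrix_append_eq {m n m' n' k k' : ℕ} {A : Matrix (Fin m) (Fin n) F}
    {A' : Matrix (Fin m') (Fin n') F} {b : Fin k → F} {b' : Fin k' → F}
    (h : encMatrix A ++ encVec b = encMatrix A' ++ encVec b') : m = m' ∧ n = n' := by
  classical
  have key : ∀ {m n k : ℕ} (A : Matrix (Fin m) (Fin n) F) (b : Fin k → F),
      (encMatrix A ++ encVec b).countP (fun s => decide (s = Sym.comma)) = m + 1 ∧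
      (encMatrix A ++ encVec b).countP (fun s => decide (s = Sym.bit true)) = n := by
    intro m n k A b
    have hv : ∀ {l : ℕ} (x : Fin l → F),
        (encVec x).countP (fun s => decide (s = Sym.comma)) = 0 ∧
        (encVec x).countP (fun s => decide (s = Sym.bit true)) = 0 := by
      intro l x
      simp [encVec, List.countP_eq_zero]
    constructor
    · simp [encMatrix, List.countP_append, List.countP_flatten, List.map_ofFn,
        Function.comp_def, List.countP_replicate, (hv _).1]
    · simp [encMatrix, List.countP_append, List.countP_flatten, List.map_ofFn,
        Function.comp_def, List.countP_replicate, (hv _).2]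
  have h1 := key A b
  have h2 := key A' b'
  rw [h] at h1
  constructor <;> omega

def CosetInstance.enc [Field F] (I : CosetInstance F) : List (Sym F) :=
  encMatrix I.A ++ encVec I.b

def SubspaceInstance.enc [Field F] (I : SubspaceInstance F) : List (Sym F) := encMatrix I.A

theorem CosetInstance.enc_injective [Field F] :
    Function.Injective (CosetInstance.enc : CosetInstance F → List (Sym F)) := by
  rintro ⟨m, n, A, b, h⟩ ⟨m', n', A', b', h'⟩ e
  simp only [CosetInstance.enc] at e
  obtain ⟨rfl, rfl⟩ := dims_of_encMatrix_append_eq e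
  have e2 := List.append_inj e (by rw [length_encMatrix, length_encMatrix])
  obtain rfl := encMatrix_inj e2.1
  obtain rfl := encVec_injective e2.2
  rfl

theorem SubspaceInstance.enc_injective [Field F] :
    Function.Injective (SubspaceInstance.enc : SubspaceInstance F → List (Sym F)) := by
  rintro ⟨m, n, A, h⟩ ⟨m', n', A', h'⟩ e
  simp only [SubspaceInstance.enc] at e
  have hd : m = m' ∧ n = n' := by
    have e' : encMatrix A ++ encVec (Fin.elim0 : Fin 0 → F) =
        encMatrix A' ++ encVec (Fin.elim0 : Fin 0 → F) := by rw [e]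
    exact dims_of_encMatrix_append_eq e'
  obtain ⟨rfl, rfl⟩ := hd
  obtain rfl := encMatrix_inj e
  rfl

variable (F) [Field F] [DecidableEq F]

/-- MIN-CWP over `F`. -/
def minCWP : OptProblem F where
  Inst := CosetInstance F
  Cand I := Fin I.n → F
  Sol I := {x | I.A.mulVec x = I.b}
  measure _ x := hammingNorm x
  opt := Goal.min
  encInst := CosetInstance.enc
  encCand _ := encVec
  encInst_injective := CosetInstance.enc_injective
  encCand_injective _ := encVec_injective
  hash_notMem_encInst I := by
    simp only [CosetInstance.enc, List.mem_append, not_or]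
    exact ⟨hash_notMem_encMatrix _, hash_notMem_encVec _⟩
  hash_notMem_encCand _ := hash_notMem_encVec

/-- MIN-SWP over `F`: the case `b = 0` of MIN-CWP. -/
def minSWP : OptProblem F where
  Inst := SubspaceInstance F
  Cand I := Fin I.n → F
  Sol I := {x | I.A.mulVec x = 0}
  measure _ x := hammingNorm x
  opt := Goal.min
  encInst := SubspaceInstance.enc
  encCand _ := encVec
  encInst_injective := SubspaceInstance.enc_injective
  encCand_injective _ := encVec_injective
  hash_notMem_encInst _ := hash_notMem_encMatrix _
  hash_notMem_encCand _ := hash_notMem_encVec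

/-- MIN-SWP over `F` with the zero solution excluded. -/
def minSWPNonzero : OptProblem F where
  Inst := SubspaceInstance F
  Cand I := Fin I.n → F
  Sol I := {x | x ≠ 0 ∧ I.A.mulVec x = 0}
  measure _ x := hammingNorm x
  opt := Goal.min
  encInst := SubspaceInstance.enc
  encCand _ := encVec
  encInst_injective := SubspaceInstance.enc_injective
  encCand_injective _ := encVec_injective
  hash_notMem_encInst _ := hash_notMem_encMatrix _
  hash_notMem_encCand _ := hash_notMem_encVec

end Problems

end CosetWeight

set_option linter.unusedSimpArgs false
set_option linter.unusedSectionVars false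

namespace CosetWeight

universe u v w

/-! ### Time-bounded runs of programs -/

section Machine

open Function

variable {Γ : Type u} {O : List Γ → List Γ}

/-! The statement has a machine part and an algorithmic part. For the machine part, `PolyFun` is a
class of functions between types represented by tuples of strings. Its programs leave their input
stacks intact and write only above a given free stack `M`, so they can be placed side by side. The
class is closed under composition, pairing, finite case distinction, folds with polynomially bounded
states, and oracle queries. After that, "computable in polynomial time" is mostly proved by
`fun_prop`. The oracle is a parameter ranging over all solvers of a problem, so one program and one
polynomial serve all of them. Rank is tested by Gaussian elimination on lists of rows
(`fullRank_iff`). NPO membership then amounts to parsing, the rank test and matrix-vector products.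
For the equivalences, everything passes through the predicate `leq`: is there a feasible solution of
measure at most `t`? Measures are at most the number `n` of columns, which the instance contains in
unary, so a linear search over `t` turns `leq` into the optimal value, and each of the three
problems yields `leq`. What remains is to compute an optimal solution from `leq`. MIN-CWP
(`cosetSolution_spec`): replacing `b` by `b - A x` turns weight into Hamming distance from `x`. One
pass over all vectors with at most one nonzero coordinate adds such a vector to `x` whenever this
lowers the distance to the solution set. A vector once rejected never becomes useful later, so after
the pass no change of a single coordinate helps, which forces `x` to be a solution. MIN-SWP with
zero excluded (`subspaceReduced_spec`, `subspaceVector_spec`): equations saying that a coordinate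
vanishes are added as long as the minimal weight does not rise. Then the kernel is a line through a
lightest vector `y`: otherwise, cancelling one coordinate of `y` with another kernel vector would
give a nonzero kernel vector of smaller support. On a line, rank tests decide whether a given row is
orthogonal to `y`, and this determines `y` up to a scalar. MIN-SWP is trivial: the zero vector is
optimal. -/

/-- The program `c` started on `σ` halts within `T` steps with the stacks `σ'`. -/
def Runs (O : List Γ → List Γ) (c : Prog Γ) (σ : ℕ → List Γ) (T : ℕ) (σ' : ℕ → List Γ) : Prop :=
  ∃ t ≤ T, Exec O c σ t σ'

/-- A step adds at most one symbol to one stack, and a query is charged for its answer. Time bounds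
therefore double as bounds on output length. -/
theorem Exec.length_le {c : Prog Γ} {σ σ' : ℕ → List Γ} {t : ℕ} (h : Exec O c σ t σ') (i : ℕ) :
    (σ' i).length ≤ (σ i).length + t := by
  induction h with
  | skip σ => omega
  | push r a σ => by_cases h : i = r <;> simp [Function.update_apply, h]
  | pop r σ =>
    by_cases h : i = r
    · subst h; simp; omega
    · simp [Function.update_apply, h]
  | seq _ _ ih1 ih2 => omega
  | branch _ ih => omega
  | loopDone _ => omega
  | loopStep _ _ _ ih1 ih2 => omega
  | query r s σ =>
    by_cases h : i = s
    · subst h; simp; omega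
    · simp [Function.update_apply, h]

namespace Runs

variable {c d : Prog Γ} {σ σ₁ σ₂ : ℕ → List Γ} {T T₁ T₂ : ℕ}

theorem mono (h : Runs O c σ T₁ σ₁) (hT : T₁ ≤ T₂) : Runs O c σ T₂ σ₁ :=
  let ⟨t, ht, e⟩ := h
  ⟨t, ht.trans hT, e⟩

theorem length_le (h : Runs O c σ T σ₁) (i : ℕ) : (σ₁ i).length ≤ (σ i).length + T :=
  let ⟨_, ht, e⟩ := h
  (e.length_le i).trans (by omega)

theorem seq (h₁ : Runs O c σ T₁ σ₁) (h₂ : Runs O d σ₁ T₂ σ₂) :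
    Runs O (Prog.seq c d) σ (T₁ + T₂) σ₂ :=
  let ⟨_, ht₁, e₁⟩ := h₁
  let ⟨_, ht₂, e₂⟩ := h₂
  ⟨_, by omega, Exec.seq e₁ e₂⟩

theorem branch {r : ℕ} {k : Option Γ → Prog Γ} (h : Runs O (k (σ r).head?) σ T σ₁) :
    Runs O (Prog.branch r k) σ (T + 1) σ₁ :=
  let ⟨_, ht, e⟩ := h
  ⟨_, by omega, Exec.branch e⟩

theorem skip : Runs O Prog.skip σ 1 σ := ⟨1, le_rfl, Exec.skip σ⟩

theorem push (r : ℕ) (a : Γ) : Runs O (Prog.push r a) σ 1 (update σ r (a :: σ r)) :=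
  ⟨1, le_rfl, Exec.push r a σ⟩

theorem pop (r : ℕ) : Runs O (Prog.pop r) σ 1 (update σ r (σ r).tail) :=
  ⟨1, le_rfl, Exec.pop r σ⟩

theorem query (r s : ℕ) :
    Runs O (Prog.query r s) σ ((σ r).length + (O (σ r)).length + 1) (update σ s (O (σ r))) :=
  ⟨_, le_rfl, Exec.query r s σ⟩

/-- A loop that consumes the list `l`, which is held on the tested stack. -/
theorem loop_foldl {α S : Type*} {r : ℕ} (code : α → Γ) (I : List α → S → ℕ → List Γ)
    (step : S → α → S) (hI : ∀ l s, I l s r = l.map code) (s₀ : S) (l₂ : List α) :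
    ∀ l₁ : List α, (∀ m₁ a m₂, l₁ ++ l₂ = m₁ ++ a :: m₂ →
      Runs O c (I (a :: m₂) (m₁.foldl step s₀)) T (I m₂ ((m₁ ++ [a]).foldl step s₀))) →
    Runs O (Prog.loop r Option.isSome c) (I l₂ (l₁.foldl step s₀)) (l₂.length * (T + 1) + 1)
      (I [] ((l₁ ++ l₂).foldl step s₀)) := by
  -- `I m s` describes the stacks when `m` is left to read and the state is `s`. The consumed prefix
  -- `l₁` is carried along so that the body has to be analysed only in states that the fold really
  -- reaches.
  induction l₂ with
  | nil =>
    intro l₁ _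
    refine ⟨1, by simp, ?_⟩
    rw [List.append_nil]
    exact Exec.loopDone (by simp [hI])
  | cons a l ih =>
    intro l₁ h
    obtain ⟨t₁, ht₁, e₁⟩ := h l₁ a l rfl
    obtain ⟨t₂, ht₂, e₂⟩ := ih (l₁ ++ [a]) (by simpa using h)
    have hl : l₁ ++ [a] ++ l = l₁ ++ a :: l := by simp
    rw [hl] at e₂
    exact ⟨_, by rw [List.length_cons]; nlinarith, Exec.loopStep (by simp [hI]) e₁ e₂⟩

end Runs

/-! ### Basic programs -/

/-- Empty the stack `r`. -/
def clear (r : ℕ) : Prog Γ := Prog.loop r Option.isSome (Prog.pop r)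

theorem runs_clear (r : ℕ) (σ : ℕ → List Γ) :
    Runs O (clear r) σ (2 * (σ r).length + 1) (update σ r []) := by
  have h := Runs.loop_foldl (O := O) (r := r) (c := Prog.pop r) (T := 1) (S := Unit) id
    (fun l _ => update σ r l) (fun _ _ => ()) (by simp) () (σ r) [] (by
      intro m₁ a m₂ _
      simpa using Runs.pop (O := O) (σ := update σ r (a :: m₂)) r)
  simpa [mul_comm, clear] using h

/-- Move the stack `a` on top of the stack `b`, in reverse order. -/
def moveRev (a b : ℕ) : Prog Γ :=
  Prog.loop a Option.isSome (Prog.branch a fun s =>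
    match s with
    | none => Prog.skip
    | some x => Prog.seq (Prog.pop a) (Prog.push b x))

theorem runs_moveRev {a b : ℕ} (hab : a ≠ b) (σ : ℕ → List Γ) :
    Runs O (moveRev a b) σ (4 * (σ a).length + 1)
      (update (update σ a []) b ((σ a).reverse ++ σ b)) := by
  have h := Runs.loop_foldl (O := O) (r := a) (T := 3) (S := List Γ)
    (c := Prog.branch a fun s =>
      match s with
      | none => Prog.skip
      | some x => Prog.seq (Prog.pop a) (Prog.push b x)) id
    (fun l s => update (update σ a l) b s) (fun s x => x :: s)
    (by intro l s; simp [Function.update_apply, hab]) (σ b) (σ a) [] (by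
      intro m₁ x m₂ _
      apply Runs.branch (T := 2)
      simp only [Function.update_apply, hab, if_false, if_true, List.head?_cons]
      have h1 := Runs.pop (O := O)
        (σ := update (update σ a (x :: m₂)) b (m₁.foldl (fun s x => x :: s) (σ b))) a
      have h2 := h1.seq (Runs.push b x)
      convert h2 using 1
      funext i
      by_cases hb : i = b
      · subst hb; simp [Function.update_apply, hab.symm]
      · by_cases ha : i = a
        · subst ha; simp [Function.update_apply, hab]
        · simp [Function.update_apply, ha, hb])
  have e : ∀ (l s : List Γ), l.foldl (fun s x => x :: s) s = l.reverse ++ s := by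
    intro l
    induction l with
    | nil => simp
    | cons a l ih => intro s; simp [ih]
  rw [List.foldl_nil, List.nil_append, e, mul_comm] at h
  simpa [moveRev] using h

/-- Move the stack `a` to the empty stack `b`, by means of the empty stack `s`. -/
def move (a b s : ℕ) : Prog Γ := Prog.seq (moveRev a s) (moveRev s b)

theorem runs_move {a b s : ℕ} (hab : a ≠ b) (has : a ≠ s) (hbs : b ≠ s) {σ : ℕ → List Γ}
    (hb : σ b = []) (hs : σ s = []) :
    Runs O (move a b s) σ (8 * (σ a).length + 2) (update (update σ a []) b (σ a)) := by
  have h := (runs_moveRev (O := O) has σ).seq (runs_moveRev hbs.symm _)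
  refine (show Runs O (move a b s) σ _ _ from by
    unfold move
    convert h using 1
    funext i
    by_cases h1 : i = b
    · subst h1; simp [Function.update_apply, hab.symm, hbs, hb, hs]
    · by_cases h2 : i = a
      · subst h2; simp [Function.update_apply, has, h1]
      · by_cases h3 : i = s
        · subst h3; simp [Function.update_apply, hbs.symm, has.symm, hs]
        · simp [Function.update_apply, h1, h2, h3]).mono ?_
  simp [hs]
  omega

/-- Copy the stack `a` to the empty stack `b`, by means of the empty stack `s`. -/
def copy (a b s : ℕ) : Prog Γ :=
  Prog.seq (moveRev a s)
    (Prog.loop s Option.isSome (Prog.branch s fun t =>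
      match t with
      | none => Prog.skip
      | some x => Prog.seq (Prog.pop s) (Prog.seq (Prog.push a x) (Prog.push b x))))

theorem runs_copy {a b s : ℕ} (hab : a ≠ b) (has : a ≠ s) (hbs : b ≠ s) {σ : ℕ → List Γ}
    (hb : σ b = []) (hs : σ s = []) :
    Runs O (copy a b s) σ (9 * (σ a).length + 2) (update σ b (σ a)) := by
  have e : ∀ (l s : List Γ), l.foldl (fun s x => x :: s) s = l.reverse ++ s := by
    intro l
    induction l with
    | nil => simp
    | cons a l ih => intro s; simp [ih]
  have h := Runs.loop_foldl (O := O) (r := s) (T := 4) (S := List Γ)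
    (c := Prog.branch s fun t =>
      match t with
      | none => Prog.skip
      | some x => Prog.seq (Prog.pop s) (Prog.seq (Prog.push a x) (Prog.push b x))) id
    (fun l m => update (update (update σ a m) b m) s l) (fun s x => x :: s)
    (by intro l m; simp) [] (σ a).reverse [] (by
      intro m₁ x m₂ _
      apply Runs.branch (T := 3)
      simp only [Function.update_self, List.head?_cons]
      have h1 := Runs.pop (O := O)
        (σ := update (update (update σ a (m₁.foldl (fun s x => x :: s) [])) b
          (m₁.foldl (fun s x => x :: s) [])) s (x :: m₂)) s
      have h2 := h1.seq ((Runs.push a x).seq (Runs.push b x))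
      convert h2 using 1
      funext i
      by_cases h1 : i = b
      · subst h1; simp [Function.update_apply, hab.symm, hbs]
      · by_cases h2 : i = a
        · subst h2; simp [Function.update_apply, has, hab]
        · by_cases h3 : i = s
          · subst h3; simp [Function.update_apply, hbs.symm, has.symm]
          · simp [Function.update_apply, h1, h2, h3])
  have h' := (runs_moveRev (O := O) has σ).seq (σ₂ := update σ b (σ a)) (d := _) (T₂ := _) (by
    convert h using 1
    · funext i
      by_cases h1 : i = b
      · subst h1; simp [Function.update_apply, hab.symm, hbs, hb]
      · by_cases h2 : i = a
        · subst h2; simp [Function.update_apply, has, h1]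
        · by_cases h3 : i = s
          · subst h3; simp [Function.update_apply, hs]
          · simp [Function.update_apply, h1, h2, h3]
    · funext i
      by_cases h1 : i = b
      · subst h1; simp [Function.update_apply, hbs, e]
      · by_cases h2 : i = a
        · subst h2; simp [Function.update_apply, has, h1, e]
        · by_cases h3 : i = s
          · subst h3; simp [Function.update_apply, hbs.symm, hs]
          · simp [Function.update_apply, h1, h2, h3])
  refine (show Runs O (copy a b s) σ _ _ from h').mono ?_
  simp
  omega

/-! ### Blocks of consecutive stacks -/

/-- All stacks from `M` on are empty. -/
def Clean (σ : ℕ → List Γ) (M : ℕ) : Prop := ∀ i, M ≤ i → σ i = []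

/-- Store the strings of the list on the stacks `M`, `M + 1`, …. -/
def put : (ℕ → List Γ) → ℕ → List (List Γ) → ℕ → List Γ
  | σ, _, [] => σ
  | σ, M, a :: L => put (update σ M a) (M + 1) L

/-- Total length of a list of strings. -/
def totalLength (L : List (List Γ)) : ℕ := (L.map List.length).sum

@[simp] theorem totalLength_nil : totalLength ([] : List (List Γ)) = 0 := rfl

@[simp] theorem totalLength_cons (a : List Γ) (L : List (List Γ)) :
    totalLength (a :: L) = a.length + totalLength L := by simp [totalLength]

@[simp] theorem totalLength_append (L L' : List (List Γ)) :
    totalLength (L ++ L') = totalLength L + totalLength L' := by simp [totalLength]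

theorem put_of_lt {i : ℕ} (L : List (List Γ)) :
    ∀ {σ : ℕ → List Γ} {M : ℕ}, i < M → put σ M L i = σ i := by
  induction L with
  | nil => intros; rfl
  | cons a L ih =>
    intro σ M h
    rw [put, ih (by omega), update_of_ne (by omega)]

theorem put_append (L L' : List (List Γ)) :
    ∀ (σ : ℕ → List Γ) (M : ℕ), put σ M (L ++ L') = put (put σ M L) (M + L.length) L' := by
  induction L with
  | nil => intros; rfl
  | cons a L ih =>
    intro σ M
    rw [List.cons_append, put, ih, put, List.length_cons, Nat.add_assoc, Nat.add_comm 1]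

theorem Clean.mono {σ : ℕ → List Γ} {M N : ℕ} (h : Clean σ M) (hMN : M ≤ N) : Clean σ N :=
  fun i hi => h i (hMN.trans hi)

theorem Clean.update {σ : ℕ → List Γ} {M : ℕ} (h : Clean σ M) {i : ℕ} (hi : i < M)
    (a : List Γ) : Clean (update σ i a) M := fun j hj => by
  rw [update_of_ne (by omega), h j hj]

theorem Clean.update_self {σ : ℕ → List Γ} {M : ℕ} (h : Clean σ M) (a : List Γ) :
    Clean (Function.update σ M a) (M + 1) :=
  (h.mono (Nat.le_succ M)).update (Nat.lt_succ_self M) a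

theorem Clean.put (L : List (List Γ)) :
    ∀ {σ : ℕ → List Γ} {M : ℕ}, Clean σ M → Clean (put σ M L) (M + L.length) := by
  induction L with
  | nil => intro σ M h; exact h
  | cons a L ih =>
    intro σ M h
    have := ih (h.update_self a)
    rwa [Nat.add_assoc, Nat.add_comm 1] at this

theorem map_range'_put (L : List (List Γ)) :
    ∀ (σ : ℕ → List Γ) (M : ℕ), (List.range' M L.length).map (CosetWeight.put σ M L) = L := by
  induction L with
  | nil => intros; rfl
  | cons a L ih =>
    intro σ M
    rw [List.length_cons, List.range'_succ, List.map_cons, CosetWeight.put, ih,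
      put_of_lt _ (Nat.lt_succ_self M), Function.update_self]

theorem map_put_of_lt {vs : List ℕ} {M : ℕ} (h : ∀ r ∈ vs, r < M) (L : List (List Γ))
    (σ : ℕ → List Γ) : vs.map (CosetWeight.put σ M L) = vs.map σ :=
  List.map_congr_left fun r hr => put_of_lt L (h r hr)

theorem map_update_of_lt {vs : List ℕ} {M : ℕ} (h : ∀ r ∈ vs, r < M) (a : List Γ)
    (σ : ℕ → List Γ) : vs.map (update σ M a) = vs.map σ :=
  map_put_of_lt h [a] σ

theorem put_update_of_lt {i : ℕ} (a : List Γ) (L : List (List Γ)) :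
    ∀ {σ : ℕ → List Γ} {M : ℕ}, i < M →
      CosetWeight.put (update σ i a) M L = update (CosetWeight.put σ M L) i a := by
  induction L with
  | nil => intros; rfl
  | cons b L ih =>
    intro σ M h
    rw [CosetWeight.put, CosetWeight.put, update_comm (by omega), ih (by omega)]

/-- The output lands on stacks that were empty, so each output string is at most as long as the
running time. This spares separate bounds for intermediate results. -/
theorem totalLength_le_of_runs {c : Prog Γ} {σ : ℕ → List Γ} {M T : ℕ} {L : List (List Γ)}
    (hσ : Clean σ M) (h : Runs O c σ T (CosetWeight.put σ M L)) :
    totalLength L ≤ L.length * T := by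
  have key : ∀ a ∈ L.map List.length, a ≤ T := by
    intro a ha
    obtain ⟨l, hl, rfl⟩ := List.mem_map.1 ha
    rw [← map_range'_put L σ M] at hl
    obtain ⟨i, hi, rfl⟩ := List.mem_map.1 hl
    have := h.length_le i
    rw [hσ i (List.mem_range'_1.1 hi).1] at this
    simpa using this
  simpa [totalLength] using List.sum_le_card_nsmul _ _ key

/-- Empty the `k` stacks from `M` on. -/
def clearBlock : ℕ → ℕ → Prog Γ
  | _, 0 => Prog.skip
  | M, k + 1 => Prog.seq (clear M) (clearBlock (M + 1) k)

theorem clearBlock_runs (L : List (List Γ)) :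
    ∀ (τ : ℕ → List Γ) (M : ℕ), (List.range' M L.length).map τ = L →
      Runs O (clearBlock M L.length) τ (2 * totalLength L + L.length + 1)
        (CosetWeight.put τ M (List.replicate L.length [])) := by
  induction L with
  | nil => intro τ M _; exact Runs.skip.mono (by simp)
  | cons a L ih =>
    intro τ M h
    rw [List.length_cons, List.range'_succ, List.map_cons, List.cons.injEq] at h
    have h1 := runs_clear (O := O) M τ
    have h2 := ih (update τ M []) (M + 1) (by
      rw [← h.2, h.2, ← h.2]
      simp only [List.length_map, List.length_range']
      refine List.map_congr_left fun r hr => ?_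
      rw [update_of_ne (by have := (List.mem_range'_1.1 hr).1; omega)])
    refine (h1.seq h2).mono ?_
    rw [h.1]
    simp
    omega

/-- Move the `k` stacks from `M + d` on down by `d`, by means of the stack `s`. -/
def shiftBlock (d s : ℕ) : ℕ → ℕ → Prog Γ
  | _, 0 => Prog.skip
  | M, k + 1 => Prog.seq (move (M + d) M s) (shiftBlock d s (M + 1) k)

/-- Working upwards keeps every target free: it lies strictly below the unmoved strings because `d >
0`, and it was either empty from the start or has just been vacated. The auxiliary stack `s` lies
beyond the block. -/
theorem runs_shiftBlock {d s : ℕ} (hd : 0 < d) (L : List (List Γ)) :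
    ∀ (σ : ℕ → List Γ) (M : ℕ), Clean σ M → M + d + L.length ≤ s →
      Runs O (shiftBlock d s M L.length) (CosetWeight.put σ (M + d) L)
        (8 * totalLength L + 2 * L.length + 1) (CosetWeight.put σ M L) := by
  induction L with
  | nil => intro σ M _ _; exact Runs.skip.mono (by simp)
  | cons a L ih =>
    intro σ M hσ hs
    rw [List.length_cons] at hs
    have hc := (hσ.mono (show M ≤ M + d by omega)).put (a :: L)
    have hm : CosetWeight.put σ (M + d) (a :: L) (M + d) = a := by
      rw [CosetWeight.put, put_of_lt _ (by omega), Function.update_self]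
    have h1 := runs_move (O := O) (a := M + d) (b := M) (s := s) (by omega) (by omega) (by omega)
      (σ := CosetWeight.put σ (M + d) (a :: L))
      (by rw [put_of_lt _ (by omega), hσ M le_rfl])
      (hc s (by rw [List.length_cons]; omega))
    have e : update (update (CosetWeight.put σ (M + d) (a :: L)) (M + d) []) M
        (CosetWeight.put σ (M + d) (a :: L) (M + d)) =
        CosetWeight.put (update σ M a) (M + 1 + d) L := by
      rw [hm, CosetWeight.put, ← put_update_of_lt _ _ (by omega), ← put_update_of_lt _ _ (by omega),
        update_idem, (update_eq_self_iff (f := σ)).2 (hσ (M + d) (by omega)).symm,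
        show M + d + 1 = M + 1 + d by omega]
    rw [e] at h1
    refine (h1.seq (ih (update σ M a) (M + 1) (hσ.update_self a) (by omega))).mono ?_
    rw [hm]
    simp
    omega

/-- Replace the block of `k` stacks from `M` on by the block of `l` stacks from `M + k + 1` on. -/
def replaceBlock (M k l : ℕ) : Prog Γ :=
  Prog.seq (clearBlock M k) (shiftBlock (k + 1) (M + k + 1 + l) M l)

theorem put_put_replicate_nil {σ : ℕ → List Γ} (L : List (List Γ)) (N : ℕ)
    (L' : List (List Γ)) : ∀ {M : ℕ}, Clean σ M → M + L.length ≤ N →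
      CosetWeight.put (CosetWeight.put (CosetWeight.put σ M L) N L') M
        (List.replicate L.length []) = CosetWeight.put σ N L' := by
  induction L generalizing σ with
  | nil => intros; rfl
  | cons a L ih =>
    intro M hσ hN
    rw [List.length_cons] at hN
    rw [List.length_cons, List.replicate_succ, CosetWeight.put, CosetWeight.put,
      ← put_update_of_lt _ _ (by omega), ← put_update_of_lt _ _ (by omega), update_idem,
      update_eq_self_iff.2 (hσ M le_rfl).symm, ih (hσ.mono (Nat.le_succ M)) (by omega)]

theorem runs_replaceBlock {σ : ℕ → List Γ} {M : ℕ} (hσ : Clean σ M) (L L' : List (List Γ)) :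
    Runs O (replaceBlock M L.length L'.length)
      (CosetWeight.put (CosetWeight.put σ M L) (M + L.length + 1) L')
      (2 * totalLength L + L.length + 8 * totalLength L' + 2 * L'.length + 2)
      (CosetWeight.put σ M L') := by
  have h1 := clearBlock_runs (O := O) L
    (CosetWeight.put (CosetWeight.put σ M L) (M + L.length + 1) L') M (by
      rw [map_put_of_lt, map_range'_put]
      intro r hr
      have := (List.mem_range'_1.1 hr).2
      omega)
  rw [put_put_replicate_nil L _ _ hσ (by omega)] at h1
  -- The unused stack between the blocks keeps the shift distance positive even if the old block is
  -- empty.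
  have h2 := runs_shiftBlock (O := O) (d := L.length + 1) (s := M + L.length + 1 + L'.length)
    (by omega) L' σ M hσ (by omega)
  refine (h1.seq h2).mono ?_
  omega

end Machine

/-! ### Functions computable in polynomial time relative to a family of oracles -/

section PolyFun

open Function Polynomial

instance {K : Type u} [Finite K] : Finite (Sym K) := by
  refine Finite.of_injective (β := K ⊕ Bool ⊕ Bool)
    (fun s => match s with
      | Sym.elt a => Sum.inl a
      | Sym.bit b => Sum.inr (Sum.inl b)
      | Sym.comma => Sum.inr (Sum.inr true)
      | Sym.hash => Sum.inr (Sum.inr false)) ?_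
  rintro (a | b | _ | _) (a' | b' | _ | _) h <;> simp_all

/-- Types whose elements are represented by single symbols. -/
class FinCode (K : Type u) (A : Type v) where
  code : A → Sym K
  code_injective : Function.Injective code

/-- Types whose elements are represented by a fixed number of strings. -/
class Rep (K : Type u) (X : Type v) where
  num : ℕ
  enc : X → List (List (Sym K))
  length_enc : ∀ x, (enc x).length = num

variable {K : Type u} {ι : Type w} {X Y Z S A B : Type*}

/-- A family of oracles. -/
structure Oracles (K : Type u) (ι : Type w) where
  answer : ι → List (Sym K) → List (Sym K)

/-- The size of the representation. -/
def sz (K : Type u) [Rep K X] (x : X) : ℕ := totalLength (Rep.enc (K := K) x)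

/-- `f` is computable in polynomial time, uniformly for the oracles `orc.answer i`. The program `c vs M`
reads its input on the stacks `vs` and puts its output on the stacks from `M` on. -/
@[fun_prop]
def PolyFun [Rep K X] [Rep K Y] (orc : Oracles K ι) (f : X → Y) : Prop :=
  ∃ (c : List ℕ → ℕ → Prog (Sym K)) (p : Polynomial ℕ), ∀ (i : ι) (vs : List ℕ) (M : ℕ)
    (σ : ℕ → List (Sym K)) (x : X), vs.map σ = Rep.enc x → (∀ r ∈ vs, r < M) → Clean σ M →
      Runs (orc.answer i) (c vs M) σ (p.eval (sz K x)) (put σ M (Rep.enc (f x)))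

theorem eval_le_eval (p : Polynomial ℕ) {a b : ℕ} (h : a ≤ b) : p.eval a ≤ p.eval b := by
  rw [Polynomial.eval_eq_sum_range, Polynomial.eval_eq_sum_range]
  gcongr

/-! #### Representations -/

instance : FinCode K (Sym K) := ⟨id, injective_id⟩

instance : FinCode K K := ⟨Sym.elt, fun _ _ h => by injection h⟩

instance : FinCode K Bool := ⟨Sym.bit, fun _ _ h => by injection h⟩

instance [FinCode K A] : Rep K A := ⟨1, fun a => [[FinCode.code a]], fun _ => rfl⟩

instance instRepList [FinCode K A] : Rep K (List A) :=
  ⟨1, fun l => [l.map FinCode.code], fun _ => rfl⟩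

instance [Rep K X] [Rep K Y] : Rep K (X × Y) :=
  ⟨Rep.num K X + Rep.num K Y, fun z => Rep.enc z.1 ++ Rep.enc z.2, fun z => by
    rw [List.length_append, Rep.length_enc, Rep.length_enc]⟩

/-- Natural numbers are represented in unary. -/
instance instRepNat : Rep K ℕ := ⟨1, fun n => [List.replicate n (Sym.bit true)], fun _ => rfl⟩

/-- The code of a list of rows: every row ends with a comma. -/
def encRows (R : List (List K)) : List (Sym K) :=
  (R.map fun r => r.map Sym.elt ++ [Sym.comma]).flatten

instance instRepRows : Rep K (List (List K)) := ⟨1, fun R => [encRows R], fun _ => rfl⟩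

/-- The type `X`, whose elements are represented by their codes under `g`. -/
def Coded {X : Type v} (_ : X → List (Sym K)) : Type v := X

instance instRepCoded {g : X → List (Sym K)} : Rep K (Coded g) :=
  ⟨1, fun x => [g x], fun _ => rfl⟩

@[simp] theorem sz_code [FinCode K A] (a : A) : sz K a = 1 := rfl

@[simp] theorem sz_list [FinCode K A] (l : List A) : sz K l = l.length := by
  simp [sz, Rep.enc]

@[simp] theorem sz_nat (n : ℕ) : sz K n = n := by simp [sz, Rep.enc]

@[simp] theorem sz_prod [Rep K X] [Rep K Y] (z : X × Y) : sz K z = sz K z.1 + sz K z.2 := by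
  simp [sz, Rep.enc]

theorem encRows_cons (r : List K) (R : List (List K)) :
    encRows (r :: R) = r.map Sym.elt ++ Sym.comma :: encRows R := by simp [encRows]

@[simp] theorem sz_rows (R : List (List K)) : sz K R = (encRows R).length := by
  simp [sz, Rep.enc]

@[simp] theorem sz_coded {g : X → List (Sym K)} (x : Coded g) : sz K x = (g x).length := by
  simp [sz, Rep.enc]

variable [Rep K X] [Rep K Y] [Rep K Z] [Rep K S] {orc : Oracles K ι}

/-! #### Closure properties -/

namespace PolyFun

/-- Computability depends on the representations only. -/
theorem of_enc {X' Y' : Type*} [Rep K X'] [Rep K Y'] {g : X' → Y'} (hg : PolyFun orc g)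
    (r : X → X') (hr : ∀ x, Rep.enc (K := K) x = Rep.enc (K := K) (r x)) {f : X → Y}
    (hf : ∀ x, Rep.enc (K := K) (f x) = Rep.enc (K := K) (g (r x))) : PolyFun orc f := by
  obtain ⟨c, p, h⟩ := hg
  refine ⟨c, p, fun i vs M σ x h1 h2 h3 => ?_⟩
  rw [hf, sz, hr]
  exact h i vs M σ (r x) (by rw [h1, hr]) h2 h3

/-- A function with another codomain of the same representation. -/
theorem of_enc_right {Y' : Type*} [Rep K Y'] {g : X → Y'} (hg : PolyFun orc g) {f : X → Y}
    (hf : ∀ x, Rep.enc (K := K) (f x) = Rep.enc (K := K) (g x)) : PolyFun orc f :=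
  hg.of_enc id (fun _ => rfl) hf

theorem congr {f g : X → Y} (hg : PolyFun orc g) (h : ∀ x, f x = g x) : PolyFun orc f :=
  (funext h : f = g) ▸ hg

/-- Copy the stacks of the list to the stacks from `M` on. -/
def copyAll : List ℕ → ℕ → Prog (Sym K)
  | [], _ => Prog.skip
  | r :: vs, M => Prog.seq (copy r M (M + 1)) (copyAll vs (M + 1))

theorem runs_copyAll {O : List (Sym K) → List (Sym K)} (vs : List ℕ) :
    ∀ (σ : ℕ → List (Sym K)) (M : ℕ), (∀ r ∈ vs, r < M) → Clean σ M →
      Runs O (copyAll vs M) σ (9 * totalLength (vs.map σ) + 2 * vs.length + 1)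
        (put σ M (vs.map σ)) := by
  induction vs with
  | nil => intro σ M _ _; exact Runs.skip.mono (by simp)
  | cons r vs ih =>
    intro σ M h hσ
    have hr : r < M := h r (by simp)
    have hvs : ∀ r ∈ vs, r < M := fun s hs => h s (by simp [hs])
    have h1 := runs_copy (O := O) (a := r) (b := M) (s := M + 1) (by omega) (by omega) (by omega)
      (hσ M le_rfl) (hσ (M + 1) (by omega))
    have h2 := ih (update σ M (σ r)) (M + 1) (fun s hs => (hvs s hs).trans (by omega))
      (hσ.update_self _)
    rw [map_update_of_lt hvs] at h2
    refine (h1.seq h2).mono ?_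
    simp
    omega

/-- The identity and the projections only choose among the input stacks by position, so copying is
enough. -/
theorem of_select {f : X → Y} (s : List ℕ → List ℕ) (hs : ∀ vs, ∀ r ∈ s vs, r ∈ vs)
    (h : ∀ (vs : List ℕ) (σ : ℕ → List (Sym K)) x, vs.map σ = Rep.enc x →
      (s vs).map σ = Rep.enc (f x)) (hsz : ∀ x, sz K (f x) ≤ sz K x) : PolyFun orc f := by
  refine ⟨fun vs M => copyAll (s vs) M, (9 : Polynomial ℕ) * Polynomial.X + ((2 * Rep.num K Y + 1 : ℕ) : Polynomial ℕ),
    fun i vs M σ x h1 h2 h3 => ?_⟩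
  have := runs_copyAll (O := orc.answer i) (s vs) σ M (fun r hr => h2 r (hs vs r hr)) h3
  have hl : (s vs).length = Rep.num K Y := by
    rw [← List.length_map (f := σ), h vs σ x h1, Rep.length_enc]
  rw [h vs σ x h1, hl] at this
  refine this.mono ?_
  have := hsz x
  rw [sz] at this
  simp
  omega

@[fun_prop]
theorem id : PolyFun orc (fun x : X => x) :=
  of_select (fun vs => vs) (fun _ _ h => h) (fun _ _ _ h => h) (fun _ => le_rfl)

@[fun_prop]
theorem fst' : PolyFun orc (fun z : X × Y => z.1) := by
  refine of_select (fun vs => vs.take (Rep.num K X)) (fun _ _ h => List.mem_of_mem_take h)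
    (fun vs σ z h => ?_) (fun z => by simp)
  rw [List.map_take, h, ← Rep.length_enc (K := K) z.1]
  exact List.take_left

@[fun_prop]
theorem snd' : PolyFun orc (fun z : X × Y => z.2) := by
  refine of_select (fun vs => vs.drop (Rep.num K X)) (fun _ _ h => List.mem_of_mem_drop h)
    (fun vs σ z h => ?_) (fun z => by simp)
  rw [List.map_drop, h, ← Rep.length_enc (K := K) z.1]
  exact List.drop_left

-- The intermediate value stays on the block from `M`, the second program writes above it, and its
-- result then replaces the block. The intermediate size is at most the number of its stacks times
-- the first running time, whence the argument `Rep.num K Y * p` of `q`.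
@[fun_prop]
theorem comp {g : Y → Z} {f : X → Y} (hg : PolyFun orc g) (hf : PolyFun orc f) :
    PolyFun orc (fun x => g (f x)) := by
  obtain ⟨c, p, hc⟩ := hf
  obtain ⟨d, q, hd⟩ := hg
  refine ⟨fun vs M => Prog.seq (c vs M)
    (Prog.seq (d (List.range' M (Rep.num K Y)) (M + Rep.num K Y + 1))
      (replaceBlock M (Rep.num K Y) (Rep.num K Z))),
    p + (q.comp (Rep.num K Y * p) + (2 * (Rep.num K Y * p) + Rep.num K Y +
      8 * (Rep.num K Z * q.comp (Rep.num K Y * p)) + (2 * Rep.num K Z + 2 : ℕ))),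
    fun i vs M σ x h1 h2 h3 => ?_⟩
  have r1 := hc i vs M σ x h1 h2 h3
  have b1 := totalLength_le_of_runs h3 r1
  have hc2 := h3.put (Rep.enc (K := K) (f x))
  rw [Rep.length_enc] at b1 hc2
  have hm := map_range'_put (Rep.enc (K := K) (f x)) σ M
  rw [Rep.length_enc] at hm
  have r2 := hd i (List.range' M (Rep.num K Y)) (M + Rep.num K Y + 1) _ (f x) hm
    (fun r hr => by have := (List.mem_range'_1.1 hr).2; omega) (hc2.mono (by omega))
  have b2 := totalLength_le_of_runs (hc2.mono (by omega)) r2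
  have r3 := runs_replaceBlock (O := orc.answer i) h3 (Rep.enc (K := K) (f x))
    (Rep.enc (K := K) (g (f x)))
  rw [Rep.length_enc, Rep.length_enc] at r3
  rw [Rep.length_enc] at b2
  refine (r1.seq (r2.seq r3)).mono ?_
  have e1 : q.eval (sz K (f x)) ≤ q.eval (Rep.num K Y * p.eval (sz K x)) := eval_le_eval q b1
  have e2 := b2.trans (Nat.mul_le_mul_left (Rep.num K Z) e1)
  simp only [eval_add, eval_comp, eval_mul, eval_natCast, eval_ofNat]
  simp
  omega

@[fun_prop]
theorem pair' {f : X → Y} {g : X → Z} (hf : PolyFun orc f) (hg : PolyFun orc g) :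
    PolyFun orc (fun x => (f x, g x)) := by
  obtain ⟨c, p, hc⟩ := hf
  obtain ⟨d, q, hd⟩ := hg
  refine ⟨fun vs M => Prog.seq (c vs M) (d vs (M + Rep.num K Y)), p + q,
    fun i vs M σ x h1 h2 h3 => ?_⟩
  have r1 := hc i vs M σ x h1 h2 h3
  have hc2 := h3.put (Rep.enc (K := K) (f x))
  rw [Rep.length_enc] at hc2
  have r2 := hd i vs (M + Rep.num K Y) _ x (by rw [map_put_of_lt h2, h1])
    (fun r hr => (h2 r hr).trans_le (by omega)) hc2
  rw [eval_add]
  convert r1.seq r2 using 1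
  rw [← Rep.length_enc (K := K) (f x), ← put_append]
  rfl

/-- Write the string `a` on the stack `M`. -/
def pushList (M : ℕ) : List (Sym K) → Prog (Sym K)
  | [] => Prog.skip
  | s :: a => Prog.seq (pushList M a) (Prog.push M s)

theorem runs_pushList {O : List (Sym K) → List (Sym K)} (M : ℕ) (a : List (Sym K))
    {σ : ℕ → List (Sym K)} (hσ : σ M = []) :
    Runs O (pushList M a) σ (a.length + 1) (update σ M a) := by
  induction a with
  | nil =>
    rw [update_eq_self_iff.2 hσ.symm]
    exact Runs.skip
  | cons s a ih => simpa [pushList] using ih.seq (Runs.push M s)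

/-- Write the strings of the list on the stacks from `M` on. -/
def pushAll : ℕ → List (List (Sym K)) → Prog (Sym K)
  | _, [] => Prog.skip
  | M, a :: L => Prog.seq (pushList M a) (pushAll (M + 1) L)

theorem runs_pushAll {O : List (Sym K) → List (Sym K)} (L : List (List (Sym K))) :
    ∀ (M : ℕ) (σ : ℕ → List (Sym K)), Clean σ M →
      Runs O (pushAll M L) σ (totalLength L + L.length + 1) (put σ M L) := by
  induction L with
  | nil => intro M σ _; exact Runs.skip.mono (by simp)
  | cons a L ih =>
    intro M σ hσ
    refine ((runs_pushList M a (hσ M le_rfl)).seq (ih (M + 1) _ (hσ.update_self a))).mono ?_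
    simp
    omega

@[fun_prop]
theorem const (y : Y) : PolyFun orc (fun _ : X => y) := by
  refine ⟨fun _ M => pushAll M (Rep.enc y), ((sz K y + Rep.num K Y + 1 : ℕ) : Polynomial ℕ),
    fun i vs M σ x _ _ h3 => ?_⟩
  have := runs_pushAll (O := orc.answer i) (Rep.enc (K := K) y) M σ h3
  rw [Rep.length_enc] at this
  exact this.mono (by simp [sz])

@[fun_prop]
theorem cons_const [FinCode K A] (a : A) {l : X → List A} (hl : PolyFun orc l) :
    PolyFun orc (fun x => a :: l x) := by
  obtain ⟨c, p, hc⟩ := hl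
  refine ⟨fun vs M => Prog.seq (c vs M) (Prog.push M (FinCode.code a)), p + 1,
    fun i vs M σ x h1 h2 h3 => ?_⟩
  have := (hc i vs M σ x h1 h2 h3).seq (Runs.push M (FinCode.code a))
  simpa [Rep.enc, put] using this

/-- The branch of a program for the element with a given code. -/
noncomputable def onCode [FinCode K A] (c : A → Prog (Sym K)) (s : Sym K) : Prog (Sym K) :=
  open Classical in if h : ∃ a : A, FinCode.code a = s then c h.choose else Prog.skip

theorem onCode_code [FinCode K A] (c : A → Prog (Sym K)) (a : A) :
    onCode c (FinCode.code a) = c a := by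
  have h : ∃ b : A, FinCode.code (K := K) b = FinCode.code a := ⟨a, rfl⟩
  rw [onCode, dif_pos h, FinCode.code_injective h.choose_spec]

theorem finite_of_finCode (K : Type u) [Finite K] (A : Type*) [FinCode K A] : Finite A :=
  Finite.of_injective _ (FinCode.code_injective (K := K) (A := A))

/-- A family of functions indexed by symbols has programs with a common time bound. -/
theorem exists_uniform [Finite K] [FinCode K A] {f : A → X → Y}
    (h : ∀ a, PolyFun orc (f a)) :
    ∃ (c : A → List ℕ → ℕ → Prog (Sym K)) (p : Polynomial ℕ), ∀ (a : A) (i : ι) (vs : List ℕ)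
      (M : ℕ) (σ : ℕ → List (Sym K)) (x : X), vs.map σ = Rep.enc x → (∀ r ∈ vs, r < M) →
        Clean σ M → Runs (orc.answer i) (c a vs M) σ (p.eval (sz K x)) (put σ M (Rep.enc (f a x))) := by
  choose c p hc using h
  have := finite_of_finCode K A
  have := Fintype.ofFinite A
  refine ⟨c, ∑ a, p a, fun a i vs M σ x h1 h2 h3 => (hc a i vs M σ x h1 h2 h3).mono ?_⟩
  rw [eval_finsetSum]
  exact Finset.single_le_sum (f := fun a => (p a).eval (sz K x)) (fun _ _ => Nat.zero_le _)
    (Finset.mem_univ a)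

/-- A top symbol has finitely many values, so each value gets its own branch in the control of the
program. Once the top is popped, stack `M` holds the tail and serves as an additional input; the
result is written from `M + 2` and moved down. -/
theorem caseList [Finite K] [FinCode K A] {l : X → List A} (hl : PolyFun orc l) {f : X → Y}
    (hf : PolyFun orc f) {g : A → X × List A → Y} (hg : ∀ a, PolyFun orc (g a)) :
    PolyFun orc (fun x => match l x with
      | [] => f x
      | a :: m => g a (x, m)) := by
  obtain ⟨c, p, hc⟩ := hl
  obtain ⟨d, q, hd⟩ := hf
  obtain ⟨e, r, he⟩ := exists_uniform hg
  let P : Polynomial ℕ := r.comp (Polynomial.X + p)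
  let k : List ℕ → ℕ → Option (Sym K) → Prog (Sym K) := fun vs M s =>
    match s with
    | none => d vs M
    | some s => onCode (fun a => Prog.seq (Prog.pop M) (Prog.seq (e a (vs ++ [M]) (M + 1 + 1))
        (replaceBlock M 1 (Rep.num K Y)))) s
  refine ⟨fun vs M => Prog.seq (c vs M) (Prog.branch M (k vs M)),
    p + (q + (1 + (P + (2 * p + (8 * (Rep.num K Y * P) + (2 * Rep.num K Y + 3 : ℕ))))) + 1),
    fun i vs M σ x h1 h2 h3 => ?_⟩
  have r1 := hc i vs M σ x h1 h2 h3
  have b1 := totalLength_le_of_runs h3 r1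
  rcases hlx : l x with _ | ⟨a, m⟩
  · have e0 : put σ M (Rep.enc (l x)) = σ := by
      simpa [hlx, Rep.enc, put] using (h3 M le_rfl)
    rw [e0] at r1
    simp only [hlx]
    refine (r1.seq (Runs.branch (k := k vs M) (T := q.eval (sz K x)) (r := M)
      (σ₁ := put σ M (Rep.enc (f x))) ?_)).mono ?_
    · simpa [h3 M le_rfl, k] using hd i vs M σ x h1 h2 h3
    · simp
  · rw [hlx] at r1 b1
    simp only [hlx]
    have e0 : put σ M (Rep.enc (a :: m)) = update σ M (FinCode.code a :: m.map FinCode.code) := rfl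
    rw [e0] at r1
    have r2 := Runs.pop (O := orc.answer i) (σ := update σ M (FinCode.code a :: m.map FinCode.code)) M
    simp only [update_self, List.tail_cons, update_idem] at r2
    have hc1 := h3.update_self (m.map FinCode.code)
    have r3 := he a i (vs ++ [M]) (M + 1 + 1) (update σ M (m.map FinCode.code)) (x, m)
      (by simp only [List.map_append, map_update_of_lt h2, h1]; simp [Rep.enc])
      (fun r hr => by
        rcases List.mem_append.1 hr with hr | hr
        · have := h2 r hr; omega
        · simp at hr; omega) (hc1.mono (by omega))
    have b3 := totalLength_le_of_runs (hc1.mono (by omega)) r3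
    have r4 := runs_replaceBlock (O := orc.answer i) h3 [m.map (FinCode.code (K := K))]
      (Rep.enc (K := K) (g a (x, m)))
    rw [Rep.length_enc] at r4 b3
    refine (r1.seq (Runs.branch (k := k vs M) (r := M) (T := _) (σ₁ := put σ M (Rep.enc (g a (x, m)))) (by
      simp only [k, update_self, List.head?_cons, onCode_code]
      exact r2.seq (r3.seq r4)))).mono ?_
    have s1 : sz K (x, m) ≤ sz K x + p.eval (sz K x) := by
      simp [Rep.enc] at b1 ⊢
      omega
    have s2 : r.eval (sz K (x, m)) ≤ P.eval (sz K x) := by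
      simpa [P] using eval_le_eval r s1
    have s3 := b3.trans (Nat.mul_le_mul_left (Rep.num K Y) s2)
    simp only [eval_add, eval_mul, eval_natCast, eval_ofNat, eval_one, totalLength_cons,
      totalLength_nil, List.length_cons, List.length_nil, List.length_map]
    simp [Rep.enc] at b1
    push_cast
    omega

/-- Polynomial-time steps alone would not suffice, since a step may double its state. Hence the
hypothesis `hq`, which bounds every intermediate state by one polynomial. -/
theorem foldl [Finite K] [FinCode K A] {l : X → List A} (hl : PolyFun orc l) {s₀ : X → S}
    (h₀ : PolyFun orc s₀) {step : A → X × S → S} (hstep : ∀ a, PolyFun orc (step a))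
    (q : Polynomial ℕ) (hq : ∀ x l₁ l₂, l x = l₁ ++ l₂ →
      sz K (l₁.foldl (fun s a => step a (x, s)) (s₀ x)) ≤
        q.eval (sz K x + (l x).length + sz K (s₀ x))) :
    PolyFun orc (fun x => (l x).foldl (fun s a => step a (x, s)) (s₀ x)) := by
  obtain ⟨c, p, hc⟩ := hl
  obtain ⟨d, p₀, hd⟩ := h₀
  obtain ⟨e, r, he⟩ := exists_uniform hstep
  set n := Rep.num K S with hn
  -- The three summands bound the sizes of the input, of the list and of the initial state, so `B`
  -- bounds all states in terms of the input alone.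
  let B : Polynomial ℕ := q.comp (Polynomial.X + p + (n : Polynomial ℕ) * p₀)
  let body : List ℕ → ℕ → Prog (Sym K) := fun vs M => Prog.branch M fun s =>
    match s with
    | none => Prog.skip
    | some s => onCode (fun a => Prog.seq (Prog.pop M)
        (Prog.seq (e a (vs ++ List.range' (M + 1) n) (M + 1 + n + 1))
          (replaceBlock (M + 1) n n))) s
  let P : Polynomial ℕ := r.comp (Polynomial.X + B)
  let T : Polynomial ℕ := (1 + (P + (10 * B + (3 * n + 2 : ℕ)))) + 1
  refine ⟨fun vs M => Prog.seq (c vs M) (Prog.seq (d vs (M + 1))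
    (Prog.seq (Prog.loop M Option.isSome (body vs M)) (replaceBlock M 0 n))),
    p + (p₀ + (p * (T + 1) + 1 + (8 * B + (2 * n + 2 : ℕ)))), fun i vs M σ x h1 h2 h3 => ?_⟩
  have r1 := hc i vs M σ x h1 h2 h3
  have b1 : (l x).length ≤ p.eval (sz K x) := by
    have := totalLength_le_of_runs h3 r1
    simpa [Rep.enc] using this
  let I : List A → S → ℕ → List (Sym K) := fun m s =>
    put (update σ M (m.map FinCode.code)) (M + 1) (Rep.enc s)
  have r2 : Runs (orc.answer i) (d vs (M + 1)) (put σ M (Rep.enc (l x))) (p₀.eval (sz K x))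
      (I (l x) (s₀ x)) := hd i vs (M + 1) _ x
      (by rw [map_put_of_lt h2, h1]) (fun r hr => (h2 r hr).trans (by omega))
      (by simpa [Rep.enc] using h3.put (Rep.enc (K := K) (l x)))
  have b2 : sz K (s₀ x) ≤ n * p₀.eval (sz K x) := by
    have := totalLength_le_of_runs (by simpa [Rep.enc] using h3.put (Rep.enc (K := K) (l x))) r2
    rwa [Rep.length_enc] at this
  have hB : ∀ l₁ l₂, l x = l₁ ++ l₂ →
      sz K (l₁.foldl (fun s a => step a (x, s)) (s₀ x)) ≤ B.eval (sz K x) := fun l₁ l₂ h => by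
    refine (hq x l₁ l₂ h).trans ?_
    simp only [B, eval_comp, eval_add, eval_mul, eval_X, eval_natCast, Nat.cast_id]
    exact eval_le_eval q (by omega)
  have hbody : ∀ (a : A) (m : List A) (s : S), sz K s ≤ B.eval (sz K x) →
      sz K (step a (x, s)) ≤ B.eval (sz K x) →
      Runs (orc.answer i) (body vs M) (I (a :: m) s) (T.eval (sz K x)) (I m (step a (x, s))) := by
    intro a m s hs hs'
    have hM : ∀ m, I m s M = m.map FinCode.code := fun m => by
      simp only [I]
      rw [put_of_lt _ (Nat.lt_succ_self M), update_self]
    have q1 := Runs.pop (O := orc.answer i) (σ := I (a :: m) s) M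
    have e1 : update (I (a :: m) s) M (I (a :: m) s M).tail = I m s := by
      rw [hM]
      simp only [I]
      rw [← put_update_of_lt _ _ (Nat.lt_succ_self M), update_idem, List.map_cons, List.tail_cons]
    rw [e1] at q1
    have hcl := h3.update_self (m.map FinCode.code)
    have hcl2 := hcl.put (Rep.enc (K := K) s)
    rw [Rep.length_enc] at hcl2
    have hmr := map_range'_put (Rep.enc (K := K) s) (update σ M (m.map FinCode.code)) (M + 1)
    rw [Rep.length_enc] at hmr
    have q2 := he a i (vs ++ List.range' (M + 1) n) (M + 1 + n + 1) (I m s) (x, s)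
      (by
        rw [List.map_append, hmr, map_put_of_lt (fun r hr => (h2 r hr).trans (by omega)),
          map_update_of_lt h2, h1]
        rfl)
      (fun r hr => by
        rcases List.mem_append.1 hr with hr | hr
        · have := h2 r hr; omega
        · have := (List.mem_range'_1.1 hr).2; omega) (hcl2.mono (by omega))
    have q3 := runs_replaceBlock (O := orc.answer i) hcl (Rep.enc (K := K) s)
      (Rep.enc (K := K) (step a (x, s)))
    rw [Rep.length_enc, Rep.length_enc] at q3
    refine (Runs.branch (r := M) (T := _) (σ₁ := I m (step a (x, s))) (by
      rw [hM]
      simp only [List.map_cons, List.head?_cons, onCode_code]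
      exact q1.seq (q2.seq q3))).mono ?_
    have s1 : r.eval (sz K (x, s)) ≤ P.eval (sz K x) := by
      have : sz K (x, s) ≤ sz K x + B.eval (sz K x) := by simpa using hs
      simpa [P] using eval_le_eval r this
    rw [sz] at hs hs'
    simp only [T, eval_add, eval_mul, eval_natCast, eval_ofNat, eval_one]
    push_cast
    omega
  have r3 := Runs.loop_foldl (O := orc.answer i) (r := M) (c := body vs M) (T := T.eval (sz K x))
    FinCode.code I (fun s a => step a (x, s))
    (fun m s => by
      simp only [I]
      rw [put_of_lt _ (Nat.lt_succ_self M), update_self]) (s₀ x) (l x) []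
    (fun m₁ a m₂ h => by
      rw [List.foldl_append]
      exact hbody a m₂ _ (hB m₁ _ h) (by
        have := hB (m₁ ++ [a]) m₂ (by rw [← List.nil_append (l x), h]; simp)
        rwa [List.foldl_append] at this))
  rw [List.foldl_nil, List.nil_append] at r3
  set s' := (l x).foldl (fun s a => step a (x, s)) (s₀ x) with hs'
  -- The loop has emptied stack `M`. The state above it thus counts as the result next to an empty
  -- block, and is moved down by one stack.
  have r4 := runs_replaceBlock (O := orc.answer i) h3 [] (Rep.enc (K := K) s')
  have e4 : put (put σ M []) (M + List.length ([] : List (List (Sym K))) + 1) (Rep.enc s') =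
      I [] s' := by
    simp only [I, put, List.map_nil, List.length_nil, Nat.add_zero]
    rw [update_eq_self_iff.2 (h3 M le_rfl).symm]
  rw [e4, Rep.length_enc] at r4
  refine (r1.seq (r2.seq (r3.seq r4))).mono ?_
  have b4 := hB (l x) [] (by simp)
  rw [← hs', sz] at b4
  have b5 := Nat.mul_le_mul_right (T.eval (sz K x) + 1) b1
  simp only [eval_add, eval_mul, eval_natCast, eval_ofNat, eval_one]
  simp only [totalLength_nil, List.length_nil]
  push_cast
  omega

/-- An oracle call followed by a computation that depends on the answer only. -/
theorem query {q : X → List (Sym K)} (hq : PolyFun orc q) {post : List (Sym K) → Y}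
    (hpost : PolyFun orc post) {f : X → Y} (hf : ∀ i x, post (orc.answer i (q x)) = f x)
    (b : Polynomial ℕ) (hb : ∀ i x, (orc.answer i (q x)).length ≤ b.eval (sz K x)) : PolyFun orc f := by
  obtain ⟨c, p, hc⟩ := hq
  obtain ⟨d, r, hd⟩ := hpost
  refine ⟨fun vs M => Prog.seq (c vs M) (Prog.seq (Prog.query M (M + 1))
    (Prog.seq (d [M + 1] (M + 2 + 1)) (replaceBlock M 2 (Rep.num K Y)))),
    p + (p + b + 1 + (r.comp b + (2 * (p + b) + (8 * (Rep.num K Y * r.comp b) +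
      (2 * Rep.num K Y + 4 : ℕ))))), fun i vs M σ x h1 h2 h3 => ?_⟩
  have r1 := hc i vs M σ x h1 h2 h3
  have b1 : (q x).length ≤ p.eval (sz K x) := by
    have := totalLength_le_of_runs h3 r1
    simpa [Rep.enc] using this
  have e1 : put σ M (Rep.enc (q x)) = update σ M (q x) := by
    change update σ M ((q x).map FinCode.code) = _
    rw [show (FinCode.code : Sym K → Sym K) = _root_.id from rfl, List.map_id]
  rw [e1] at r1
  have r2 := Runs.query (O := orc.answer i) (σ := update σ M (q x)) M (M + 1)
  simp only [update_self] at r2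
  set a := orc.answer i (q x) with ha
  have hcl : Clean (update (update σ M (q x)) (M + 1) a) (M + 2) :=
    (h3.update_self _).update_self _
  have r3 := hd i [M + 1] (M + 2 + 1) (update (update σ M (q x)) (M + 1) a) a
    (by
      change [_] = [a.map FinCode.code]
      rw [show (FinCode.code : Sym K → Sym K) = _root_.id from rfl, List.map_id, update_self])
    (by simp) (hcl.mono (by omega))
  have b3 := totalLength_le_of_runs (hcl.mono (by omega)) r3
  have r4 := runs_replaceBlock (O := orc.answer i) h3 [q x, a] (Rep.enc (K := K) (f x))
  rw [Rep.length_enc] at r4 b3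
  rw [hf] at r3 b3
  refine (r1.seq (r2.seq (r3.seq r4))).mono ?_
  -- The answer is charged by its length, which only `hb` controls.
  have b4 : a.length ≤ b.eval (sz K x) := hb i x
  have s1 : r.eval (sz K a) ≤ r.eval (b.eval (sz K x)) := by
    rw [sz_list]
    exact eval_le_eval r b4
  have s2 := b3.trans (Nat.mul_le_mul_left (Rep.num K Y) s1)
  simp only [eval_add, eval_mul, eval_natCast, eval_ofNat, eval_one, eval_comp]
  simp only [totalLength_nil, totalLength_cons, List.length_nil, List.length_cons]
  push_cast
  omega

end PolyFun

/-- A function between sets of strings that is computable in polynomial time has a program for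
it. -/
theorem PolyFun.exists_outputs {X Y : Type*} {g : X → List (Sym K)} {h : Y → List (Sym K)}
    {f : Coded g → Coded h} (hf : PolyFun orc f) :
    ∃ (c : Prog (Sym K)) (p : Polynomial ℕ), ∀ i x,
      Outputs (orc.answer i) c (g x) (p.eval (g x).length) (h (f x)) := by
  obtain ⟨c, p, hc⟩ := hf
  refine ⟨Prog.seq (c [0] 1) (Prog.seq (clear 0) (move 1 0 2)),
    p + (2 * Polynomial.X + 1 + (8 * p + 2)), fun i (x : Coded g) => ?_⟩
  set σ : ℕ → List (Sym K) := update (fun _ => []) 0 (g x) with hσ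
  have h3 : Clean σ 1 := fun j hj => by rw [hσ, update_of_ne (by omega)]
  have r1 := hc i [0] 1 σ x rfl (by simp) h3
  have b1 : (h (f x)).length ≤ p.eval (sz K x) := by
    have := totalLength_le_of_runs h3 r1
    simpa [Rep.enc] using this
  have e1 : put σ 1 (Rep.enc (f x)) = update σ 1 (h (f x)) := rfl
  rw [e1] at r1
  have r2 := runs_clear (O := orc.answer i) 0 (update σ 1 (h (f x)))
  have r3 := runs_move (O := orc.answer i) (a := 1) (b := 0) (s := 2) (by omega) (by omega) (by omega)
    (σ := update (update σ 1 (h (f x))) 0 []) (by simp) (by simp [Function.update_apply, hσ])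
  obtain ⟨t, ht, e⟩ := r1.seq (r2.seq r3)
  refine ⟨t, _, e, ht.trans ?_, by simp [Function.update_apply]⟩
  have e2 : σ 0 = g x := by simp [hσ]
  rw [sz_coded] at b1
  simp only [eval_add, eval_mul, eval_X, eval_ofNat, eval_one, sz_coded]
  simp [Function.update_apply, e2]
  omega

end PolyFun

/-! ### Polynomial-time functions on lists -/

section Lists

open Polynomial

variable {K : Type u} {ι : Type w} {X Y Z S A B : Type*} [Rep K X] [Rep K Y] [Rep K Z] [Rep K S]
  {orc : Oracles K ι} [FinCode K A] [FinCode K B]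

/-- Equality of lists as a Boolean function. -/
noncomputable def listEq (l m : List A) : Bool := open Classical in decide (l = m)

@[simp] theorem listEq_iff (l m : List A) : listEq l m = true ↔ l = m := by simp [listEq]

/-- Equality of symbols as a Boolean function. -/
noncomputable def codeEq (a b : A) : Bool := open Classical in decide (a = b)

@[simp] theorem codeEq_iff (a b : A) : codeEq a b = true ↔ a = b := by simp [codeEq]

/-- Equality of natural numbers as a Boolean function. -/
def natEq (m n : ℕ) : Bool := decide (m = n)

@[simp] theorem natEq_iff (m n : ℕ) : natEq m n = true ↔ m = n := by simp [natEq]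

/-- `zipWith` for lists of possibly different lengths; the second list is extended by `d` or cut
off. -/
def zipD {C D E : Type*} (f : C → D → E) (d : D) : List C → List D → List E
  | [], _ => []
  | a :: l, m => f a (m.headD d) :: zipD f d l m.tail

theorem length_zipD {C D E : Type*} (f : C → D → E) (d : D) (l : List C) :
    ∀ m : List D, (zipD f d l m).length = l.length := by
  induction l with
  | nil => intro m; rfl
  | cons a l ih => intro m; simp [zipD, ih]

/-- The scalar product of lists; the second list is extended by zeros or cut off. -/
def dot [Field K] : List K → List K → K
  | [], _ => 0
  | a :: l, m => a * m.headD 0 + dot l m.tail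

/-- The least `u ≤ n` with `P u`, and `n` if there is none. -/
def search (P : ℕ → Bool) (n : ℕ) : ℕ := (fun u => bif P u then u else u + 1)^[n] 0

theorem search_spec (P : ℕ → Bool) (n : ℕ) :
    search P n ≤ n ∧ (∀ v < search P n, P v = false) ∧
      (search P n < n → P (search P n) = true) := by
  induction n with
  | zero => simp [search]
  | succ n ih =>
    have e : search P (n + 1) = bif P (search P n) then search P n else search P n + 1 := by
      rw [search, Function.iterate_succ_apply', ← search]
    obtain ⟨h1, h2, h3⟩ := ih
    rcases h : P (search P n) with _ | _
    · simp only [e, h, cond_false]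
      have : search P n = n := by
        by_contra hne
        have := h3 (by omega)
        simp [this] at h
      refine ⟨by omega, fun v hv => ?_, fun hlt => by omega⟩
      rcases Nat.lt_succ_iff_lt_or_eq.1 hv with hv | rfl
      · exact h2 v hv
      · exact h
    · simp only [e, h, cond_true]
      exact ⟨by omega, h2, fun _ => trivial⟩

theorem search_eq {P : ℕ → Bool} {n v : ℕ} (hv : v ≤ n) (h : P v = true)
    (hlt : ∀ u < v, P u = false) : search P n = v := by
  obtain ⟨h1, h2, h3⟩ := search_spec P n
  rcases lt_trichotomy (search P n) v with hs | hs | hs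
  · have := h3 (by omega)
    simp [hlt _ hs] at this
  · exact hs
  · simp [h2 v hs] at h

/-- The successor of a number in binary. -/
def incBits : List Bool → List Bool
  | [] => [true]
  | false :: l => true :: l
  | true :: l => false :: incBits l

theorem length_incBits_le (l : List Bool) : (incBits l).length ≤ l.length + 1 := by
  induction l with
  | nil => simp [incBits]
  | cons b l ih => cases b <;> simp [incBits]; omega

theorem bits_succ (n : ℕ) : (n + 1).bits = incBits n.bits := by
  induction n using Nat.strong_induction_on with
  | _ n ih =>
    obtain ⟨k, rfl | rfl⟩ := Nat.even_or_odd' n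
    · rw [Nat.bit1_bits]
      rcases Nat.eq_zero_or_pos k with rfl | hk
      · simp [incBits]
      · rw [Nat.bit0_bits k (by omega), incBits]
    · rw [Nat.bit1_bits, incBits, ← ih k (by omega), show 2 * k + 1 + 1 = 2 * (k + 1) by ring,
        Nat.bit0_bits (k + 1) (by omega)]

theorem bits_eq_iterate (n : ℕ) : n.bits = incBits^[n] [] := by
  induction n with
  | zero => simp
  | succ n ih => rw [Function.iterate_succ_apply', ← ih, bits_succ]

/-- Horner evaluation of the bits is a left inverse. -/
theorem bits_injective : Function.Injective Nat.bits := by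
  intro m n h
  have key : ∀ n : ℕ, n.bits.foldr (fun b s => 2 * s + b.toNat) 0 = n := by
    intro n
    induction n using Nat.strong_induction_on with
    | _ n ih =>
      obtain ⟨k, rfl | rfl⟩ := Nat.even_or_odd' n
      · rcases Nat.eq_zero_or_pos k with rfl | hk
        · simp
        · rw [Nat.bit0_bits k (by omega), List.foldr_cons, ih k (by omega)]
          simp
      · rw [Nat.bit1_bits, List.foldr_cons, ih k (by omega)]
        simp
  rw [← key m, h, key n]

theorem encNat_injective : Function.Injective (encNat : ℕ → List (Sym K)) := by
  intro m n h
  exact bits_injective (List.map_injective_iff.2 (fun _ _ h => by injection h) h)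

theorem length_bits_le (n : ℕ) : n.bits.length ≤ n := by
  induction n with
  | zero => simp
  | succ n ih =>
    rw [bits_succ]
    exact (length_incBits_le _).trans (by omega)

theorem length_encNat_le (n : ℕ) : (encNat n : List (Sym K)).length ≤ n := by
  simpa [encNat] using length_bits_le n

namespace PolyFun

theorem of_isEmpty [IsEmpty X] (f : X → Y) : PolyFun orc f :=
  ⟨fun _ _ => Prog.skip, 0, fun _ _ _ _ x => isEmptyElim x⟩

@[fun_prop]
theorem fst {f : X → Y × Z} (hf : PolyFun orc f) : PolyFun orc (fun x => (f x).1) := fst'.comp hf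

@[fun_prop]
theorem snd {f : X → Y × Z} (hf : PolyFun orc f) : PolyFun orc (fun x => (f x).2) := snd'.comp hf

variable [Finite K]

/-- Distinction of finitely many cases. -/
theorem case {a : X → A} (ha : PolyFun orc a) {g : A → X → Y} (hg : ∀ a, PolyFun orc (g a)) :
    PolyFun orc (fun x => g (a x) x) := by
  rcases isEmpty_or_nonempty A with hA | ⟨⟨a₀⟩⟩
  · have : IsEmpty X := ⟨fun x => isEmptyElim (a x)⟩
    exact of_isEmpty _
  -- The list is never empty; `g a₀` merely fills the branch for the empty list.
  · exact caseList (l := fun x => [a x]) (ha.of_enc_right fun _ => rfl) (hg a₀)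
      (g := fun a z => g a z.1) (fun a => (hg a).comp fst')

theorem of_code {a : X → A} (h : A → Y) (ha : PolyFun orc a) : PolyFun orc (fun x => h (a x)) :=
  case ha (g := fun a _ => h a) fun a => const (h a)

theorem of_code₂ {a : X → A} {b : X → B} (h : A → B → Y) (ha : PolyFun orc a)
    (hb : PolyFun orc b) : PolyFun orc (fun x => h (a x) (b x)) :=
  case ha (g := fun a x => h a (b x)) fun a => of_code (h a) hb

@[fun_prop]
theorem cond {b : X → Bool} {f g : X → Y} (hb : PolyFun orc b) (hf : PolyFun orc f)
    (hg : PolyFun orc g) : PolyFun orc (fun x => cond (b x) (f x) (g x)) :=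
  case hb (g := fun b x => bif b then f x else g x) fun b => by cases b <;> assumption

@[fun_prop]
theorem and {b c : X → Bool} (hb : PolyFun orc b) (hc : PolyFun orc c) :
    PolyFun orc (fun x => b x && c x) := of_code₂ _ hb hc

@[fun_prop]
theorem or {b c : X → Bool} (hb : PolyFun orc b) (hc : PolyFun orc c) :
    PolyFun orc (fun x => b x || c x) := of_code₂ _ hb hc

@[fun_prop]
theorem not {b : X → Bool} (hb : PolyFun orc b) : PolyFun orc (fun x => !(b x)) := of_code _ hb

@[fun_prop]
theorem xor {b c : X → Bool} (hb : PolyFun orc b) (hc : PolyFun orc c) :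
    PolyFun orc (fun x => b x ^^ c x) := of_code₂ _ hb hc

@[fun_prop]
theorem codeEq {a b : X → A} (ha : PolyFun orc a) (hb : PolyFun orc b) :
    PolyFun orc (fun x => codeEq (a x) (b x)) := of_code₂ _ ha hb

@[fun_prop]
theorem cons {a : X → A} {l : X → List A} (ha : PolyFun orc a) (hl : PolyFun orc l) :
    PolyFun orc (fun x => a x :: l x) :=
  case ha (g := fun a x => a :: l x) fun a => cons_const a hl

theorem singleton {a : X → A} (ha : PolyFun orc a) : PolyFun orc (fun x => [a x]) :=
  ha.cons (const [])

@[fun_prop]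
theorem headD {l : X → List A} {d : X → A} (hl : PolyFun orc l) (hd : PolyFun orc d) :
    PolyFun orc (fun x => (l x).headD (d x)) := by
  refine (caseList hl hd (g := fun a _ => a) fun a => const a).of_enc_right fun x => ?_
  rcases l x with _ | _ <;> rfl

@[fun_prop]
theorem tail {l : X → List A} (hl : PolyFun orc l) : PolyFun orc (fun x => (l x).tail) := by
  refine (caseList hl (const []) (g := fun _ z => z.2) fun a => snd').of_enc_right fun x => ?_
  rcases l x with _ | _ <;> rfl

@[fun_prop]
theorem isEmpty {l : X → List A} (hl : PolyFun orc l) : PolyFun orc (fun x => (l x).isEmpty) := by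
  refine (caseList hl (const true) (g := fun _ _ => false) fun a => const _).of_enc_right
    fun x => ?_
  rcases l x with _ | _ <;> rfl

theorem foldl' {l : X → List A} {s₀ : X → S} {step : X → S → A → S} (hl : PolyFun orc l)
    (h₀ : PolyFun orc s₀) (hstep : PolyFun orc fun z : (X × S) × A => step z.1.1 z.1.2 z.2)
    (q : Polynomial ℕ) (hq : ∀ x l₁ l₂, l x = l₁ ++ l₂ →
      sz K (l₁.foldl (step x) (s₀ x)) ≤ q.eval (sz K x + (l x).length + sz K (s₀ x))) :
    PolyFun orc (fun x => (l x).foldl (step x) (s₀ x)) :=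
  foldl hl h₀ (step := fun a z => step z.1 z.2 a)
    (fun a => hstep.comp (id.pair' (const a))) q hq

/-- A fold whose state grows by a bounded amount in each step. -/
theorem foldl_of_le {l : X → List A} {s₀ : X → S} {step : X → S → A → S} (hl : PolyFun orc l)
    (h₀ : PolyFun orc s₀) (hstep : PolyFun orc fun z : (X × S) × A => step z.1.1 z.1.2 z.2)
    (C : ℕ) (hC : ∀ x s a, sz K (step x s a) ≤ sz K s + C) :
    PolyFun orc (fun x => (l x).foldl (step x) (s₀ x)) := by
  refine foldl' hl h₀ hstep ((C : Polynomial ℕ) * Polynomial.X + Polynomial.X)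
    fun x l₁ l₂ h => ?_
  have key : ∀ (l₁ : List A) (s : S), sz K (l₁.foldl (step x) s) ≤ sz K s + C * l₁.length := by
    intro l₁
    induction l₁ with
    | nil => simp
    | cons a l₁ ih =>
      intro s
      have h1 := ih (step x s a)
      have h2 := hC x s a
      rw [List.foldl_cons, List.length_cons, Nat.mul_succ]
      omega
  have h1 := key l₁ (s₀ x)
  have h2 : C * l₁.length ≤ C * (l x).length :=
    Nat.mul_le_mul_left C (by rw [h, List.length_append]; omega)
  simp only [eval_add, eval_mul, eval_natCast, eval_X, Nat.cast_id, Nat.mul_add]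
  omega

theorem foldl_cons_eq {C : Type*} (l m : List C) :
    l.foldl (fun s a => a :: s) m = l.reverse ++ m := by
  induction l generalizing m with
  | nil => simp
  | cons a l ih => simp [ih]

@[fun_prop]
theorem reverse {l : X → List A} (hl : PolyFun orc l) : PolyFun orc (fun x => (l x).reverse) := by
  have := foldl_of_le (s₀ := fun _ : X => ([] : List A)) (step := fun _ s a => a :: s) hl
    (const []) (by fun_prop) 1 (fun x s a => by simp)
  simpa only [foldl_cons_eq, List.append_nil] using this

@[fun_prop]
theorem append {l m : X → List A} (hl : PolyFun orc l) (hm : PolyFun orc m) :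
    PolyFun orc (fun x => l x ++ m x) := by
  have := foldl_of_le (step := fun _ s a => a :: s) hl.reverse
    hm (by fun_prop) 1 (fun x s a => by simp)
  simpa only [foldl_cons_eq, List.reverse_reverse] using this

theorem map {l : X → List A} {f : X → A → B} (hl : PolyFun orc l)
    (hf : PolyFun orc fun z : X × A => f z.1 z.2) :
    PolyFun orc (fun x => (l x).map (f x)) := by
  have h := (foldl_of_le (s₀ := fun _ : X => ([] : List B)) (step := fun x s a => f x a :: s) hl
    (const []) (by fun_prop) 1 (fun x s a => by simp)).reverse
  refine h.of_enc_right fun x => congrArg _ ?_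
  have key : ∀ (l : List A) (m : List B),
      l.foldl (fun s a => f x a :: s) m = (l.map (f x)).reverse ++ m := by
    intro l
    induction l with
    | nil => simp
    | cons a l ih => intro m; simp [ih]
  simp [key]

@[fun_prop]
theorem zipD {C : Type*} [FinCode K C] {f : X → A → B → C} {d : X → B}
    {l : X → List A} {m : X → List B}
    (hf : PolyFun orc fun z : X × A × B => f z.1 z.2.1 z.2.2)
    (hd : PolyFun orc d) (hl : PolyFun orc l) (hm : PolyFun orc m) :
    PolyFun orc (fun x => zipD (f x) (d x) (l x) (m x)) := by
  have h := (foldl_of_le (s₀ := fun x : X => (m x, ([] : List C)))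
    (step := fun x s a => (s.1.tail, f x a (s.1.headD (d x)) :: s.2)) hl
    (by fun_prop) (by fun_prop) 1 (fun x s a => by simp; omega)).snd.reverse
  refine h.of_enc_right fun x => congrArg _ ?_
  have key : ∀ (l : List A) (m : List B) (s : List C),
      (l.foldl (fun s a => (s.1.tail, f x a (s.1.headD (d x)) :: s.2)) (m, s)).2 =
        (CosetWeight.zipD (f x) (d x) l m).reverse ++ s := by
    intro l
    induction l with
    | nil => simp [CosetWeight.zipD]
    | cons a l ih =>
      intro m s
      rw [List.foldl_cons, ih, CosetWeight.zipD, List.reverse_cons, List.append_assoc]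
      rfl
  rw [key, List.append_nil, List.reverse_reverse]

@[fun_prop]
theorem listEq {l m : X → List A} (hl : PolyFun orc l) (hm : PolyFun orc m) :
    PolyFun orc (fun x => listEq (l x) (m x)) := by
  have h := foldl_of_le (s₀ := fun x => (m x, true)) (step := fun _ (s : List A × Bool) a =>
      (s.1.tail, s.2 && !s.1.isEmpty && CosetWeight.codeEq a (s.1.headD a))) hl (by fun_prop)
    (by fun_prop) 0 (fun x s a => by simp)
  refine (h.snd.and h.fst.isEmpty).of_enc_right fun x => congrArg _ ?_
  have key : ∀ (l m : List A) (b : Bool),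
      ((l.foldl (fun s a => (s.1.tail, s.2 && !s.1.isEmpty && CosetWeight.codeEq a (s.1.headD a)))
        (m, b)).2 && (l.foldl (fun s a =>
          (s.1.tail, s.2 && !s.1.isEmpty && CosetWeight.codeEq a (s.1.headD a))) (m, b)).1.isEmpty) =
      (b && CosetWeight.listEq l m) := by
    intro l
    induction l with
    | nil => intro m b; cases m <;> simp [CosetWeight.listEq]
    | cons a l ih =>
      intro m b
      rw [List.foldl_cons, ih]
      rcases m with _ | ⟨c, m⟩
      · simp [CosetWeight.listEq]
      · rw [Bool.eq_iff_iff]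
        simp [and_assoc]
  rw [key, Bool.true_and]

/-! #### Natural numbers -/

@[fun_prop]
theorem replicate_true {n : X → ℕ} (hn : PolyFun orc n) :
    PolyFun orc (fun x => List.replicate (n x) true) :=
  hn.of_enc_right fun x => by simp [Rep.enc, FinCode.code]

@[fun_prop]
theorem length {l : X → List A} (hl : PolyFun orc l) : PolyFun orc (fun x => (l x).length) :=
  (map (f := fun _ _ => true) hl (const true)).of_enc_right fun x => by
    simp [Rep.enc, FinCode.code, List.map_const']

@[fun_prop]
theorem succ {n : X → ℕ} (hn : PolyFun orc n) : PolyFun orc (fun x => n x + 1) :=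
  ((const true).cons hn.replicate_true).of_enc_right fun x => by
    simp [Rep.enc, FinCode.code, List.replicate_succ]

@[fun_prop]
theorem pred {n : X → ℕ} (hn : PolyFun orc n) : PolyFun orc (fun x => n x - 1) :=
  hn.replicate_true.tail.of_enc_right fun x => by
    simp [Rep.enc, FinCode.code]

@[fun_prop]
theorem natEq {m n : X → ℕ} (hm : PolyFun orc m) (hn : PolyFun orc n) :
    PolyFun orc (fun x => natEq (m x) (n x)) :=
  (hm.replicate_true.listEq hn.replicate_true).of_enc_right fun x => congrArg _ (by
    rw [Bool.eq_iff_iff, listEq_iff, natEq_iff]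
    exact ⟨fun h => by rw [h], fun h => by simpa using congrArg List.length h⟩)

@[fun_prop]
theorem replicate {n : X → ℕ} {a : X → A} (hn : PolyFun orc n) (ha : PolyFun orc a) :
    PolyFun orc (fun x => List.replicate (n x) (a x)) :=
  (map (f := fun x _ => a x) hn.replicate_true (by fun_prop)).of_enc_right fun x => by
    simp [List.map_const']

/-- Numbers are represented in unary, so an `n`-fold iteration is a fold over a string of length
`n`. -/
theorem iterate {n : X → ℕ} {s₀ : X → S} {step : X → S → S} (hn : PolyFun orc n)
    (h₀ : PolyFun orc s₀) (hstep : PolyFun orc fun z : X × S => step z.1 z.2)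
    (q : Polynomial ℕ) (hq : ∀ x, ∀ k ≤ n x,
      sz K ((step x)^[k] (s₀ x)) ≤ q.eval (sz K x + n x + sz K (s₀ x))) :
    PolyFun orc (fun x => (step x)^[n x] (s₀ x)) := by
  have key : ∀ (x : X) (l : List Bool) (s : S),
      l.foldl (fun s _ => step x s) s = (step x)^[l.length] s := by
    intro x l
    induction l with
    | nil => simp
    | cons a l ih => intro s; simp [ih]
  have := foldl' (step := fun x s _ => step x s) hn.replicate_true h₀
    (hstep.comp fst') q (fun x l₁ l₂ h => by
      rw [key]
      refine (hq x l₁.length ?_).trans ?_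
      · have := congrArg List.length h
        simp at this
        omega
      · rw [List.length_replicate])
  simpa only [key, List.length_replicate] using this

theorem iterate_of_le {n : X → ℕ} {s₀ : X → S} {step : X → S → S} (hn : PolyFun orc n)
    (h₀ : PolyFun orc s₀) (hstep : PolyFun orc fun z : X × S => step z.1 z.2)
    (C : ℕ) (hC : ∀ x s, sz K (step x s) ≤ sz K s + C) :
    PolyFun orc (fun x => (step x)^[n x] (s₀ x)) := by
  refine iterate hn h₀ hstep ((C : Polynomial ℕ) * Polynomial.X + Polynomial.X) fun x k hk => ?_
  have key : ∀ k : ℕ, sz K ((step x)^[k] (s₀ x)) ≤ sz K (s₀ x) + C * k := by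
    intro k
    induction k with
    | zero => simp
    | succ k ih =>
      rw [Function.iterate_succ_apply', Nat.mul_succ]
      have := hC x ((step x)^[k] (s₀ x))
      omega
  have h1 := key k
  have h2 : C * k ≤ C * n x := Nat.mul_le_mul_left C hk
  simp only [eval_add, eval_mul, eval_natCast, eval_X, Nat.cast_id, Nat.mul_add]
  omega

theorem search {n : X → ℕ} {P : X → ℕ → Bool} (hn : PolyFun orc n)
    (hP : PolyFun orc fun z : X × ℕ => P z.1 z.2) :
    PolyFun orc (fun x => search (P x) (n x)) :=
  iterate_of_le (s₀ := fun _ => 0) (step := fun x u => bif P x u then u else u + 1) hn (const 0)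
    (by fun_prop) 1 (fun x s => by cases h : P x s <;> simp [h])

@[fun_prop]
theorem incBits {l : X → List Bool} (hl : PolyFun orc l) :
    PolyFun orc (fun x => incBits (l x)) := by
  -- The state consists of the carry and the reversed output. The initial carry is the `1` to be
  -- added, and a carry left at the end becomes a new leading bit.
  have h := foldl_of_le (s₀ := fun _ => (true, ([] : List Bool)))
    (step := fun _ s a => (s.1 && a, (s.1 ^^ a) :: s.2)) hl (const _) (by fun_prop) 1
    (fun x s a => by simp; omega)
  have h2 : PolyFun orc fun x =>
      ((l x).foldl (fun s a => (s.1 && a, (s.1 ^^ a) :: s.2)) (true, ([] : List Bool))).2.reverse ++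
        bif ((l x).foldl (fun s a => (s.1 && a, (s.1 ^^ a) :: s.2)) (true, ([] : List Bool))).1
          then [true] else [] := by fun_prop
  refine h2.of_enc_right fun x => congrArg _ ?_
  have key : ∀ (l : List Bool) (b : Bool) (s : List Bool),
      (l.foldl (fun s a => (s.1 && a, (s.1 ^^ a) :: s.2)) (b, s)).2.reverse ++
        (bif (l.foldl (fun s a => (s.1 && a, (s.1 ^^ a) :: s.2)) (b, s)).1 then [true] else []) =
      s.reverse ++ bif b then CosetWeight.incBits l else l := by
    intro l
    induction l with
    | nil => intro b s; cases b <;> simp [CosetWeight.incBits]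
    | cons a l ih =>
      intro b s
      rw [List.foldl_cons, ih]
      cases a <;> cases b <;> simp [CosetWeight.incBits]
  simp [key]

-- Conversion from unary to binary by counting up from zero; each increment adds at most one bit.
@[fun_prop]
theorem bits {n : X → ℕ} (hn : PolyFun orc n) : PolyFun orc (fun x => (n x).bits) := by
  have := iterate_of_le (s₀ := fun _ => ([] : List Bool))
    (step := fun _ s => CosetWeight.incBits s) hn (const _)
    (by fun_prop) 1 (fun x s => by simpa using length_incBits_le s)
  simpa only [← bits_eq_iterate] using this

@[fun_prop]
theorem encNat {n : X → ℕ} (hn : PolyFun orc n) :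
    PolyFun orc (fun x => (encNat (n x) : List (Sym K))) :=
  hn.bits.of_enc_right fun x => by
    simp [Rep.enc, CosetWeight.encNat, FinCode.code]

end PolyFun

end Lists

/-! ### Polynomial-time functions on lists of rows -/

section Rows

open Polynomial

variable {K : Type u} {ι : Type w} {X Y Z S A B : Type*} [Rep K X] [Rep K Y] [Rep K Z] [Rep K S]
  {orc : Oracles K ι} [FinCode K A] [FinCode K B]

@[simp] theorem encRows_nil : encRows ([] : List (List K)) = [] := rfl

theorem encRows_append (R R' : List (List K)) : encRows (R ++ R') = encRows R ++ encRows R' := by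
  simp [encRows]

@[simp] theorem length_encRows_cons (r : List K) (R : List (List K)) :
    (encRows (r :: R)).length = r.length + 1 + (encRows R).length := by
  simp [encRows_cons]; omega

/-- One step of a fold over rows that reads the code symbol by symbol. The first component of the
state collects the entries of the current row in reverse order. -/
def rowStep (step : S → List K → S) (z : List K × S) : Sym K → List K × S
  | Sym.elt a => (a :: z.1, z.2)
  | Sym.comma => ([], step z.2 z.1.reverse)
  | Sym.bit _ => z
  | Sym.hash => z

theorem foldl_rowStep_elt (step : S → List K → S) (r : List K) (z : List K × S) :
    (r.map Sym.elt).foldl (rowStep step) z = (r.reverse ++ z.1, z.2) := by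
  induction r generalizing z with
  | nil => rfl
  | cons a r ih => simp [ih, rowStep]

theorem foldl_rowStep (step : S → List K → S) (R : List (List K)) (s : S) :
    (encRows R).foldl (rowStep step) ([], s) = ([], R.foldl step s) := by
  induction R generalizing s with
  | nil => rfl
  | cons r R ih =>
    rw [encRows_cons, List.foldl_append, foldl_rowStep_elt]
    simp [rowStep, ih]

/-- The state of the row fold changes only at commas, so in the middle of a row it still is a state
between two rows, and the buffer is no longer than the code. In this way size bounds for folds over
rows pass to the symbolwise fold. -/
theorem foldl_rowStep_prefix (step : S → List K → S) (R : List (List K)) :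
    ∀ (s : S) (l₁ l₂ : List (Sym K)), encRows R = l₁ ++ l₂ → ∃ R₁ R₂, R = R₁ ++ R₂ ∧
      (l₁.foldl (rowStep step) ([], s)).2 = R₁.foldl step s ∧
      (l₁.foldl (rowStep step) ([], s)).1.length ≤ (encRows R).length := by
  induction R with
  | nil =>
    intro s l₁ l₂ h
    simp only [encRows_nil, List.nil_eq, List.append_eq_nil_iff] at h
    exact ⟨[], [], rfl, by simp [h.1], by simp [h.1]⟩
  | cons r R ih =>
    intro s l₁ l₂ h
    rw [encRows_cons, List.append_eq_append_iff] at h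
    rcases h with ⟨m, rfl, h⟩ | ⟨m, hm, h⟩
    -- Here the prefix covers all entries of `r`; an empty `m` means that the comma after them has
    -- not been read yet.
    · rcases m with _ | ⟨c, m⟩
      · refine ⟨[], r :: R, rfl, ?_, ?_⟩
        · rw [List.append_nil, foldl_rowStep_elt]
          rfl
        · rw [List.append_nil, foldl_rowStep_elt]
          simp
          omega
      · rw [List.cons_append, List.cons.injEq] at h
        obtain ⟨rfl, h⟩ := h
        obtain ⟨R₁, R₂, rfl, h1, h2⟩ := ih (step s r) m l₂ h
        refine ⟨r :: R₁, R₂, rfl, ?_, ?_⟩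
        · rw [List.foldl_append, foldl_rowStep_elt]
          simpa [rowStep] using h1
        · rw [List.foldl_append, foldl_rowStep_elt]
          refine (show _ ≤ _ from ?_ : _).trans (h2.trans ?_)
          · simp [rowStep]
          · simp
    · obtain ⟨r₁, r₂, rfl, rfl, rfl⟩ := List.map_eq_append_iff.1 hm
      refine ⟨[], _, rfl, ?_, ?_⟩
      · rw [foldl_rowStep_elt]
        rfl
      · rw [foldl_rowStep_elt]
        simp
        omega

namespace PolyFun

@[fun_prop]
theorem encRows {R : X → List (List K)} (hR : PolyFun orc R) :
    PolyFun orc (fun x => encRows (R x)) :=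
  hR.of_enc_right fun x => by simp [Rep.enc, FinCode.code]

@[fun_prop]
theorem mapElt {l : X → List K} (hl : PolyFun orc l) :
    PolyFun orc (fun x => (l x).map Sym.elt) :=
  hl.of_enc_right fun x => by simp [Rep.enc, FinCode.code]

variable [Finite K]

@[fun_prop]
theorem singletonRow {r : X → List K} (hr : PolyFun orc r) : PolyFun orc (fun x => [r x]) := by
  refine (hr.mapElt.append (const [Sym.comma])).of_enc_right fun x => ?_
  simp [Rep.enc, FinCode.code, encRows_cons]

@[fun_prop]
theorem appendRows {R R' : X → List (List K)} (hR : PolyFun orc R) (hR' : PolyFun orc R') :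
    PolyFun orc (fun x => R x ++ R' x) := by
  refine (hR.encRows.append hR'.encRows).of_enc_right fun x => ?_
  simp [Rep.enc, FinCode.code, encRows_append]

@[fun_prop]
theorem consRow {r : X → List K} {R : X → List (List K)} (hr : PolyFun orc r)
    (hR : PolyFun orc R) : PolyFun orc (fun x => r x :: R x) := hr.singletonRow.appendRows hR

theorem rowStep {step : X → S → List K → S}
    (hstep : PolyFun orc fun z : (X × S) × List K => step z.1.1 z.1.2 z.2) :
    PolyFun orc fun z : (X × (List K × S)) × Sym K => rowStep (step z.1.1) z.1.2 z.2 := by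
  refine case snd' (g := fun c (z : (X × (List K × S)) × Sym K) => CosetWeight.rowStep (step z.1.1) z.1.2 c) fun c => ?_
  have h : PolyFun orc fun z : (X × (List K × S)) × Sym K =>
      step z.1.1 z.1.2.2 z.1.2.1.reverse :=
    hstep.comp (f := fun z : (X × (List K × S)) × Sym K => ((z.1.1, z.1.2.2), z.1.2.1.reverse))
      (by fun_prop)
  cases c
  case comma => exact (const []).pair' h
  all_goals simp only [CosetWeight.rowStep]; fun_prop

theorem foldRows {R : X → List (List K)} {s₀ : X → S} {step : X → S → List K → S}
    (hR : PolyFun orc R) (h₀ : PolyFun orc s₀)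
    (hstep : PolyFun orc fun z : (X × S) × List K => step z.1.1 z.1.2 z.2)
    (q : Polynomial ℕ) (hq : ∀ x R₁ R₂, R x = R₁ ++ R₂ →
      sz K (R₁.foldl (step x) (s₀ x)) ≤
        q.eval (sz K x + (CosetWeight.encRows (R x)).length + sz K (s₀ x))) :
    PolyFun orc (fun x => (R x).foldl (step x) (s₀ x)) := by
  have h := foldl' (s₀ := fun x => (([] : List K), s₀ x))
    (step := fun x s a => CosetWeight.rowStep (step x) s a) hR.encRows
    (by fun_prop) (rowStep hstep) (q + Polynomial.X) (fun x l₁ l₂ hl => by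
      obtain ⟨R₁, R₂, h1, h2, h3⟩ := foldl_rowStep_prefix (step x) (R x) (s₀ x) l₁ l₂ hl
      have := hq x R₁ R₂ h1
      rw [← h2] at this
      change sz K (l₁.foldl (CosetWeight.rowStep (step x)) ([], s₀ x)) ≤ _
      simp
      omega)
  simpa only [foldl_rowStep] using h.snd

theorem foldRows_of_le {R : X → List (List K)} {s₀ : X → S} {step : X → S → List K → S}
    (hR : PolyFun orc R) (h₀ : PolyFun orc s₀)
    (hstep : PolyFun orc fun z : (X × S) × List K => step z.1.1 z.1.2 z.2)
    (C : ℕ) (hC : ∀ x s r, sz K (step x s r) ≤ sz K s + C * (r.length + 1)) :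
    PolyFun orc (fun x => (R x).foldl (step x) (s₀ x)) := by
  refine foldRows hR h₀ hstep ((C : Polynomial ℕ) * Polynomial.X + Polynomial.X)
    fun x R₁ R₂ h => ?_
  have key : ∀ (R₁ : List (List K)) (s : S),
      sz K (R₁.foldl (step x) s) ≤ sz K s + C * (CosetWeight.encRows R₁).length := by
    intro R₁
    induction R₁ with
    | nil => simp
    | cons r R₁ ih =>
      intro s
      have h1 := ih (step x s r)
      have h2 := hC x s r
      rw [List.foldl_cons, length_encRows_cons, Nat.mul_add]
      omega
  have h1 := key R₁ (s₀ x)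
  have h2 : C * (CosetWeight.encRows R₁).length ≤ C * (CosetWeight.encRows (R x)).length :=
    Nat.mul_le_mul_left C (by rw [h, encRows_append, List.length_append]; omega)
  simp only [eval_add, eval_mul, eval_natCast, eval_X, Nat.cast_id, Nat.mul_add]
  omega

theorem mapRows {R : X → List (List K)} {f : X → List K → List K} (hR : PolyFun orc R)
    (hf : PolyFun orc fun z : X × List K => f z.1 z.2)
    (hle : ∀ x r, (f x r).length ≤ r.length + 1) : PolyFun orc (fun x => (R x).map (f x)) := by
  have hf' : PolyFun orc fun z : (X × List (List K)) × List K => f z.1.1 z.2 :=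
    hf.comp (f := fun z : (X × List (List K)) × List K => (z.1.1, z.2)) (by fun_prop)
  have h := foldRows_of_le (s₀ := fun _ : X => ([] : List (List K)))
    (step := fun x s r => s ++ [f x r]) hR (by fun_prop) (by fun_prop) 2 (fun x s r => by
      have := hle x r
      simp [encRows_append]
      omega)
  refine h.of_enc_right fun x => congrArg _ ?_
  have key : ∀ (R R' : List (List K)), R.foldl (fun s r => s ++ [f x r]) R' = R' ++ R.map (f x) := by
    intro R
    induction R with
    | nil => simp
    | cons a R ih => intro R'; simp [ih]
  rw [key, List.nil_append]

theorem mapRowsCode {R : X → List (List K)} {f : X → List K → A} (hR : PolyFun orc R)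
    (hf : PolyFun orc fun z : X × List K => f z.1 z.2) :
    PolyFun orc (fun x => (R x).map (f x)) := by
  have hf' : PolyFun orc fun z : (X × List A) × List K => f z.1.1 z.2 :=
    hf.comp (f := fun z : (X × List A) × List K => (z.1.1, z.2)) (by fun_prop)
  have h := (foldRows_of_le (s₀ := fun _ : X => ([] : List A))
    (step := fun x s r => f x r :: s) hR (by fun_prop) (by fun_prop) 1 (fun x s r => by
      simp)).reverse
  refine h.of_enc_right fun x => congrArg _ ?_
  have key : ∀ (R : List (List K)) (m : List A),
      R.foldl (fun s r => f x r :: s) m = (R.map (f x)).reverse ++ m := by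
    intro R
    induction R with
    | nil => simp
    | cons a R ih => intro R'; simp [ih]
  rw [key, List.append_nil, List.reverse_reverse]

@[fun_prop]
theorem lengthRows {R : X → List (List K)} (hR : PolyFun orc R) :
    PolyFun orc (fun x => (R x).length) := by
  simpa using (mapRowsCode (f := fun _ _ => true) hR (by fun_prop)).length

@[fun_prop]
theorem headRow {R : X → List (List K)} (hR : PolyFun orc R) :
    PolyFun orc (fun x => (R x).headD []) := by
  have h := (foldRows_of_le (s₀ := fun _ : X => (false, ([] : List K)))
    (step := fun _ s r => (true, bif s.1 then s.2 else r)) hR (by fun_prop) (by fun_prop) 1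
    (fun x s r => by cases h : s.1 <;> simp [h]; omega)).snd
  refine h.of_enc_right fun x => congrArg _ ?_
  have key : ∀ (R : List (List K)) (s : List K),
      (R.foldl (fun (s : Bool × List K) r => (true, bif s.1 then s.2 else r)) (true, s)).2 = s := by
    intro R
    induction R with
    | nil => simp
    | cons a R ih => intro R'; simp [ih]
  rcases R x with _ | ⟨r, R⟩
  · rfl
  · rw [List.foldl_cons]
    exact (key R r).symm

@[fun_prop]
theorem tailRows {R : X → List (List K)} (hR : PolyFun orc R) :
    PolyFun orc (fun x => (R x).tail) := by
  have h := (foldRows_of_le (s₀ := fun _ : X => (false, ([] : List (List K))))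
    (step := fun _ s r => (true, bif s.1 then s.2 ++ [r] else s.2)) hR (by fun_prop)
    (by fun_prop) 1 (fun x s r => by
      cases h : s.1 <;> simp [h, encRows_append]
      omega)).snd
  refine h.of_enc_right fun x => congrArg _ ?_
  have key : ∀ (R : List (List K)) (s : List (List K)),
      (R.foldl (fun (s : Bool × List (List K)) r => (true, bif s.1 then s.2 ++ [r] else s.2))
        (true, s)).2 = s ++ R := by
    intro R
    induction R with
    | nil => simp
    | cons a R ih => intro R'; simp [ih]
  rcases R x with _ | ⟨r, R⟩
  · rfl
  · rw [List.foldl_cons]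
    exact (key R []).symm

/-- All rows have length `n`. -/
theorem allLength {R : X → List (List K)} {n : X → ℕ} (hR : PolyFun orc R)
    (hn : PolyFun orc n) : PolyFun orc (fun x => (R x).all fun r => CosetWeight.natEq r.length (n x)) := by
  have h := mapRowsCode (f := fun x r => CosetWeight.natEq r.length (n x)) hR (by fun_prop)
  have h2 := foldl_of_le (s₀ := fun _ : X => true) (step := fun _ s a => s && a) h (by fun_prop)
    (by fun_prop) 0 (fun x s a => by simp)
  refine h2.of_enc_right fun x => congrArg _ ?_
  have key : ∀ (R : List (List K)) (b : Bool),
      (R.map fun r => CosetWeight.natEq r.length (n x)).foldl (fun s a => s && a) b =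
        (b && R.all fun r => CosetWeight.natEq r.length (n x)) := by
    intro R
    induction R with
    | nil => simp
    | cons a R ih => intro b; simp [ih, Bool.and_assoc]
  rw [key, Bool.true_and]

/-! #### Linear algebra -/

variable [Field K]

@[fun_prop]
theorem mul {a b : X → K} (ha : PolyFun orc a) (hb : PolyFun orc b) :
    PolyFun orc (fun x => a x * b x) := of_code₂ _ ha hb

@[fun_prop]
theorem add {a b : X → K} (ha : PolyFun orc a) (hb : PolyFun orc b) :
    PolyFun orc (fun x => a x + b x) := of_code₂ _ ha hb

@[fun_prop]
theorem sub {a b : X → K} (ha : PolyFun orc a) (hb : PolyFun orc b) :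
    PolyFun orc (fun x => a x - b x) := of_code₂ _ ha hb

@[fun_prop]
theorem inv {a : X → K} (ha : PolyFun orc a) : PolyFun orc (fun x => (a x)⁻¹) := of_code _ ha

@[fun_prop]
theorem dot {l m : X → List K} (hl : PolyFun orc l) (hm : PolyFun orc m) :
    PolyFun orc (fun x => dot (l x) (m x)) := by
  have h := (foldl_of_le (s₀ := fun x => (m x, (0 : K)))
    (step := fun _ (s : List K × K) a => (s.1.tail, s.2 + a * s.1.headD 0)) hl (by fun_prop)
    (by fun_prop) 0 (fun x s a => by simp)).snd
  refine h.of_enc_right fun x => congrArg _ ?_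
  have key : ∀ (l m : List K) (c : K),
      (l.foldl (fun (s : List K × K) a => (s.1.tail, s.2 + a * s.1.headD 0)) (m, c)).2 =
        c + CosetWeight.dot l m := by
    intro l
    induction l with
    | nil => simp [CosetWeight.dot]
    | cons a l ih =>
      intro m c
      rw [List.foldl_cons, ih, CosetWeight.dot, add_assoc]
  rw [key, zero_add]

end PolyFun

variable [Field K]

/-- The inverse of the first nonzero entry, at its place, and zeros elsewhere. -/
noncomputable def pivot : List K → List K
  | [] => []
  | a :: l => bif codeEq a 0 then 0 :: pivot l else a⁻¹ :: l.map fun _ => 0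

/-- Eliminate the pivot coordinate of `r` from `s` by means of `r`. -/
noncomputable def reduceRow (r s : List K) : List K :=
  zipD (fun a b => a - dot (pivot r) s * b) 0 s r

/-- One step of Gaussian elimination. The second component of the state records whether all pivot
rows were nonzero. -/
noncomputable def elimStep (z : List (List K) × Bool) : List (List K) × Bool :=
  (z.1.tail.map (reduceRow (z.1.headD [])),
    z.2 && (natEq z.1.length 0 || codeEq (dot (pivot (z.1.headD [])) (z.1.headD [])) 1))

/-- Test for linear independence of rows. -/
noncomputable def fullRank (R : List (List K)) : Bool := (elimStep^[R.length] (R, true)).2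

namespace PolyFun

variable [Finite K]

@[fun_prop]
theorem pivot {l : X → List K} (hl : PolyFun orc l) : PolyFun orc (fun x => pivot (l x)) := by
  have h := (foldl_of_le (s₀ := fun x => (false, ([] : List K)))
    (step := fun _ (s : Bool × List K) a =>
      (s.1 || !CosetWeight.codeEq a 0,
        (bif s.1 then 0 else bif CosetWeight.codeEq a 0 then 0 else a⁻¹) :: s.2)) hl (by fun_prop)
    (by fun_prop) 1 (fun x s a => by simp; omega)).snd.reverse
  refine h.of_enc_right fun x => congrArg _ ?_
  have key : ∀ (l : List K) (b : Bool) (s : List K),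
      (l.foldl (fun (s : Bool × List K) a => (s.1 || !CosetWeight.codeEq a 0,
        (bif s.1 then 0 else bif CosetWeight.codeEq a 0 then 0 else a⁻¹) :: s.2)) (b, s)).2.reverse =
      s.reverse ++ bif b then l.map (fun _ => 0) else CosetWeight.pivot l := by
    intro l
    induction l with
    | nil => intro b s; cases b <;> simp [CosetWeight.pivot]
    | cons a l ih =>
      intro b s
      rw [List.foldl_cons, ih]
      cases b <;> cases h : CosetWeight.codeEq a 0 <;> simp [CosetWeight.pivot, h]
  rw [key]
  rfl

@[fun_prop]
theorem reduceRow {r s : X → List K} (hr : PolyFun orc r) (hs : PolyFun orc s) :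
    PolyFun orc (fun x => reduceRow (r x) (s x)) :=
  zipD (f := fun x a b => a - CosetWeight.dot (CosetWeight.pivot (r x)) (s x) * b)
    (d := fun _ => 0) (by fun_prop) (by fun_prop) hs hr

theorem length_encRows_tail_le (R : List (List K)) :
    (CosetWeight.encRows R.tail).length ≤ (CosetWeight.encRows R).length := by
  rcases R with _ | ⟨r, R⟩ <;> simp

theorem length_encRows_map (R : List (List K)) (f : List K → List K)
    (hf : ∀ r, (f r).length = r.length) :
    (CosetWeight.encRows (R.map f)).length = (CosetWeight.encRows R).length := by
  induction R with
  | nil => rfl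
  | cons r R ih => simp [ih, hf]

@[fun_prop]
theorem fullRank {R : X → List (List K)} (hR : PolyFun orc R) :
    PolyFun orc (fun x => fullRank (R x)) := by
  refine (iterate_of_le (s₀ := fun x => (R x, true)) (step := fun _ z => elimStep z)
    hR.lengthRows (by fun_prop) ?_ 0 (fun x z => ?_)).snd
  · have h := mapRows (R := fun z : X × List (List K) × Bool => z.2.1.tail)
      (f := fun z s => CosetWeight.reduceRow (z.2.1.headD []) s) (orc := orc) (by fun_prop)
      (by fun_prop) (fun z r => by rw [CosetWeight.reduceRow, length_zipD]; omega)
    unfold elimStep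
    fun_prop
  · simp only [elimStep, sz_prod, sz_rows, sz_code]
    rw [length_encRows_map _ _ fun r => by rw [CosetWeight.reduceRow, length_zipD]]
    have := length_encRows_tail_le z.1
    omega

end PolyFun

end Rows

/-! ### Correctness of Gaussian elimination -/

section Elimination

variable {K : Type u}

section Zero

variable [Zero K]

/-- The vector with given coordinates; the list is extended by zeros or cut off. -/
def toVec (n : ℕ) (l : List K) : Fin n → K := fun i => l.getD i 0

@[simp] theorem toVec_ofFn {n : ℕ} (x : Fin n → K) : toVec n (List.ofFn x) = x := by
  funext i
  simp [toVec]

theorem ofFn_toVec {n : ℕ} {l : List K} (h : l.length = n) : List.ofFn (toVec n l) = l := by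
  subst h
  refine List.ext_getElem (by simp) fun i h1 h2 => ?_
  simp [toVec, List.getElem?_eq_getElem h2]

end Zero

theorem getD_tail {C : Type*} (l : List C) (i : ℕ) (d : C) : l.tail.getD i d = l.getD (i + 1) d := by
  cases l <;> simp

theorem headD_eq {C : Type*} (l : List C) (d : C) : l.headD d = l.getD 0 d := by
  cases l <;> simp

theorem getD_zipD {C D E : Type*} (f : C → D → E) (c : C) (d : D) (e : E) (l : List C) :
    ∀ (m : List D) (i : ℕ), i < l.length →
      (zipD f d l m).getD i e = f (l.getD i c) (m.getD i d) := by
  induction l with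
  | nil => intro m i hi; simp at hi
  | cons a l ih =>
    intro m i hi
    rcases i with _ | i
    · rw [zipD, headD_eq]
      rfl
    · rw [zipD, List.getD_cons_succ, List.getD_cons_succ, ih _ _ (by simpa using hi), getD_tail]

theorem zipD_ofFn {C D E : Type*} (f : C → D → E) (d : D) {n : ℕ} (x : Fin n → C) (m : List D) :
    zipD f d (List.ofFn x) m = List.ofFn fun i => f (x i) (m.getD i d) := by
  induction n generalizing m with
  | zero => rfl
  | succ n ih =>
    rw [List.ofFn_succ, List.ofFn_succ, zipD, ih, headD_eq]
    simp [getD_tail]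

variable [Field K]

theorem dot_eq_sum {n : ℕ} {l : List K} (hl : l.length = n) (m : List K) :
    dot l m = ∑ i, toVec n l i * toVec n m i := by
  subst hl
  induction l generalizing m with
  | nil => rfl
  | cons a l ih =>
    rw [dot, ih]
    refine Eq.symm ((Fin.sum_univ_succ (n := l.length) _).trans ?_)
    rw [headD_eq]
    simp [toVec, getD_tail]

theorem dot_zero (l m : List K) (h : ∀ a ∈ l, a = 0) : dot l m = 0 := by
  induction l generalizing m with
  | nil => rfl
  | cons a l ih =>
    rw [dot, h a (by simp), ih _ fun b hb => h b (by simp [hb])]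
    simp

theorem length_pivot (r : List K) : (pivot r).length = r.length := by
  induction r with
  | nil => rfl
  | cons a r ih => cases h : codeEq a 0 <;> simp [pivot, h, ih]

/-- `dot (pivot r)` is the coordinate functional at the first nonzero entry of `r`, scaled to take
the value `1` at `r`. It is zero precisely if `r` has no such entry. -/
theorem dot_pivot_self (r : List K) :
    dot (pivot r) r = 1 ∨ ((∀ a ∈ r, a = 0) ∧ dot (pivot r) r = 0) := by
  induction r with
  | nil => exact Or.inr ⟨by simp, rfl⟩
  | cons a r ih =>
    cases h : codeEq a 0
    · have ha : a ≠ 0 := fun h' => by rw [(codeEq_iff a 0).2 h'] at h; cases h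
      left
      rw [pivot, h, cond_false, dot, dot_zero _ _ (by simp)]
      simp [ha]
    · have ha : a = 0 := by simpa using h
      rw [pivot, h, cond_true, dot]
      subst ha
      simpa using ih

/-- Linear independence of the rows of a list. -/
def Indep (n : ℕ) (R : List (List K)) : Prop :=
  ∀ c : ℕ → K, ∑ i ∈ Finset.range R.length, c i • toVec n (R.getD i []) = 0 →
    ∀ i < R.length, c i = 0

theorem toVec_reduceRow {n : ℕ} {r s : List K} (hs : s.length = n) :
    toVec n (reduceRow r s) = toVec n s - dot (pivot r) s • toVec n r := by
  funext i
  rw [toVec, reduceRow, getD_zipD (c := 0) _ _ _ _ _ _ (by omega)]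
  rfl

/-- For a functional `φ` with `φ r = 1`, reduction is the projection along `r` onto the kernel of
`φ`. A relation among the reduced rows is a relation among `r :: R` whose coefficient at `r` is
dictated by the others. -/
theorem indep_cons_iff {n : ℕ} {r : List K} {R : List (List K)} (hr : r.length = n)
    (hR : ∀ s ∈ R, s.length = n) (h1 : dot (pivot r) r = 1) :
    Indep n (r :: R) ↔ Indep n (R.map (reduceRow r)) := by
  have hlen : (pivot r).length = n := by rw [length_pivot, hr]
  let φ : (Fin n → K) →ₗ[K] K := ∑ i, toVec n (pivot r) i • LinearMap.proj i
  have hφ : ∀ s, dot (pivot r) s = φ (toVec n s) := fun s => by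
    rw [dot_eq_sum hlen]
    simp [φ]
  have hred : ∀ i < R.length, toVec n ((R.map (reduceRow r)).getD i []) =
      toVec n (R.getD i []) - φ (toVec n (R.getD i [])) • toVec n r := fun i hi => by
    rw [← hφ, ← toVec_reduceRow (hR _ _)]
    · simp [hi]
    · simp [hi]
  have hsum : ∀ c : ℕ → K, ∑ i ∈ Finset.range (R.map (reduceRow r)).length,
      c i • toVec n ((R.map (reduceRow r)).getD i []) =
      ∑ i ∈ Finset.range R.length, c i • toVec n (R.getD i []) -
        (∑ i ∈ Finset.range R.length, c i * φ (toVec n (R.getD i []))) • toVec n r := fun c => by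
    rw [List.length_map, Finset.sum_smul, ← Finset.sum_sub_distrib]
    refine Finset.sum_congr rfl fun i hi => ?_
    rw [hred i (Finset.mem_range.1 hi), smul_sub, mul_smul]
  rw [hφ] at h1
  constructor
  · intro h c hc i hi
    rw [hsum] at hc
    rw [List.length_map] at hi
    -- The coefficient at `r` collects everything that the reductions subtracted.
    have := h (fun i => Nat.casesOn i
      (-∑ i ∈ Finset.range R.length, c i * φ (toVec n (R.getD i []))) c) (by
        rw [List.length_cons, Finset.sum_range_succ']
        simp only [List.getD_cons_succ, List.getD_cons_zero]
        change _ + (-_ : K) • _ = 0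
        rw [neg_smul, ← sub_eq_add_neg]
        exact hc) (i + 1) (by simpa using hi)
    exact this
  · intro h c hc
    rw [List.length_cons, Finset.sum_range_succ'] at hc
    simp only [List.getD_cons_succ, List.getD_cons_zero] at hc
    -- Applying `φ` to the relation expresses the coefficient at `r` by the remaining ones.
    have h0 : ∑ i ∈ Finset.range R.length, c (i + 1) * φ (toVec n (R.getD i [])) = -c 0 := by
      have := congrArg φ hc
      simp only [map_add, map_sum, map_smul, smul_eq_mul, h1, mul_one, map_zero] at this
      exact eq_neg_of_add_eq_zero_left this
    have key := h (fun i => c (i + 1)) (by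
      rw [hsum, h0, neg_smul, sub_neg_eq_add]
      exact hc)
    rw [List.length_map] at key
    intro i hi
    rcases i with _ | i
    · rw [← neg_eq_zero, ← h0]
      exact Finset.sum_eq_zero fun i hi => by rw [key i (Finset.mem_range.1 hi), zero_mul]
    · exact key i (by simpa using hi)

theorem elimStep_iterate (n k : ℕ) : ∀ (R : List (List K)) (b : Bool), R.length = k →
    (∀ r ∈ R, r.length = n) → ((elimStep^[k] (R, b)).2 = true ↔ b = true ∧ Indep n R) := by
  induction k with
  | zero =>
    intro R b hR _
    obtain rfl := List.eq_nil_of_length_eq_zero hR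
    simp [Indep]
  | succ k ih =>
    intro R b hR hlen
    rcases R with _ | ⟨r, R⟩
    · simp at hR
    · have hr := hlen r (by simp)
      have hR' : ∀ s ∈ R, s.length = n := fun s hs => hlen s (by simp [hs])
      rw [Function.iterate_succ_apply]
      simp only [elimStep, List.tail_cons, List.headD_cons]
      rw [ih _ _ (by simpa using hR) (by
        intro s hs
        obtain ⟨s', hs', rfl⟩ := List.mem_map.1 hs
        rw [reduceRow, length_zipD, hR' s' hs'])]
      rcases dot_pivot_self r with h | ⟨h0, h⟩
      · rw [indep_cons_iff hr hR' h, h]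
        simp
      · rw [h]
        -- A zero row is dependent: take coefficient `1` there and `0` elsewhere.
        have hn : ¬ Indep n (r :: R) := fun hi => by
          have := hi (fun i => if i = 0 then 1 else 0) (by
            rw [List.length_cons, Finset.sum_range_succ']
            have e : toVec n r = 0 := by
              funext i
              rw [toVec, List.getD_eq_getElem _ _ (by omega)]
              exact h0 _ (List.getElem_mem _)
            simp [e]) 0 (by simp)
          simp at this
        simp [hn, natEq, codeEq]

theorem fullRank_iff {n : ℕ} {R : List (List K)} (hR : ∀ r ∈ R, r.length = n) :
    fullRank R = true ↔ Indep n R := by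
  rw [fullRank, elimStep_iterate n _ R true rfl hR]
  simp

/-- The list of rows of a matrix. -/
def rowsOf {m n : ℕ} (A : Matrix (Fin m) (Fin n) K) : List (List K) :=
  List.ofFn fun i => List.ofFn (A i)

/-- The matrix with given rows. -/
def ofRows (n : ℕ) (R : List (List K)) : Matrix (Fin R.length) (Fin n) K :=
  Matrix.of fun i => toVec n (R.getD i [])

theorem rowsOf_ofRows {n : ℕ} {R : List (List K)} (hR : ∀ r ∈ R, r.length = n) :
    rowsOf (ofRows n R) = R := by
  apply List.ext_getElem
  · simp [rowsOf]
  · intro i h1 h2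
    simp only [rowsOf, ofRows, List.getElem_ofFn, Matrix.of_apply]
    change List.ofFn (toVec n (R.getD i [])) = _
    rw [List.getD_eq_getElem _ _ h2]
    exact ofFn_toVec (hR _ (List.getElem_mem _))

theorem length_of_mem_rowsOf {m n : ℕ} {A : Matrix (Fin m) (Fin n) K} {r : List K}
    (hr : r ∈ rowsOf A) : r.length = n := by
  obtain ⟨i, rfl⟩ := List.mem_ofFn.1 hr
  simp

theorem indep_rowsOf {m n : ℕ} (A : Matrix (Fin m) (Fin n) K) :
    Indep n (rowsOf A) ↔ A.rank = m := by
  have h1 : LinearIndependent K A.row ↔ A.rank = m := by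
    rw [linearIndependent_iff_card_eq_finrank_span, Matrix.rank_eq_finrank_span_row,
      Fintype.card_fin, eq_comm]
    rfl
  rw [← h1, Fintype.linearIndependent_iff]
  have hl : (rowsOf A).length = m := by simp [rowsOf]
  have hrow : ∀ i : Fin m, toVec n ((rowsOf A).getD i []) = A.row i := fun i => by
    rw [List.getD_eq_getElem _ _ (by rw [hl]; exact i.2)]
    simp [rowsOf, Matrix.row]
  rw [Indep, hl]
  constructor
  · intro h g hg i
    have := h (fun j => if hj : j < m then g ⟨j, hj⟩ else 0) (by
      rw [Finset.sum_range, ← hg]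
      refine Finset.sum_congr rfl fun i _ => ?_
      rw [hrow]
      simp) i i.2
    simpa using this
  · intro h c hc i hi
    refine h (fun j => c j) ?_ ⟨i, hi⟩
    rw [Finset.sum_range] at hc
    rw [← hc]
    exact Finset.sum_congr rfl fun i _ => by rw [hrow]

theorem fullRank_rowsOf {m n : ℕ} (A : Matrix (Fin m) (Fin n) K) :
    fullRank (rowsOf A) = true ↔ A.rank = m := by
  rw [fullRank_iff fun r hr => length_of_mem_rowsOf hr, indep_rowsOf]

theorem map_dot_rowsOf {m n : ℕ} (A : Matrix (Fin m) (Fin n) K) (l : List K) :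
    (rowsOf A).map (fun r => dot r l) = List.ofFn (A.mulVec (toVec n l)) := by
  rw [rowsOf, List.map_ofFn]
  congr 1
  funext i
  rw [Function.comp, dot_eq_sum (n := n) (by simp), toVec_ofFn]
  rfl

end Elimination

/-! ### Instances as strings -/

section Strings

open Polynomial

variable {K : Type u} {ι : Type w} {X Y Z S A B : Type*} [Rep K X] [Rep K Y] [Rep K Z] [Rep K S]
  {orc : Oracles K ι}

/-- The string with `n` columns, rows `R` and right-hand side `b`. -/
def mkStr (n : ℕ) (R : List (List K)) (b : List K) : List (Sym K) :=
  List.replicate n (Sym.bit true) ++ encRows ([] :: R) ++ b.map Sym.elt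

/-- Rows, and the entries after the last row in reverse order. -/
def parse (w : List (Sym K)) : List K × List (List K) :=
  w.foldl (rowStep fun s r => s ++ [r]) ([], [])

/-- The rows of a string. -/
def strRows (w : List (Sym K)) : List (List K) := (parse w).2.tail

/-- The entries after the last row of a string. -/
def strVec (w : List (Sym K)) : List K := (parse w).1.reverse

/-- The counter step for the number of columns. -/
def numStep (n : ℕ) : Sym K → ℕ
  | Sym.bit true => n + 1
  | _ => n

/-- The number of columns of a string. -/
def strNum (w : List (Sym K)) : ℕ := w.foldl numStep 0

/-- The comma that closes the unary prefix reads as the end of an empty row. This is the spurious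
first row that `strRows` removes with `tail`. -/
theorem parse_mkStr (n : ℕ) (R : List (List K)) (b : List K) :
    parse (mkStr n R b) = (b.reverse, [] :: R) := by
  have h1 : ∀ z : List K × List (List K), (List.replicate n (Sym.bit true)).foldl
      (rowStep fun s r => s ++ [r]) z = z := by
    intro z
    induction n with
    | zero => rfl
    | succ n ih => rw [List.replicate_succ, List.foldl_cons]; exact ih
  have h2 : ∀ R R' : List (List K), R.foldl (fun s r => s ++ [r]) R' = R' ++ R := by
    intro R
    induction R with
    | nil => simp
    | cons r R ih => intro R'; simp [ih]
  rw [parse, mkStr, List.foldl_append, List.foldl_append, h1, foldl_rowStep, foldl_rowStep_elt, h2]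
  simp

theorem strRows_mkStr (n : ℕ) (R : List (List K)) (b : List K) :
    strRows (mkStr n R b) = R := by rw [strRows, parse_mkStr]; rfl

theorem strVec_mkStr (n : ℕ) (R : List (List K)) (b : List K) :
    strVec (mkStr n R b) = b := by rw [strVec, parse_mkStr, List.reverse_reverse]

theorem strVec_map_elt (l : List K) : strVec (l.map Sym.elt) = l := by
  rw [strVec, parse, foldl_rowStep_elt]
  simp

theorem strNum_mkStr (n : ℕ) (R : List (List K)) (b : List K) :
    strNum (mkStr n R b) = n := by
  have h1 : ∀ n k : ℕ, (List.replicate n (Sym.bit true : Sym K)).foldl numStep k = k + n := by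
    intro n
    induction n with
    | zero => intro k; rfl
    | succ n ih =>
      intro k
      rw [List.replicate_succ, List.foldl_cons, ih]
      simp only [numStep]
      omega
  have h2 : ∀ (l : List K) (k : ℕ), (l.map Sym.elt).foldl numStep k = k := by
    intro l
    induction l with
    | nil => intro k; rfl
    | cons a l ih => intro k; exact ih k
  have h3 : ∀ (R : List (List K)) (k : ℕ), (encRows R).foldl numStep k = k := by
    intro R
    induction R with
    | nil => intro k; rfl
    | cons r R ih =>
      intro k
      rw [encRows_cons, List.foldl_append, h2, List.foldl_cons]
      exact ih k
  rw [strNum, mkStr, List.foldl_append, List.foldl_append, h1, h3, h2, Nat.zero_add]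

/-- The number of nonzero entries. -/
noncomputable def weight [Zero K] (l : List K) : ℕ :=
  l.foldl (fun n a => bif codeEq a 0 then n else n + 1) 0

theorem weight_ofFn [Zero K] [DecidableEq K] {n : ℕ} (x : Fin n → K) :
    weight (List.ofFn x) = hammingNorm x := by
  have key : ∀ (n : ℕ) (x : Fin n → K) (k : ℕ),
      (List.ofFn x).foldl (fun n a => bif codeEq a 0 then n else n + 1) k =
        k + ∑ i, if x i ≠ 0 then 1 else 0 := by
    intro n
    induction n with
    | zero => simp
    | succ n ih =>
      intro x k
      rw [List.ofFn_succ, List.foldl_cons, ih, Fin.sum_univ_succ]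
      by_cases h : x 0 = 0
      · rw [(codeEq_iff _ _).2 h]
        simp [h]
      · have h' : codeEq (x 0) 0 = false := by
          rw [← Bool.not_eq_true, codeEq_iff]
          exact h
        simp [h', h]
        omega
  rw [weight, key, hammingNorm, Finset.card_filter, Nat.zero_add]

/-- One step of a search for the first `#` that collects the symbols before it. -/
def beforeStep (z : Bool × List (Sym K)) : Sym K → Bool × List (Sym K)
  | Sym.hash => (true, z.2)
  | s => (z.1, bif z.1 then z.2 else s :: z.2)

/-- One step of a search for the first `#` that collects the symbols after it. -/
def afterStep (z : Bool × List (Sym K)) (s : Sym K) : Bool × List (Sym K) :=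
  bif z.1 then (true, s :: z.2) else
    match s with
    | Sym.hash => (true, [])
    | _ => (false, [])

/-- The part of a string before the first `#`. -/
def beforeHash (w : List (Sym K)) : List (Sym K) :=
  (w.foldl beforeStep (false, [])).2.reverse

/-- The part of a string after the first `#`. -/
def afterHash (w : List (Sym K)) : List (Sym K) :=
  (w.foldl afterStep (false, [])).2.reverse

theorem beforeHash_pair {w : List (Sym K)} (hw : Sym.hash ∉ w) (v : List (Sym K)) :
    beforeHash (pair w v) = w := by
  have h1 : ∀ (v s : List (Sym K)), (v.foldl beforeStep (true, s)).2 = s := by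
    intro v
    induction v with
    | nil => intro s; rfl
    | cons a v ih => intro s; cases a <;> exact ih s
  have h2 : ∀ (w : List (Sym K)), Sym.hash ∉ w → ∀ s, w.foldl beforeStep (false, s) = (false, w.reverse ++ s) := by
    intro w
    induction w with
    | nil => intro _ s; rfl
    | cons a w ih =>
      intro h s
      rw [List.mem_cons, not_or] at h
      rw [List.foldl_cons, List.reverse_cons, List.append_assoc, List.singleton_append, ← ih h.2]
      cases a
      case hash => exact absurd rfl h.1
      all_goals rfl
  rw [beforeHash, pair, List.foldl_append, h2 w hw, List.foldl_cons, beforeStep, h1]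
  simp

theorem afterHash_pair {w : List (Sym K)} (hw : Sym.hash ∉ w) (v : List (Sym K)) :
    afterHash (pair w v) = v := by
  have h1 : ∀ (v s : List (Sym K)), (v.foldl afterStep (true, s)).2 = v.reverse ++ s := by
    intro v
    induction v with
    | nil => intro s; rfl
    | cons a v ih => intro s; simp [ih, afterStep]
  have h2 : ∀ (w : List (Sym K)), Sym.hash ∉ w → w.foldl afterStep (false, []) = (false, []) := by
    intro w
    induction w with
    | nil => intro _; rfl
    | cons a w ih =>
      intro h
      rw [List.mem_cons, not_or] at h
      rw [List.foldl_cons, ← ih h.2]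
      cases a
      case hash => exact absurd rfl h.1
      all_goals simp [ih h.2, afterStep]
  rw [afterHash, pair, List.foldl_append, h2 w hw, List.foldl_cons]
  simp only [afterStep, cond_false]
  rw [h1]
  simp

namespace PolyFun

/-- The code of an input. -/
theorem str {X : Type*} {g : X → List (Sym K)} : PolyFun orc (fun x : Coded g => g x) :=
  id.of_enc (fun x => x) (fun _ => rfl) fun x => by simp [Rep.enc, FinCode.code]

/-- A function on a set of strings that is computable in polynomial time has a program. -/
theorem exists_program {X : Type*} {g : X → List (Sym K)} {f : X → List (Sym K)}
    (hf : PolyFun (X := Coded g) orc f) : ∃ (c : Prog (Sym K)) (p : Polynomial ℕ), ∀ i x,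
      Outputs (orc.answer i) c (g x) (p.eval (g x).length) (f x) :=
  exists_outputs (h := fun s : List (Sym K) => s) (f := f)
    (hf.of_enc (fun x => x) (fun _ => rfl) fun x => by
      simp [Rep.enc, FinCode.code])

variable [Finite K]

@[fun_prop]
theorem symBit {b : X → Bool} (hb : PolyFun orc b) :
    PolyFun orc (fun x => (Sym.bit (b x) : Sym K)) := of_code _ hb

@[fun_prop]
theorem parse {w : X → List (Sym K)} (hw : PolyFun orc w) : PolyFun orc (fun x => parse (w x)) :=
  foldl_of_le (s₀ := fun _ => (([] : List K), ([] : List (List K))))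
    (step := fun _ z s => CosetWeight.rowStep (fun s r => s ++ [r]) z s) hw (const _)
    (rowStep (X := X) (step := fun _ s r => s ++ [r]) (by fun_prop)) 1 (fun x z s => by
      cases s <;> simp [CosetWeight.rowStep, encRows_append]
      all_goals omega)

@[fun_prop]
theorem strRows {w : X → List (Sym K)} (hw : PolyFun orc w) :
    PolyFun orc (fun x => strRows (w x)) := hw.parse.snd.tailRows

@[fun_prop]
theorem strVec {w : X → List (Sym K)} (hw : PolyFun orc w) :
    PolyFun orc (fun x => strVec (w x)) := hw.parse.fst.reverse

@[fun_prop]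
theorem strNum {w : X → List (Sym K)} (hw : PolyFun orc w) :
    PolyFun orc (fun x => strNum (w x)) :=
  foldl_of_le (s₀ := fun _ => 0) (step := fun _ n s => numStep n s) hw (const _)
    (case snd' (g := fun s (z : (X × ℕ) × Sym K) => numStep z.1.2 s) fun s => by
      rcases s with a | (_ | _) | _ | _ <;> simp only [numStep] <;> fun_prop)
    1 (fun x z s => by rcases s with a | (_ | _) | _ | _ <;> simp [numStep])

@[fun_prop]
theorem mkStr {n : X → ℕ} {R : X → List (List K)} {b : X → List K} (hn : PolyFun orc n)
    (hR : PolyFun orc R) (hb : PolyFun orc b) :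
    PolyFun orc (fun x => mkStr (n x) (R x) (b x)) := by
  unfold CosetWeight.mkStr
  fun_prop

@[fun_prop]
theorem beforeHash {w : X → List (Sym K)} (hw : PolyFun orc w) :
    PolyFun orc (fun x => beforeHash (w x)) :=
  (foldl_of_le (s₀ := fun _ => (false, ([] : List (Sym K))))
    (step := fun _ z s => beforeStep z s) hw (const _)
    (case snd' (g := fun s (z : (X × (Bool × List (Sym K))) × Sym K) => beforeStep z.1.2 s)
      fun s => by cases s <;> simp only [beforeStep] <;> fun_prop)
    1 (fun x z s => by
      rcases z with ⟨_ | _, z⟩ <;> cases s <;> simp [beforeStep]; all_goals omega)).snd.reverse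

@[fun_prop]
theorem afterHash {w : X → List (Sym K)} (hw : PolyFun orc w) :
    PolyFun orc (fun x => afterHash (w x)) :=
  (foldl_of_le (s₀ := fun _ => (false, ([] : List (Sym K))))
    (step := fun _ z s => afterStep z s) hw (const _)
    (case snd' (g := fun s (z : (X × (Bool × List (Sym K))) × Sym K) => afterStep z.1.2 s)
      fun s => by cases s <;> simp only [afterStep] <;> fun_prop)
    1 (fun x z s => by
      rcases z with ⟨_ | _, z⟩ <;> cases s <;> simp [afterStep]; all_goals omega)).snd.reverse

@[fun_prop]
theorem weight [Field K] {l : X → List K} (hl : PolyFun orc l) :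
    PolyFun orc (fun x => weight (l x)) :=
  foldl_of_le (s₀ := fun _ => 0) (step := fun _ n a => bif CosetWeight.codeEq a 0 then n else n + 1)
    hl (const _) (by fun_prop) 1 (fun x s a => by
      cases h : CosetWeight.codeEq a 0 <;> simp [h])

end PolyFun

/-! ### Coset and subspace instances -/

variable [Field K]

/-- The rows of the matrix. -/
def CosetInstance.rows (I : CosetInstance K) : List (List K) := rowsOf I.A

/-- The right-hand side as a list. -/
def CosetInstance.rhs (I : CosetInstance K) : List K := List.ofFn I.b

/-- The rows of the matrix. -/
def SubspaceInstance.rows (I : SubspaceInstance K) : List (List K) := rowsOf I.A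

theorem encMatrix_append {m n : ℕ} (A : Matrix (Fin m) (Fin n) K) (b : List K) :
    encMatrix A ++ b.map Sym.elt = mkStr n (rowsOf A) b := by
  rw [encMatrix, mkStr, encRows_cons, encRows, rowsOf, List.map_ofFn]
  rfl

theorem CosetInstance.enc_eq (I : CosetInstance K) : I.enc = mkStr I.n I.rows I.rhs :=
  encMatrix_append I.A (List.ofFn I.b)

theorem SubspaceInstance.enc_eq (I : SubspaceInstance K) : I.enc = mkStr I.n I.rows [] := by
  rw [SubspaceInstance.rows, ← encMatrix_append, List.map_nil, List.append_nil]
  rfl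

instance : Rep K (CosetInstance K) := ⟨1, fun I => [I.enc], fun _ => rfl⟩

instance : Rep K (SubspaceInstance K) := ⟨1, fun I => [I.enc], fun _ => rfl⟩

theorem sz_cosetInstance (I : CosetInstance K) : sz K I = I.enc.length := by
  simp [sz, Rep.enc]

theorem sz_subspaceInstance (I : SubspaceInstance K) : sz K I = I.enc.length := by
  simp [sz, Rep.enc]

/-- Recognition of coset instances. -/
noncomputable def isCoset (w : List (Sym K)) : Bool :=
  listEq w (mkStr (strNum w) (strRows w) (strVec w)) &&
    ((strRows w).all (fun r => natEq r.length (strNum w)) &&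
      (natEq (strVec w).length (strRows w).length && fullRank (strRows w)))

/-- Recognition of subspace instances. -/
noncomputable def isSubspace (w : List (Sym K)) : Bool :=
  isCoset (mkStr (strNum w) (strRows w) (List.replicate (strRows w).length 0)) &&
    listEq w (mkStr (strNum w) (strRows w) [])

/-- Parsing is total and ignores misplaced symbols, so comparing the string with the code of its
parsed parts excludes every malformed string at once. Row lengths, the length of the right-hand side
and the rank are then checked on the parts. -/
theorem isCoset_iff (w : List (Sym K)) :
    isCoset w = true ↔ w ∈ Set.range (CosetInstance.enc : CosetInstance K → _) := by
  simp only [isCoset, Bool.and_eq_true, listEq_iff, natEq_iff, List.all_eq_true]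
  constructor
  · rintro ⟨h1, h2, h3, h4⟩
    refine ⟨⟨(strRows w).length, strNum w, ofRows _ (strRows w), toVec _ (strVec w), ?_⟩, ?_⟩
    · rw [← fullRank_rowsOf, rowsOf_ofRows h2, h4]
    · rw [CosetInstance.enc_eq, CosetInstance.rows, CosetInstance.rhs]
      simp only
      rw [rowsOf_ofRows h2, ofFn_toVec h3, ← h1]
  · rintro ⟨I, rfl⟩
    rw [CosetInstance.enc_eq, strNum_mkStr, strRows_mkStr, strVec_mkStr]
    exact ⟨rfl, fun r hr => length_of_mem_rowsOf hr, by
      simp [CosetInstance.rows, CosetInstance.rhs, rowsOf],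
      (fullRank_rowsOf I.A).2 I.full_rank⟩

/-- A matrix is a subspace instance exactly if together with a zero right-hand side it is a coset
instance. The final comparison of strings rejects input that carries a right-hand side or stray
symbols. -/
theorem isSubspace_iff (w : List (Sym K)) :
    isSubspace w = true ↔ w ∈ Set.range (SubspaceInstance.enc : SubspaceInstance K → _) := by
  rw [isSubspace, Bool.and_eq_true, isCoset_iff, listEq_iff]
  constructor
  · rintro ⟨⟨I, hI⟩, h⟩
    rw [CosetInstance.enc_eq] at hI
    have h1 := congrArg strNum hI
    have h2 := congrArg strRows hI
    rw [strNum_mkStr, strNum_mkStr] at h1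
    rw [strRows_mkStr, strRows_mkStr] at h2
    refine ⟨⟨I.m, I.n, I.A, I.full_rank⟩, ?_⟩
    rw [SubspaceInstance.enc_eq, h, ← h1, ← h2]
    rfl
  · rintro ⟨I, rfl⟩
    rw [SubspaceInstance.enc_eq, strNum_mkStr, strRows_mkStr]
    refine ⟨⟨⟨I.m, I.n, I.A, 0, I.full_rank⟩, ?_⟩, rfl⟩
    rw [CosetInstance.enc_eq]
    congr 1
    simp [CosetInstance.rhs, SubspaceInstance.rows, rowsOf, Pi.zero_def, List.ofFn_const]

namespace PolyFun

theorem cosetStr {I : X → CosetInstance K} (hI : PolyFun orc I) :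
    PolyFun orc (fun x => (I x).enc) :=
  hI.of_enc_right fun x => by simp [Rep.enc, FinCode.code]

theorem subspaceStr {I : X → SubspaceInstance K} (hI : PolyFun orc I) :
    PolyFun orc (fun x => (I x).enc) :=
  hI.of_enc_right fun x => by simp [Rep.enc, FinCode.code]

theorem coset_of_str {I : X → CosetInstance K} (hI : PolyFun orc fun x => (I x).enc) :
    PolyFun orc I :=
  hI.of_enc_right fun x => by simp [Rep.enc, FinCode.code]

theorem subspace_of_str {I : X → SubspaceInstance K} (hI : PolyFun orc fun x => (I x).enc) :
    PolyFun orc I :=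
  hI.of_enc_right fun x => by simp [Rep.enc, FinCode.code]

variable [Finite K]

@[fun_prop]
theorem cosetNum {I : X → CosetInstance K} (hI : PolyFun orc I) :
    PolyFun orc (fun x => (I x).n) := by
  simpa only [CosetInstance.enc_eq, strNum_mkStr] using hI.cosetStr.strNum

@[fun_prop]
theorem cosetRows {I : X → CosetInstance K} (hI : PolyFun orc I) :
    PolyFun orc (fun x => (I x).rows) := by
  simpa only [CosetInstance.enc_eq, strRows_mkStr] using hI.cosetStr.strRows

@[fun_prop]
theorem cosetRhs {I : X → CosetInstance K} (hI : PolyFun orc I) :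
    PolyFun orc (fun x => (I x).rhs) := by
  simpa only [CosetInstance.enc_eq, strVec_mkStr] using hI.cosetStr.strVec

@[fun_prop]
theorem subspaceNum {I : X → SubspaceInstance K} (hI : PolyFun orc I) :
    PolyFun orc (fun x => (I x).n) := by
  simpa only [SubspaceInstance.enc_eq, strNum_mkStr] using hI.subspaceStr.strNum

@[fun_prop]
theorem subspaceRows {I : X → SubspaceInstance K} (hI : PolyFun orc I) :
    PolyFun orc (fun x => (I x).rows) := by
  simpa only [SubspaceInstance.enc_eq, strRows_mkStr] using hI.subspaceStr.strRows

theorem coset_mk {I : X → CosetInstance K} (hn : PolyFun orc fun x => (I x).n)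
    (hR : PolyFun orc fun x => (I x).rows) (hb : PolyFun orc fun x => (I x).rhs) :
    PolyFun orc I := by
  apply coset_of_str
  simpa only [CosetInstance.enc_eq] using hn.mkStr hR hb

theorem subspace_mk {I : X → SubspaceInstance K} (hn : PolyFun orc fun x => (I x).n)
    (hR : PolyFun orc fun x => (I x).rows) : PolyFun orc I := by
  apply subspace_of_str
  simpa only [SubspaceInstance.enc_eq] using hn.mkStr hR (const [])

@[fun_prop]
theorem isCoset {w : X → List (Sym K)} (hw : PolyFun orc w) :
    PolyFun orc (fun x => isCoset (w x)) := by
  have := hw.strRows.allLength hw.strNum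
  unfold CosetWeight.isCoset
  fun_prop

@[fun_prop]
theorem isSubspace {w : X → List (Sym K)} (hw : PolyFun orc w) :
    PolyFun orc (fun x => isSubspace (w x)) := by
  unfold CosetWeight.isSubspace
  fun_prop

end PolyFun

end Strings

/-! ### Membership in NPO and decision problems -/

section NPO

open Polynomial

variable {K : Type u} [Field K] [Finite K]

/-- The family that consists of the trivial oracle. -/
def trivialOracle (K : Type u) : Oracles K Unit := ⟨fun _ => noOracle⟩

theorem encProp_eq (P : Prop) (b : Bool) (h : b = true ↔ P) :
    (encProp P : List (Sym K)) = [Sym.bit b] := by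
  classical
  rw [encProp]
  congr 2
  rw [Bool.eq_iff_iff, h, decide_eq_true_iff]

theorem polyTimeDecidable_of {L : Set (List (Sym K))} {f : List (Sym K) → Bool}
    (hf : PolyFun (trivialOracle K) f) (h : ∀ w, f w = true ↔ w ∈ L) : PolyTimeDecidable L := by
  obtain ⟨c, p, hc⟩ := PolyFun.exists_program (g := fun w : List (Sym K) => w)
    (f := fun w => [Sym.bit (f w)])
    (hf.comp (PolyFun.str (g := fun w : List (Sym K) => w))).symBit.singleton
  exact ⟨c, p, fun w => by rw [encProp_eq _ _ (h w)]; exact hc () w⟩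

/-- Feasibility for MIN-CWP. -/
noncomputable def isCosetSol (R : List (List K)) (n : ℕ) (b : List K) (s : List (Sym K)) : Bool :=
  listEq s ((strVec s).map Sym.elt) && (natEq (strVec s).length n &&
    listEq (R.map fun r => dot r (strVec s)) b)

theorem PolyFun.isCosetSol {ι : Type w} {orc : Oracles K ι} {X : Type*} [Rep K X]
    {R : X → List (List K)} {n : X → ℕ} {b : X → List K} {s : X → List (Sym K)}
    (hR : PolyFun orc R) (hn : PolyFun orc n) (hb : PolyFun orc b) (hs : PolyFun orc s) :
    PolyFun orc (fun x => isCosetSol (R x) (n x) (b x) (s x)) := by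
  have := mapRowsCode (f := fun x r => CosetWeight.dot r (CosetWeight.strVec (s x))) hR (by fun_prop)
  unfold CosetWeight.isCosetSol
  fun_prop

theorem isCosetSol_iff {m n : ℕ} (A : Matrix (Fin m) (Fin n) K) (b : Fin m → K)
    (s : List (Sym K)) : isCosetSol (rowsOf A) n (List.ofFn b) s = true ↔
      ∃ y : Fin n → K, A.mulVec y = b ∧ encVec y = s := by
  simp only [isCosetSol, Bool.and_eq_true, listEq_iff, natEq_iff, map_dot_rowsOf]
  constructor
  · rintro ⟨h1, h2, h3⟩
    refine ⟨toVec n (strVec s), List.ofFn_injective h3, ?_⟩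
    rw [encVec, ofFn_toVec h2, ← h1]
  · rintro ⟨y, rfl, rfl⟩
    rw [encVec, strVec_map_elt]
    simp

variable [DecidableEq K]

/-- The measure of a solution can be computed in polynomial time. -/
theorem exists_weight_program : ∃ (c : Prog (Sym K)) (q : Polynomial ℕ),
    ∀ (w : List (Sym K)) (n : ℕ) (y : Fin n → K), Sym.hash ∉ w →
      Outputs noOracle c (pair w (encVec y)) (q.eval (pair w (encVec y)).length)
        (encNat (hammingNorm y)) := by
  obtain ⟨c, q, h⟩ := PolyFun.exists_program (orc := trivialOracle K)
    (g := fun w : List (Sym K) => w) (f := fun w => encNat (weight (strVec (afterHash w))))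
    (PolyFun.str (g := fun w : List (Sym K) => w)).afterHash.strVec.weight.encNat
  refine ⟨c, q, fun w n y hw => ?_⟩
  have := h () (pair w (encVec y))
  simp only [afterHash_pair hw, encVec, strVec_map_elt, weight_ofFn] at this
  exact this

theorem minCWP_isNPO : (minCWP K).IsNPO where
  recognizable := polyTimeDecidable_of PolyFun.id.isCoset isCoset_iff
  solutions := by
    -- The number of columns is written in unary, so a solution is no longer than its instance.
    refine ⟨Polynomial.X, fun I y _ => ?_, ?_⟩
    · change (encVec y).length ≤ eval I.enc.length X
      simp only [CosetInstance.enc, length_encVec, length_encMatrix, List.length_append, eval_X]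
      have : (encVec y).length = I.n := length_encVec y
      omega
    · let g : CosetInstance K × List (Sym K) → List (Sym K) := fun z => pair z.1.enc z.2
      have hb : ∀ z, beforeHash (g z) = z.1.enc := fun z =>
        beforeHash_pair ((minCWP K).hash_notMem_encInst z.1) z.2
      have ha : ∀ z, afterHash (g z) = z.2 := fun z =>
        afterHash_pair ((minCWP K).hash_notMem_encInst z.1) z.2
      have hI : PolyFun (X := Coded g) (trivialOracle K) (fun z => Prod.fst z) :=
        PolyFun.coset_of_str ((PolyFun.str (g := g)).beforeHash.congr fun z => (hb z).symm)
      have hs : PolyFun (X := Coded g) (trivialOracle K) (fun z => Prod.snd z) :=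
        (PolyFun.str (g := g)).afterHash.congr fun z => (ha z).symm
      obtain ⟨c, q, h⟩ := PolyFun.exists_program (PolyFun.symBit
        (PolyFun.isCosetSol hI.cosetRows hI.cosetNum hI.cosetRhs hs)).singleton
      refine ⟨c, q, fun I s _ => ?_⟩
      change Outputs noOracle c (pair I.enc s) (q.eval (pair I.enc s).length)
        (encProp (∃ y : Fin I.n → K, I.A.mulVec y = I.b ∧ encVec y = s))
      rw [encProp_eq _ _ (isCosetSol_iff I.A I.b s)]
      exact h () (I, s)
  measure_computable := by
    obtain ⟨c, q, h⟩ := exists_weight_program (K := K)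
    exact ⟨c, q, fun I y _ => h _ _ y ((minCWP K).hash_notMem_encInst I)⟩

/-- Feasibility for the subspace problems in terms of a test `f` of the vector. -/
theorem exists_subspace_program {f : List K → Bool} (hf : PolyFun (trivialOracle K) f) :
    ∃ (c : Prog (Sym K)) (q : Polynomial ℕ), ∀ (I : SubspaceInstance K) (s : List (Sym K)),
      Outputs noOracle c (pair I.enc s) (q.eval (pair I.enc s).length)
        (encProp (∃ y : Fin I.n → K, (f (List.ofFn y) = true ∧ I.A.mulVec y = 0) ∧
          encVec y = s)) := by
  let g : SubspaceInstance K × List (Sym K) → List (Sym K) := fun z => pair z.1.enc z.2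
  have hb : ∀ z, beforeHash (g z) = z.1.enc := fun z =>
    beforeHash_pair ((minSWP K).hash_notMem_encInst z.1) z.2
  have ha : ∀ z, afterHash (g z) = z.2 := fun z =>
    afterHash_pair ((minSWP K).hash_notMem_encInst z.1) z.2
  have hI : PolyFun (X := Coded g) (trivialOracle K) (fun z => Prod.fst z) :=
    PolyFun.subspace_of_str ((PolyFun.str (g := g)).beforeHash.congr fun z => (hb z).symm)
  have hs : PolyFun (X := Coded g) (trivialOracle K) (fun z => Prod.snd z) :=
    (PolyFun.str (g := g)).afterHash.congr fun z => (ha z).symm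
  obtain ⟨c, q, h⟩ := PolyFun.exists_program (PolyFun.symBit
    ((PolyFun.isCosetSol hI.subspaceRows hI.subspaceNum
      (hI.subspaceRows.lengthRows.replicate (PolyFun.const (0 : K))) hs).and
        (hf.comp hs.strVec))).singleton
  refine ⟨c, q, fun I s => ?_⟩
  rw [encProp_eq _ (isCosetSol I.rows I.n (List.replicate I.rows.length 0) s && f (strVec s))]
  · exact h () (I, s)
  · have e : List.replicate I.rows.length (0 : K) = List.ofFn (0 : Fin I.m → K) := by
      simp [SubspaceInstance.rows, rowsOf, Pi.zero_def, List.ofFn_const]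
    rw [Bool.and_eq_true, e, SubspaceInstance.rows, isCosetSol_iff]
    constructor
    · rintro ⟨⟨y, h1, rfl⟩, h2⟩
      rw [encVec, strVec_map_elt] at h2
      exact ⟨y, ⟨h2, h1⟩, rfl⟩
    · rintro ⟨y, ⟨h2, h1⟩, rfl⟩
      rw [encVec, strVec_map_elt]
      exact ⟨⟨y, h1, rfl⟩, h2⟩

theorem length_encVec_le_enc (I : SubspaceInstance K) (y : Fin I.n → K) :
    (encVec y).length ≤ Polynomial.eval I.enc.length Polynomial.X := by
  simp [SubspaceInstance.enc, length_encVec, length_encMatrix]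

theorem minSWP_isNPO : (minSWP K).IsNPO where
  recognizable := polyTimeDecidable_of PolyFun.id.isSubspace isSubspace_iff
  solutions := by
    obtain ⟨c, q, h⟩ := exists_subspace_program (K := K) (f := fun _ => true) (PolyFun.const _)
    refine ⟨Polynomial.X, fun I y _ => length_encVec_le_enc I y, c, q, fun I s _ => ?_⟩
    simp only [true_and] at h
    exact h I s
  measure_computable := by
    obtain ⟨c, q, h⟩ := exists_weight_program (K := K)
    exact ⟨c, q, fun I y _ => h _ _ y ((minSWP K).hash_notMem_encInst I)⟩

/-- Test for a nonzero entry. -/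
noncomputable def nonzero (l : List K) : Bool := !(natEq (weight l) 0)

theorem nonzero_ofFn {n : ℕ} (x : Fin n → K) : nonzero (List.ofFn x) = true ↔ x ≠ 0 := by
  rw [nonzero, weight_ofFn, Bool.not_eq_true', ← Bool.not_eq_true, natEq_iff, hammingNorm_eq_zero]

theorem PolyFun.nonzero {ι : Type w} {orc : Oracles K ι} {X : Type*} [Rep K X] {l : X → List K}
    (hl : PolyFun orc l) : PolyFun orc (fun x => nonzero (l x)) := by
  unfold CosetWeight.nonzero
  fun_prop

theorem minSWPNonzero_isNPO : (minSWPNonzero K).IsNPO where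
  recognizable := polyTimeDecidable_of PolyFun.id.isSubspace isSubspace_iff
  solutions := by
    obtain ⟨c, q, h⟩ := exists_subspace_program (K := K) (f := nonzero) PolyFun.id.nonzero
    refine ⟨Polynomial.X, fun I y _ => length_encVec_le_enc I y, c, q, fun I s _ => ?_⟩
    simp only [nonzero_ofFn] at h
    exact h I s
  measure_computable := by
    obtain ⟨c, q, h⟩ := exists_weight_program (K := K)
    exact ⟨c, q, fun I y _ => h _ _ y ((minSWPNonzero K).hash_notMem_encInst I)⟩

end NPO

/-! ### Optimal values of minimization problems -/

namespace OptProblem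

variable {K : Type u} {A : OptProblem K}

theorem exists_isOptValue (hA : A.opt = Goal.min) {x : A.Inst} (h : (A.Sol x).Nonempty) :
    ∃ v, A.IsOptValue x v := by
  classical
  have hex : ∃ v, ∃ y ∈ A.Sol x, A.measure x y = v := ⟨_, h.choose, h.choose_spec, rfl⟩
  obtain ⟨y, hy, hv⟩ := Nat.find_spec hex
  refine ⟨Nat.find hex, y, ?_, hv⟩
  simp only [OptSol, hA]
  exact ⟨hy, fun z hz => hv ▸ Nat.find_min' hex ⟨z, hz, rfl⟩⟩

theorem isOptValue_iff (hA : A.opt = Goal.min) {x : A.Inst} {v : ℕ} :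
    A.IsOptValue x v ↔ ∃ y ∈ A.Sol x, A.measure x y = v ∧ ∀ z ∈ A.Sol x, v ≤ A.measure x z := by
  simp only [IsOptValue, OptSol, hA]
  constructor
  · rintro ⟨y, ⟨hy, h⟩, rfl⟩
    exact ⟨y, hy, rfl, h⟩
  · rintro ⟨y, hy, rfl, h⟩
    exact ⟨y, ⟨hy, h⟩, rfl⟩

theorem mem_optSol_iff (hA : A.opt = Goal.min) {x : A.Inst} {y : A.Cand x} :
    y ∈ A.OptSol x ↔ y ∈ A.Sol x ∧ ∀ z ∈ A.Sol x, A.measure x y ≤ A.measure x z := by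
  simp only [OptSol, hA]
  rfl

/-- A nonempty set of natural numbers has a minimum, so one cheap feasible solution already
guarantees that an optimal value exists. -/
theorem decides_iff (hA : A.opt = Goal.min) (x : A.Inst) (t : ℕ) :
    A.Decides x t ↔ ∃ y ∈ A.Sol x, A.measure x y ≤ t := by
  have : A.Decides x t ↔ ∃ v, A.IsOptValue x v ∧ v ≤ t := by simp only [Decides, hA]
  rw [this]
  constructor
  · rintro ⟨v, hv, ht⟩
    obtain ⟨y, hy, rfl, _⟩ := (isOptValue_iff hA).1 hv
    exact ⟨y, hy, ht⟩
  · rintro ⟨y, hy, ht⟩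
    obtain ⟨v, hv⟩ := exists_isOptValue hA ⟨y, hy⟩
    obtain ⟨_, _, _, h⟩ := (isOptValue_iff hA).1 hv
    exact ⟨v, hv, (h y hy).trans ht⟩

end OptProblem

section Decides

variable {K : Type u} [Field K] [DecidableEq K]

theorem minCWP_decides_iff (I : CosetInstance K) (t : ℕ) :
    (minCWP K).Decides I t ↔ CWP I.A I.b t :=
  OptProblem.decides_iff rfl _ _

theorem minSWP_decides_iff (I : SubspaceInstance K) (t : ℕ) :
    (minSWP K).Decides I t ↔ SWP I.A t :=
  OptProblem.decides_iff rfl _ _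

theorem minSWPNonzero_decides_iff (I : SubspaceInstance K) (t : ℕ) :
    (minSWPNonzero K).Decides I t ↔ SWPNonzero I.A t :=
  (OptProblem.decides_iff rfl _ _).trans (exists_congr fun _ => and_assoc)

end Decides

/-! ### Reductions between the three problems of a minimization problem -/

section Reductions

open Polynomial

variable {K : Type u} [Field K] [Finite K]

/-- The oracles that solve `R`. -/
def solvers (R : StringProblem (Sym K)) : Oracles K {O : List (Sym K) → List (Sym K) // Solves O R} :=
  ⟨Subtype.val⟩

/-- The oracle family consists of all solvers of `S`, and `f` does not depend on its members. This
gives the uniformity in the definition of a reduction. -/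
theorem PolyFun.reducible {R S : StringProblem (Sym K)} {X : Type*} {g f : X → List (Sym K)}
    (hf : PolyFun (X := Coded g) (solvers S) f)
    (h : ∀ w, (∃ v, R w v) → ∃ x, w = g x ∧ R w (f x)) : PolyTuringReducible R S := by
  obtain ⟨c, p, hc⟩ := hf.exists_program
  refine ⟨c, p, fun O hO w hw => ?_⟩
  obtain ⟨x, rfl, hx⟩ := h w hw
  exact ⟨f x, hx, hc ⟨O, hO⟩ x⟩

/-- Instances are represented by their codes. -/
instance instRepInst (A : OptProblem K) : Rep K A.Inst := ⟨1, fun x => [A.encInst x], fun _ => rfl⟩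

theorem sz_inst (A : OptProblem K) (x : A.Inst) : sz K x = (A.encInst x).length := by
  simp [sz, Rep.enc]

theorem PolyFun.encInst {ι : Type w} {orc : Oracles K ι} {X : Type*} [Rep K X]
    {A : OptProblem K} {f : X → A.Inst} (hf : PolyFun orc f) :
    PolyFun orc fun x => A.encInst (f x) :=
  hf.of_enc_right fun x => by simp [Rep.enc, FinCode.code]

theorem PolyFun.inst_of_enc {ι : Type w} {orc : Oracles K ι} {X : Type*} [Rep K X]
    {A : OptProblem K} {f : X → A.Inst} (hf : PolyFun orc fun x => A.encInst (f x)) :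
    PolyFun orc f :=
  hf.of_enc_right fun x => by simp [Rep.enc, FinCode.code]

theorem PolyFun.reducible_inst {A : OptProblem K} {R S : StringProblem (Sym K)}
    {f : A.Inst → List (Sym K)} (hf : PolyFun (solvers S) f)
    (h : ∀ w, (∃ v, R w v) → ∃ x, w = A.encInst x ∧ R w (f x)) : PolyTuringReducible R S :=
  PolyFun.reducible (g := A.encInst)
    (hf.of_enc (X := Coded A.encInst) (fun x => x) (fun _ => rfl) fun _ => rfl) h

/-- There is a feasible solution of measure at most `t`. -/
noncomputable def leq (A : OptProblem K) (z : A.Inst × ℕ) : Bool :=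
  open Classical in decide (∃ y ∈ A.Sol z.1, A.measure z.1 y ≤ z.2)

theorem leq_iff (A : OptProblem K) (x : A.Inst) (t : ℕ) :
    leq A (x, t) = true ↔ ∃ y ∈ A.Sol x, A.measure x y ≤ t := by
  classical
  exact decide_eq_true_iff

/-- A minimization problem with small solutions for which it is easy to recognize the existence of
solutions and of solutions of measure zero. -/
structure EasyMin (A : OptProblem K) where
  opt_eq : A.opt = Goal.min
  bound : A.Inst → ℕ
  bound_poly : ∀ {ι : Type u} (orc : Oracles K ι), PolyFun orc bound
  measure_le : ∀ x, ∀ y ∈ A.Sol x, A.measure x y ≤ bound x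
  bound_le : ∀ x, bound x ≤ (A.encInst x).length
  cand_le : ∀ x, ∀ y ∈ A.Sol x, (A.encCand x y).length ≤ (A.encInst x).length
  zero : A.Inst → Bool
  zero_poly : ∀ {ι : Type u} (orc : Oracles K ι), PolyFun orc zero
  zero_iff : ∀ x, zero x = true ↔ ∃ y ∈ A.Sol x, A.measure x y = 0
  solvable : A.Inst → Bool
  solvable_poly : ∀ {ι : Type u} (orc : Oracles K ι), PolyFun orc solvable
  solvable_iff : ∀ x, solvable x = true ↔ (A.Sol x).Nonempty
  base : A.Inst
  base_solvable : (A.Sol base).Nonempty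

namespace EasyMin

variable {A : OptProblem K} (E : EasyMin A)

/-- The optimal value (and `E.bound x` if there is no solution). -/
noncomputable def val (x : A.Inst) : ℕ := search (fun t => leq A (x, t)) (E.bound x)

theorem isOptValue_iff_eq_val (x : A.Inst) (hx : (A.Sol x).Nonempty) (v : ℕ) :
    A.IsOptValue x v ↔ v = E.val x := by
  obtain ⟨v₀, hv₀⟩ := OptProblem.exists_isOptValue E.opt_eq hx
  have key : ∀ v, A.IsOptValue x v → E.val x = v := by
    intro v hv
    obtain ⟨y, hy, rfl, h⟩ := (OptProblem.isOptValue_iff E.opt_eq).1 hv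
    refine search_eq (E.measure_le x y hy) ((leq_iff A x _).2 ⟨y, hy, le_rfl⟩) fun u hu => ?_
    rw [← Bool.not_eq_true, leq_iff]
    rintro ⟨z, hz, hzu⟩
    exact absurd (h z hz) (by omega)
  exact ⟨fun h => (key v h).symm, fun h => by rw [h, key _ hv₀]; exact hv₀⟩

theorem leq_iff_val_le (x : A.Inst) (hx : (A.Sol x).Nonempty) (t : ℕ) :
    leq A (x, t) = true ↔ E.val x ≤ t := by
  obtain ⟨y, hy, h1, h2⟩ := (OptProblem.isOptValue_iff E.opt_eq).1
    ((E.isOptValue_iff_eq_val x hx _).2 rfl)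
  rw [leq_iff]
  exact ⟨fun ⟨z, hz, ht⟩ => (h2 z hz).trans ht, fun h => ⟨y, hy, h1 ▸ h⟩⟩

theorem mem_optSol_iff_val (x : A.Inst) (y : A.Cand x) :
    y ∈ A.OptSol x ↔ y ∈ A.Sol x ∧ A.measure x y ≤ E.val x := by
  rw [OptProblem.mem_optSol_iff E.opt_eq]
  refine and_congr_right fun hy => ?_
  obtain ⟨z, hz, h1, h2⟩ := (OptProblem.isOptValue_iff E.opt_eq).1
    ((E.isOptValue_iff_eq_val x ⟨y, hy⟩ _).2 rfl)
  exact ⟨fun h => h1 ▸ h z hz, fun h w hw => h.trans (h2 w hw)⟩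

section FromLeq

variable {ι : Type u} {orc : Oracles K ι} {S : StringProblem (Sym K)}

/-- The bound is computed in unary, so all thresholds up to it can be tried one by one. -/
theorem val_poly (hleq : PolyFun orc (leq A)) : PolyFun orc E.val :=
  PolyFun.search (P := fun x t => leq A (x, t)) (E.bound_poly orc)
    (hleq.comp (f := fun z : A.Inst × ℕ => (z.1, z.2)) (by fun_prop))

theorem evaluation_reducible (E : EasyMin A) (hleq : PolyFun (solvers S) (leq A)) :
    PolyTuringReducible A.evaluation S := by
  refine PolyFun.reducible_inst (A := A) (f := fun x => encNat (E.val x))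
    (E.val_poly hleq).encNat ?_
  rintro w ⟨v, x, rfl, n, hn, rfl⟩
  have hx : (A.Sol x).Nonempty := by
    obtain ⟨y, hy, _⟩ := (OptProblem.isOptValue_iff E.opt_eq).1 hn
    exact ⟨y, hy⟩
  exact ⟨x, rfl, x, rfl, E.val x, (E.isOptValue_iff_eq_val x hx _).2 rfl, rfl⟩

/-- The threshold `t` comes in binary and may be exponential in the input size, so it cannot be
converted to unary. The search over `u ≤ E.bound x` compares binary codes and returns the minimum of
`t` and the bound; capping `t` at a bound of all measures does not affect the answer. -/
theorem decision_reducible (E : EasyMin A) (hleq : PolyFun (solvers S) (leq A)) :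
    PolyTuringReducible A.decision S := by
  let g : {z : A.Inst × ℕ // 0 < z.2} → List (Sym K) := fun z =>
    pair (A.encInst z.1.1) (encNat z.1.2)
  have hb : ∀ z, beforeHash (g z) = A.encInst z.1.1 := fun z =>
    beforeHash_pair (A.hash_notMem_encInst _) _
  have ha : ∀ z, afterHash (g z) = encNat z.1.2 := fun z =>
    afterHash_pair (A.hash_notMem_encInst _) _
  have hI : PolyFun (X := Coded g) (Y := A.Inst) (solvers S) (fun z => z.1.1) :=
    ((PolyFun.str (g := g)).beforeHash.congr fun z => (hb z).symm).inst_of_enc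
  have ht : PolyFun (X := Coded g) (solvers S) fun z => (encNat z.1.2 : List (Sym K)) :=
    (PolyFun.str (g := g)).afterHash.congr fun z => (ha z).symm
  have hcap : PolyFun (X := Coded g) (solvers S) fun z =>
      search (fun u => listEq (encNat u : List (Sym K)) (encNat z.1.2)) (E.bound z.1.1) := by
    refine PolyFun.search (P := fun (z : Coded g) u =>
      listEq (encNat u : List (Sym K)) (encNat z.1.2)) ((E.bound_poly _).comp hI) ?_
    have := ht.comp (PolyFun.fst' (X := Coded g) (Y := ℕ))
    fun_prop
  refine PolyFun.reducible (hleq.comp (hI.pair' hcap)).symBit.singleton ?_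
  rintro w ⟨v, x, t, ht, rfl, rfl⟩
  refine ⟨⟨(x, t), ht⟩, rfl, x, t, ht, rfl, ?_⟩
  rw [encProp_eq (A.Decides x t) (leq A (x, search (fun u =>
    listEq (encNat u : List (Sym K)) (encNat t)) (E.bound x)))]
  rw [OptProblem.decides_iff E.opt_eq, leq_iff]
  refine exists_congr fun y => and_congr_right fun hy => ?_
  have hm := E.measure_le x y hy
  rcases le_or_gt t (E.bound x) with h | h
  · rw [search_eq h ((listEq_iff _ _).2 rfl) fun u hu => by
      rw [← Bool.not_eq_true, listEq_iff]
      exact fun h' => hu.ne (encNat_injective h')]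
  · obtain ⟨h1, _, h3⟩ := search_spec (fun u => listEq (encNat u : List (Sym K)) (encNat t))
      (E.bound x)
    have : search (fun u => listEq (encNat u : List (Sym K)) (encNat t)) (E.bound x) =
        E.bound x := by
      by_contra hne
      have := encNat_injective ((listEq_iff _ _).1 (h3 (by omega)))
      omega
    rw [this]
    exact ⟨fun _ => by omega, fun _ => by omega⟩

/-- A function that computes a solution of minimal measure yields a reduction of the constructive
problem. -/
theorem constructive_reducible (hleq : PolyFun (solvers S) (leq A))
    {f : A.Inst → List K} (hf : PolyFun (solvers S) f)
    (h : ∀ x, (A.Sol x).Nonempty → ∃ y ∈ A.Sol x, A.measure x y ≤ E.val x ∧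
      A.encCand x y = (f x).map Sym.elt) : PolyTuringReducible A.constructive S := by
  refine PolyFun.reducible_inst (A := A)
    (f := fun x => (f x).map Sym.elt ++ Sym.hash :: encNat (E.val x))
    (hf.mapElt.append ((PolyFun.const Sym.hash).cons (E.val_poly hleq).encNat)) ?_
  rintro w ⟨v, x, rfl, y, hy, _⟩
  obtain ⟨z, hz, h1, h2⟩ := h x ⟨y, ((E.mem_optSol_iff_val x y).1 hy).1⟩
  have hz' := (E.mem_optSol_iff_val x z).2 ⟨hz, h1⟩
  refine ⟨x, rfl, x, rfl, z, hz', ?_⟩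
  rw [pair, h2, (E.isOptValue_iff_eq_val x ⟨z, hz⟩ _).1 ⟨z, hz', rfl⟩]

end FromLeq

/-- The given instance if it is solvable, and the base instance otherwise. -/
noncomputable def proper (x : A.Inst) : A.Inst :=
  bif E.solvable x then x else E.base

/-- An oracle for the evaluation or the constructive problem may answer anything, at any length, if
the instance has no solution. Replacing unsolvable instances by a fixed solvable one keeps every
query under control. -/
theorem proper_solvable (x : A.Inst) : (A.Sol (E.proper x)).Nonempty := by
  cases h : E.solvable x
  · rw [proper, h]
    exact E.base_solvable
  · rw [proper, h]
    exact (E.solvable_iff x).1 h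

theorem val_proper_le (x : A.Inst) :
    E.val (E.proper x) ≤ (A.encInst (E.proper x)).length :=
  (search_spec _ _).1.trans (E.bound_le _)

theorem length_proper_le (x : A.Inst) :
    (A.encInst (E.proper x)).length ≤ (A.encInst x).length + (A.encInst E.base).length := by
  cases h : E.solvable x <;> simp [proper, h]

variable {ι : Type u} {orc : Oracles K ι}

theorem proper_poly : PolyFun orc fun x => A.encInst (E.proper x) := by
  have := E.solvable_poly orc
  have h : PolyFun orc E.proper := by
    unfold proper
    fun_prop
  exact h.encInst

/-- The value is given in binary and `t` in unary. The search looks for a `u ≤ t` with the same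
binary code as the value, and succeeds exactly if the value is at most `t`; the test of solvability
covers the instances that were replaced. -/
theorem leq_poly_of_val (h : PolyFun orc fun x => (encNat (E.val (E.proper x)) : List (Sym K))) :
    PolyFun orc (leq A) := by
  have h1 : PolyFun orc fun z : A.Inst × ℕ => search (fun u =>
      listEq (encNat u : List (Sym K)) (encNat (E.val (E.proper z.1)))) z.2 := by
    refine PolyFun.search (P := fun (z : A.Inst × ℕ) u =>
      listEq (encNat u : List (Sym K)) (encNat (E.val (E.proper z.1)))) (by fun_prop) ?_
    have := h.comp (f := fun z : (A.Inst × ℕ) × ℕ => z.1.1) (by fun_prop)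
    fun_prop
  have h2 := h.comp (PolyFun.fst' (X := A.Inst) (Y := ℕ))
  have h3 := (E.solvable_poly orc).comp (PolyFun.fst' (X := A.Inst) (Y := ℕ))
  refine (h3.and (h1.encNat.listEq h2)).congr fun z => ?_
  rw [Bool.eq_iff_iff, Bool.and_eq_true, listEq_iff, E.solvable_iff]
  obtain ⟨x, t⟩ := z
  by_cases hx : (A.Sol x).Nonempty
  · have hp : E.proper x = x := by simp [proper, (E.solvable_iff x).2 hx]
    rw [E.leq_iff_val_le x hx, hp]
    constructor
    · intro hle
      refine ⟨hx, ?_⟩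
      rw [search_eq hle ((listEq_iff _ _).2 rfl) fun u hu => by
        rw [← Bool.not_eq_true, listEq_iff]
        exact fun h' => hu.ne (encNat_injective h')]
    · rintro ⟨_, he⟩
      rw [← encNat_injective he]
      exact (search_spec _ _).1
  · refine iff_of_false (fun h => ?_) fun h => hx h.1
    obtain ⟨y, hy, _⟩ := (leq_iff A x t).1 h
    exact hx ⟨y, hy⟩

theorem leq_poly_evaluation (E : EasyMin A) : PolyFun (solvers A.evaluation) (leq A) := by
  have hans : ∀ (O : {O : List (Sym K) → List (Sym K) // Solves O A.evaluation})
      (x : A.Inst), O.1 (A.encInst (E.proper x)) = encNat (E.val (E.proper x)) := by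
    intro O x
    have hv := (E.isOptValue_iff_eq_val _ (E.proper_solvable x) _).2 rfl
    obtain ⟨x', hx', n, hn, h⟩ := O.2 _ ⟨_, E.proper x, rfl, _, hv, rfl⟩
    obtain rfl := A.encInst_injective hx'
    rw [h, (E.isOptValue_iff_eq_val _ (E.proper_solvable x) _).1 hn]
  refine E.leq_poly_of_val (PolyFun.query E.proper_poly PolyFun.id hans
    -- The answer is at most as long as the value it denotes, which is at most the length of the
    -- instance asked about, that is, of `x` or of the base instance.
    (Polynomial.X + ((A.encInst E.base).length : Polynomial ℕ)) fun O x => ?_)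
  change (O.1 _).length ≤ _
  rw [hans]
  have h1 := E.val_proper_le x
  have h2 := E.length_proper_le x
  have h3 := length_encNat_le (K := K) (E.val (E.proper x))
  simp only [eval_add, eval_X, eval_natCast, sz_inst, Nat.cast_id]
  omega

/-- Different solvers may return different optimal solutions. Only the value after the `#` is used,
and all solvers agree on it, as `PolyFun.query` requires. -/
theorem leq_poly_constructive (E : EasyMin A) : PolyFun (solvers A.constructive) (leq A) := by
  have hans : ∀ (O : {O : List (Sym K) → List (Sym K) // Solves O A.constructive})
      (x : A.Inst), ∃ y ∈ A.Sol (E.proper x), O.1 (A.encInst (E.proper x)) =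
        pair (A.encCand _ y) (encNat (E.val (E.proper x))) := by
    intro O x
    obtain ⟨y, hy, h1⟩ := (E.isOptValue_iff_eq_val _ (E.proper_solvable x) _).2 rfl
    obtain ⟨x', hx', z, hz, h⟩ := O.2 _ ⟨_, E.proper x, rfl, y, hy, rfl⟩
    obtain rfl := A.encInst_injective hx'
    refine ⟨z, ((E.mem_optSol_iff_val _ z).1 hz).1, ?_⟩
    rw [h, (E.isOptValue_iff_eq_val _ (E.proper_solvable x) _).1 ⟨z, hz, rfl⟩]
  refine E.leq_poly_of_val (PolyFun.query E.proper_poly PolyFun.id.afterHash (fun O x => ?_)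
    (2 * (Polynomial.X + ((A.encInst E.base).length : Polynomial ℕ)) + 1) fun O x => ?_)
  · obtain ⟨y, hy, h⟩ := hans O x
    change afterHash (O.1 _) = _
    rw [h, afterHash_pair (A.hash_notMem_encCand _ _)]
  · obtain ⟨y, hy, h⟩ := hans O x
    change (O.1 _).length ≤ _
    rw [h]
    have h1 := E.val_proper_le x
    have h2 := E.length_proper_le x
    have h3 := length_encNat_le (K := K) (E.val (E.proper x))
    have h4 := E.cand_le _ y hy
    simp only [eval_add, eval_mul, eval_X, eval_natCast, eval_ofNat, eval_one, sz_inst,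
      Nat.cast_id, pair, List.length_append, List.length_cons]
    omega

/-- Decision instances need a positive threshold. The expression `z.2 - 1 + 1` equals `z.2` if this
is positive and `1` otherwise, so every query is legal; threshold zero is left to `E.zero`. -/
theorem leq_poly_decision (E : EasyMin A) : PolyFun (solvers A.decision) (leq A) := by
  have hans : ∀ (O : {O : List (Sym K) → List (Sym K) // Solves O A.decision})
      (z : A.Inst × ℕ), O.1 (pair (A.encInst z.1) (encNat (z.2 - 1 + 1))) =
        [Sym.bit (leq A (z.1, z.2 - 1 + 1))] := by
    intro O z
    obtain ⟨x, t, ht, h1, h2⟩ := O.2 _ ⟨_, z.1, z.2 - 1 + 1, by omega, rfl, rfl⟩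
    have e1 : A.encInst z.1 = A.encInst x := by
      have := congrArg beforeHash h1
      rwa [beforeHash_pair (A.hash_notMem_encInst _), beforeHash_pair (A.hash_notMem_encInst _)]
        at this
    have e2 : z.2 - 1 + 1 = t := by
      have := congrArg afterHash h1
      rw [afterHash_pair (A.hash_notMem_encInst _), afterHash_pair (A.hash_notMem_encInst _)]
        at this
      exact encNat_injective this
    obtain rfl := A.encInst_injective e1
    rw [h2, encProp_eq (A.Decides z.1 t) (leq A (z.1, z.2 - 1 + 1))]
    rw [leq_iff, OptProblem.decides_iff E.opt_eq, e2]
  have hstr : PolyFun (solvers A.decision) fun z : A.Inst × ℕ =>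
      pair (A.encInst z.1) (encNat (z.2 - 1 + 1)) := by
    have := (PolyFun.fst' (K := K) (X := A.Inst) (Y := ℕ) (orc := solvers A.decision)).encInst
    unfold pair
    fun_prop
  have hq : PolyFun (solvers A.decision) fun z : A.Inst × ℕ =>
      leq A (z.1, z.2 - 1 + 1) := by
    refine PolyFun.query hstr (post := fun s => codeEq (s.headD Sym.hash) (Sym.bit true))
      (by fun_prop) (fun O z => ?_) 1 (fun O z => ?_)
    · change codeEq ((O.1 _).headD _) _ = _
      rw [hans, Bool.eq_iff_iff, codeEq_iff]
      simp
    · change (O.1 _).length ≤ _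
      rw [hans]
      simp
  have h3 := (E.zero_poly (solvers A.decision)).comp
    (PolyFun.fst' (X := A.Inst) (Y := ℕ))
  have h4 : PolyFun (solvers A.decision) fun z : A.Inst × ℕ =>
      bif natEq z.2 0 then E.zero z.1 else leq A (z.1, z.2 - 1 + 1) := by fun_prop
  refine h4.congr fun z => ?_
  obtain ⟨x, t⟩ := z
  rcases t with _ | t
  · simp only [natEq, decide_true, cond_true]
    rw [Bool.eq_iff_iff, leq_iff, E.zero_iff]
    simp
  · simp [natEq]

/-- The three problems are equivalent if a solution of minimal measure can be computed from
`leq`. -/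
theorem allTuringEquivalent {f : A.Inst → List K}
    (hf : ∀ {ι : Type u} (orc : Oracles K ι), PolyFun orc (leq A) → PolyFun orc f)
    (h : ∀ x, (A.Sol x).Nonempty → ∃ y ∈ A.Sol x, A.measure x y ≤ E.val x ∧
      A.encCand x y = (f x).map Sym.elt) : A.AllTuringEquivalent :=
  ⟨⟨E.constructive_reducible E.leq_poly_evaluation (hf _ E.leq_poly_evaluation) h,
      E.evaluation_reducible E.leq_poly_constructive⟩,
    ⟨E.evaluation_reducible E.leq_poly_decision, E.decision_reducible E.leq_poly_evaluation⟩,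
    ⟨E.constructive_reducible E.leq_poly_decision (hf _ E.leq_poly_decision) h,
      E.decision_reducible E.leq_poly_constructive⟩⟩

end EasyMin

end Reductions

/-! ### MIN-CWP -/

/-! ### Vectors with at most one nonzero coordinate -/

section Singles

open Polynomial

variable {K : Type u} [Field K]

section Poly

variable [Finite K]

variable (K) in
/-- The elements of `K`. -/
noncomputable def elems : List K := (Set.finite_univ : (Set.univ : Set K).Finite).toFinset.toList

theorem mem_elems (a : K) : a ∈ elems K := by simp [elems]

variable (K) in
/-- The vectors of length `n` with at most one nonzero coordinate. -/
noncomputable def singles : ℕ → List (List K)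
  | 0 => []
  | n + 1 => ((elems K).map fun a => a :: List.replicate n 0) ++ (singles n).map fun r => 0 :: r

/-- The recursion also needs the zero vector of the current length. Carrying it in the state makes
the recursion an iteration. -/
theorem singles_iterate (n : ℕ) : (fun s : List K × List (List K) =>
      (0 :: s.1, ((elems K).map fun a => a :: s.1) ++ s.2.map fun r => 0 :: r))^[n] ([], []) =
    (List.replicate n 0, singles K n) := by
  induction n with
  | zero => rfl
  | succ n ih => rw [Function.iterate_succ_apply', ih]; rfl

theorem length_of_mem_singles (n : ℕ) : ∀ e ∈ singles K n, e.length = n := by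
  induction n with
  | zero => simp [singles]
  | succ n ih =>
    simp only [singles, List.mem_append, List.mem_map]
    rintro e (⟨a, _, rfl⟩ | ⟨r, hr, rfl⟩)
    · simp
    · simp [ih r hr]

theorem single_mem_singles {n : ℕ} (j : Fin n) (a : K) :
    List.ofFn (Pi.single j a : Fin n → K) ∈ singles K n := by
  induction n with
  | zero => exact j.elim0
  | succ n ih =>
    simp only [singles, List.mem_append, List.mem_map, List.ofFn_succ]
    refine Fin.cases (Or.inl ⟨a, mem_elems a, ?_⟩) (fun j => Or.inr ⟨_, ih j, ?_⟩) j
    · simp [List.ofFn_const]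
    · rw [Pi.single_eq_of_ne (Fin.succ_ne_zero j).symm]
      congr 2
      funext i
      simp [Pi.single_apply]

theorem exists_single_of_mem_singles (n : ℕ) :
    ∀ e ∈ singles K n, ∃ (j : Fin n) (a : K), e = List.ofFn (Pi.single j a : Fin n → K) := by
  induction n with
  | zero => simp [singles]
  | succ n ih =>
    simp only [singles, List.mem_append, List.mem_map]
    rintro e (⟨a, _, rfl⟩ | ⟨r, hr, rfl⟩)
    · exact ⟨0, a, by simp [List.ofFn_succ, List.ofFn_const]⟩
    · obtain ⟨j, a, rfl⟩ := ih r hr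
      refine ⟨j.succ, a, ?_⟩
      rw [List.ofFn_succ, Pi.single_eq_of_ne (Fin.succ_ne_zero j).symm]
      congr 2
      funext i
      simp [Pi.single_apply]

theorem hammingNorm_singles_le [DecidableEq K] (n : ℕ) :
    ∀ e ∈ singles K n, hammingNorm (toVec n e) ≤ 1 := by
  intro e he
  obtain ⟨j, a, rfl⟩ := exists_single_of_mem_singles n e he
  rw [toVec_ofFn, hammingNorm]
  refine (Finset.card_le_card (t := {j}) fun i hi => ?_).trans (by simp)
  by_contra hne
  simp [Pi.single_eq_of_ne (Finset.mem_singleton.not.1 hne)] at hi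

theorem length_encRows_singles (n : ℕ) :
    (encRows (singles K n)).length = n * (elems K).length * (n + 1) := by
  have h1 : ∀ (m : ℕ) (R : List (List K)), (∀ r ∈ R, r.length = m) →
      (encRows R).length = R.length * (m + 1) := by
    intro m R hR
    induction R with
    | nil => simp [encRows]
    | cons r R ih =>
      rw [length_encRows_cons, ih fun s hs => hR s (by simp [hs]), hR r (by simp), List.length_cons]
      ring
  rw [h1 n _ (length_of_mem_singles n)]
  congr 1
  induction n with
  | zero => simp [singles]
  | succ n ih =>
    simp only [singles, List.length_append, List.length_map, ih]
    ring

variable {ι : Type w} {orc : Oracles K ι} {X : Type*} [Rep K X]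

namespace PolyFun

theorem map_cons_const (L : List K) {r : X → List K} (hr : PolyFun orc r) :
    PolyFun orc (fun x => L.map fun a => a :: r x) := by
  induction L with
  | nil => exact const []
  | cons a L ih => exact ((const a).cons hr).consRow ih

@[fun_prop]
theorem singles {n : X → ℕ} (hn : PolyFun orc n) : PolyFun orc (fun x => singles K (n x)) := by
  -- A step lengthens every row, so the growth per step is not bounded by a constant and the size of
  -- the state is bounded explicitly.
  have h := (iterate (s₀ := fun _ : X => (([], []) : List K × List (List K)))
    (step := fun _ s => (0 :: s.1, ((elems K).map fun a => a :: s.1) ++ s.2.map fun r => 0 :: r))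
    hn (const _) ?_
    (Polynomial.X + Polynomial.X * ((elems K).length : Polynomial ℕ) * (Polynomial.X + 1))
    fun x k hk => ?_).snd
  · simpa only [singles_iterate] using h
  · have h1 := map_cons_const (elems K) (r := fun z : X × List K × List (List K) => z.2.1)
      (orc := orc) (by fun_prop)
    have h2 := mapRows (R := fun z : X × List K × List (List K) => z.2.2)
      (f := fun _ r => (0 : K) :: r) (orc := orc) (by fun_prop) (by fun_prop) (by simp)
    fun_prop
  · rw [singles_iterate]
    simp only [sz_prod, sz_list, sz_rows, List.length_replicate, length_encRows_singles, eval_add,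
      eval_mul, eval_X, eval_natCast, eval_one, Nat.cast_id]
    gcongr <;> omega

end PolyFun

end Poly

end Singles

/-! ### Greedy construction of a lightest vector of a coset -/

section CWP

open Polynomial

variable {K : Type u} [Field K] [Finite K] [DecidableEq K]

theorem mulVec_surjective {m n : ℕ} {A : Matrix (Fin m) (Fin n) K} (hA : A.rank = m) :
    Function.Surjective A.mulVec := by
  have : LinearMap.range A.mulVecLin = ⊤ := by
    apply Submodule.eq_top_of_finrank_eq
    rw [Module.finrank_fin_fun]
    exact hA
  exact LinearMap.range_eq_top.1 this

theorem PolyFun.of_coset {ι : Type w} {orc : Oracles K ι} {Y : Type*} [Rep K Y]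
    {f : CosetInstance K → Y} (hf : PolyFun orc f) : PolyFun (X := (minCWP K).Inst) orc f := hf

variable (K) in
/-- MIN-CWP is easy to handle. -/
noncomputable def easyCWP : EasyMin (minCWP K) where
  opt_eq := rfl
  bound := CosetInstance.n
  bound_poly _ := PolyFun.of_coset PolyFun.id.cosetNum
  measure_le I y _ := hammingNorm_le_card_fintype.trans (Fintype.card_fin _).le
  bound_le I := by
    change I.n ≤ (encMatrix I.A ++ encVec I.b).length
    rw [List.length_append, length_encMatrix]
    exact le_add_right (Nat.le_add_right I.n _)
  cand_le I y _ := by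
    change (encVec y).length ≤ (encMatrix I.A ++ encVec I.b).length
    rw [List.length_append, length_encMatrix]
    exact (length_encVec (y : Fin I.n → K)).le.trans (le_add_right (Nat.le_add_right I.n _))
  zero := fun I : CosetInstance K => !(nonzero I.rhs)
  zero_poly _ := PolyFun.of_coset PolyFun.id.cosetRhs.nonzero.not
  zero_iff I := by
    change (!(nonzero (List.ofFn I.b))) = true ↔ _
    rw [Bool.not_eq_true', ← Bool.not_eq_true, nonzero_ofFn, not_not]
    constructor
    · intro h
      exact ⟨(0 : Fin I.n → K), (Matrix.mulVec_zero I.A).trans h.symm,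
        show hammingNorm (0 : Fin I.n → K) = 0 from hammingNorm_zero⟩
    · rintro ⟨y, hy, h0⟩
      obtain rfl : y = (0 : Fin I.n → K) := hammingNorm_eq_zero.1 h0
      exact Eq.trans (Eq.symm hy) (Matrix.mulVec_zero I.A)
  solvable := fun _ => true
  solvable_poly _ := PolyFun.const true
  solvable_iff I := iff_of_true rfl (mulVec_surjective I.full_rank I.b)
  base := (⟨0, 0, 0, 0, by simp⟩ : CosetInstance K)
  base_solvable := ⟨(0 : Fin 0 → K), Matrix.mulVec_zero _⟩

/-- The instance whose solutions are the solutions of `I` minus `e`. -/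
noncomputable def CosetInstance.shift (I : CosetInstance K) (e : List K) : CosetInstance K :=
  ⟨I.m, I.n, I.A, I.b - I.A.mulVec (toVec I.n e), I.full_rank⟩

theorem CosetInstance.rhs_shift (I : CosetInstance K) (e : List K) :
    (I.shift e).rhs = zipD (fun a b => a - b) 0 I.rhs (I.rows.map fun r => dot r e) := by
  change List.ofFn (I.b - I.A.mulVec (toVec I.n e)) = _
  rw [CosetInstance.rhs, zipD_ofFn, CosetInstance.rows, map_dot_rowsOf]
  congr 1
  funext i
  simp

theorem CosetInstance.length_enc_shift (I : CosetInstance K) (e : List K) :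
    (I.shift e).enc.length = I.enc.length := by
  simp only [CosetInstance.enc, List.length_append, length_encMatrix, length_encVec]
  rfl

@[fun_prop]
theorem PolyFun.shift {ι : Type w} {orc : Oracles K ι} {X : Type*} [Rep K X]
    {I : X → CosetInstance K} {e : X → List K} (hI : PolyFun orc I) (he : PolyFun orc e) :
    PolyFun orc (fun x => (I x).shift (e x)) := by
  refine coset_mk (I := fun x => (I x).shift (e x)) hI.cosetNum hI.cosetRows ?_
  simp only [CosetInstance.rhs_shift]
  have h := mapRowsCode (f := fun x r => CosetWeight.dot r (e x)) hI.cosetRows (orc := orc)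
    (by fun_prop)
  exact zipD (f := fun _ a b => a - b) (d := fun _ => 0) (by fun_prop) (by fun_prop) hI.cosetRhs h

/-- There is a solution of weight at most `t`. -/
noncomputable def cosetLeq (z : CosetInstance K × ℕ) : Bool := leq (minCWP K) z

theorem cosetLeq_iff (I : CosetInstance K) (t : ℕ) :
    cosetLeq (I, t) = true ↔ ∃ y : Fin I.n → K, I.A.mulVec y = I.b ∧ hammingNorm y ≤ t :=
  leq_iff (minCWP K) I t

/-- If the instance gets a better value by subtracting `e`, do it, and add `e` to the partial
solution. -/
noncomputable def cosetStep (s : CosetInstance K × List K × ℕ) (e : List K) :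
    CosetInstance K × List K × ℕ :=
  bif !(natEq s.2.2 0) && cosetLeq (s.1.shift e, s.2.2 - 1) then
    (s.1.shift e, zipD (fun a b => a + b) 0 s.2.1 e, s.2.2 - 1) else s

/-- An optimal solution. -/
noncomputable def cosetSolution (I : CosetInstance K) : List K :=
  ((singles K I.n).foldl cosetStep (I, List.replicate I.n 0, (easyCWP K).val I)).2.1

theorem PolyFun.cosetSolution {ι : Type u} {orc : Oracles K ι}
    (h : PolyFun orc (leq (minCWP K))) : PolyFun orc (cosetSolution : CosetInstance K → List K) := by
  have hleq : PolyFun orc (cosetLeq (K := K)) := h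
  have hval : PolyFun (X := CosetInstance K) orc (easyCWP K).val := (easyCWP K).val_poly h
  have hstep : PolyFun orc fun z : (CosetInstance K × CosetInstance K × List K × ℕ) × List K =>
      cosetStep z.1.2 z.2 := by
    have h1 : PolyFun orc fun z : (CosetInstance K × CosetInstance K × List K × ℕ) × List K =>
        cosetLeq (z.1.2.1.shift z.2, z.1.2.2.2 - 1) := hleq.comp
      (f := fun z : (CosetInstance K × CosetInstance K × List K × ℕ) × List K =>
        (z.1.2.1.shift z.2, z.1.2.2.2 - 1)) (by fun_prop)
    have h2 : PolyFun orc fun z : (CosetInstance K × CosetInstance K × List K × ℕ) × List K =>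
        CosetWeight.zipD (fun a b => a + b) 0 z.1.2.2.1 z.2 :=
      zipD (f := fun _ a b => a + b) (d := fun _ => 0) (by fun_prop) (by fun_prop) (by fun_prop)
        (by fun_prop)
    unfold cosetStep
    fun_prop
  -- The growth constant is `0`: shifting keeps the length of the instance, the partial solution
  -- keeps its length, and the counter never increases.
  refine (foldRows_of_le (R := fun I : CosetInstance K => CosetWeight.singles K I.n)
    (s₀ := fun I => (I, List.replicate I.n 0, (easyCWP K).val I)) (step := fun _ => cosetStep)
    (by fun_prop) ?_ hstep 0 fun I s r => ?_).snd.fst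
  · fun_prop
  · rw [cosetStep]
    cases hc : !(CosetWeight.natEq s.2.2 0) && cosetLeq (s.1.shift r, s.2.2 - 1)
    · simp
    · simp only [cond_true, sz_prod, sz_cosetInstance, CosetInstance.length_enc_shift, sz_list,
        length_zipD, sz_nat]
      omega

/-- Translation by `x` identifies the solutions of the shifted instance with those of `I`, and
weight becomes distance from `x`. Thus the oracle measures how far `x` is from the solution set. -/
theorem cosetLeq_shift_iff (I : CosetInstance K) (x : Fin I.n → K) (t : ℕ) :
    cosetLeq (I.shift (List.ofFn x), t) = true ↔
      ∃ z : Fin I.n → K, I.A.mulVec z = I.b ∧ hammingDist z x ≤ t := by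
  rw [cosetLeq_iff]
  constructor
  · rintro ⟨(y : Fin I.n → K), hy, ht⟩
    change I.A.mulVec y = I.b - I.A.mulVec (toVec I.n (List.ofFn x)) at hy
    rw [toVec_ofFn] at hy
    refine ⟨y + x, ?_, ?_⟩
    · rw [Matrix.mulVec_add, hy, sub_add_cancel]
    · rw [hammingDist_comm, hammingDist_eq_hammingNorm, add_comm, add_neg_cancel_right]
      exact ht
  · rintro ⟨z, hz, ht⟩
    refine ⟨z - x, ?_, ?_⟩
    · change I.A.mulVec (z - x) = I.b - I.A.mulVec (toVec I.n (List.ofFn x))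
      rw [toVec_ofFn, Matrix.mulVec_sub, hz]
    · rwa [hammingDist_comm, hammingDist_eq_hammingNorm, neg_add_eq_sub] at ht

/-- The partial solution `x` can be completed with `t` more changes to an optimal solution, and no
vector of `P` brings it closer to the solutions. -/
structure CosetInvariant (I : CosetInstance K) (d : ℕ) (P : Set (Fin I.n → K)) (x : Fin I.n → K)
    (t : ℕ) : Prop where
  norm_le : hammingNorm x + t ≤ d
  dist_le : ∃ z, I.A.mulVec z = I.b ∧ hammingDist z x ≤ t
  le_dist : ∀ z, I.A.mulVec z = I.b → t ≤ hammingDist z x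
  le_dist_add : ∀ e ∈ P, ∀ z, I.A.mulVec z = I.b → t ≤ hammingDist z (x + e)

theorem hammingDist_self_add {n : ℕ} (x e : Fin n → K) :
    hammingDist (x + e) x = hammingNorm e := by
  rw [hammingDist_comm, hammingDist_eq_hammingNorm, neg_add_cancel_left]

/-- One pass suffices because rejection is permanent. An accepted `v` lowers the distance `t` by one
and changes only one coordinate, so the distance from `x + v + e` is at least that from `x + e`
minus one; a vector `e` that was no gain at `x` is no gain at `x + v`. The weight of `x` rises by at
most one per accepted step, which `t` pays for. -/
theorem foldl_cosetStep (I : CosetInstance K) (d : ℕ) : ∀ (L : List (List K))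
    (P : Set (Fin I.n → K)) (x : Fin I.n → K) (t : ℕ),
    (∀ e ∈ L, e.length = I.n ∧ hammingNorm (toVec I.n e) ≤ 1) → CosetInvariant I d P x t →
    ∃ x' t', L.foldl cosetStep (I.shift (List.ofFn x), List.ofFn x, t) =
      (I.shift (List.ofFn x'), List.ofFn x', t') ∧
      CosetInvariant I d (P ∪ {v | List.ofFn v ∈ L}) x' t' := by
  intro L
  induction L with
  | nil => intro P x t _ h; exact ⟨x, t, rfl, by simpa using h⟩
  | cons e L ih =>
    intro P x t hL h
    obtain ⟨he, he1⟩ := hL e (by simp)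
    obtain ⟨v, rfl⟩ : ∃ v : Fin I.n → K, e = List.ofFn v := ⟨toVec I.n e, (ofFn_toVec he).symm⟩
    rw [toVec_ofFn] at he1
    have hP : P ∪ {w | List.ofFn w ∈ List.ofFn v :: L} =
        insert v P ∪ {w | List.ofFn w ∈ L} := by
      ext w
      simp only [List.mem_cons, List.ofFn_inj, Set.mem_union, Set.mem_ofPred_eq, Set.mem_insert_iff]
      tauto
    have hshift : (I.shift (List.ofFn x)).shift (List.ofFn v) = I.shift (List.ofFn (x + v)) := by
      have : I.b - I.A.mulVec (toVec I.n (List.ofFn x)) - I.A.mulVec (toVec I.n (List.ofFn v)) =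
          I.b - I.A.mulVec (toVec I.n (List.ofFn (x + v))) := by
        simp only [toVec_ofFn, Matrix.mulVec_add, sub_add_eq_sub_sub]
      exact congrArg (fun b => (⟨I.m, I.n, I.A, b, I.full_rank⟩ : CosetInstance K)) this
    have hadd : zipD (fun a b => a + b) 0 (List.ofFn x) (List.ofFn v) = List.ofFn (x + v) := by
      rw [zipD_ofFn]
      congr 1
      funext i
      simp
    have hlt : hammingNorm (x + v) ≤ hammingNorm v + hammingNorm x := by
      have := hammingDist_triangle (x + v) x 0
      rwa [hammingDist_self_add, hammingDist_zero_right, hammingDist_zero_right] at this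
    have hclose : ∀ z w : Fin I.n → K, hammingDist z w ≤ hammingDist z (w + v) + 1 := by
      intro z w
      have := hammingDist_triangle z (w + v) w
      rw [hammingDist_self_add] at this
      omega
    rw [List.foldl_cons, hP]
    by_cases hc : t ≠ 0 ∧ ∃ z, I.A.mulVec z = I.b ∧ hammingDist z (x + v) ≤ t - 1
    · have hstep : cosetStep (I.shift (List.ofFn x), List.ofFn x, t) (List.ofFn v) =
          (I.shift (List.ofFn (x + v)), List.ofFn (x + v), t - 1) := by
        have : (!(natEq t 0) && cosetLeq (I.shift (List.ofFn (x + v)), t - 1)) = true := by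
          rw [Bool.and_eq_true, Bool.not_eq_true', ← Bool.not_eq_true, natEq_iff, cosetLeq_shift_iff]
          exact hc
        rw [cosetStep]
        simp only [hshift, this, hadd, cond_true]
      rw [hstep]
      obtain ⟨h0, hz⟩ := hc
      have h1 := h.norm_le
      refine ih _ _ _ (fun e he => hL e (by simp [he])) ⟨by omega, hz, fun z hz => ?_, ?_⟩
      · have := h.le_dist z hz
        have := hclose z x
        omega
      · rintro w (rfl | hw) z hz
        -- The vector just accepted is useless a second time: `x + w + w` differs from `x` in at
        -- most one coordinate.
        · have h2 := h.le_dist z hz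
          have h3 := hammingDist_triangle z (x + w + w) x
          have h4 : hammingDist (x + w + w) x ≤ 1 := by
            rw [add_assoc, hammingDist_self_add]
            refine le_trans (Finset.card_le_card fun i hi => ?_) he1
            simp only [Finset.mem_filter, Finset.mem_univ, true_and, Pi.add_apply] at hi ⊢
            exact fun h => hi (by rw [h, add_zero])
          omega
        · have h2 := h.le_dist_add w hw z hz
          have h3 := hclose z (x + w)
          rw [add_right_comm] at h3
          omega
    · have hstep : cosetStep (I.shift (List.ofFn x), List.ofFn x, t) (List.ofFn v) =
          (I.shift (List.ofFn x), List.ofFn x, t) := by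
        have : (!(natEq t 0) && cosetLeq (I.shift (List.ofFn (x + v)), t - 1)) = false := by
          rw [← Bool.not_eq_true, Bool.and_eq_true, Bool.not_eq_true', ← Bool.not_eq_true,
            natEq_iff, cosetLeq_shift_iff]
          exact hc
        rw [cosetStep]
        simp only [hshift, this, cond_false]
      rw [hstep]
      refine ih _ _ _ (fun e he => hL e (by simp [he])) ⟨h.norm_le, h.dist_le, h.le_dist, ?_⟩
      rintro w (rfl | hw) z hz
      · by_contra hlt
        exact hc ⟨by omega, z, hz, by omega⟩
      · exact h.le_dist_add w hw z hz

theorem cosetSolution_spec (I : CosetInstance K) : ∃ y : Fin I.n → K, I.A.mulVec y = I.b ∧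
    hammingNorm y ≤ (easyCWP K).val I ∧ encVec y = (cosetSolution I).map Sym.elt := by
  have hI : I.shift (List.ofFn (0 : Fin I.n → K)) = I := by
    rw [CosetInstance.shift, toVec_ofFn, Matrix.mulVec_zero, sub_zero]
  obtain ⟨z₀, hz₀⟩ := mulVec_surjective I.full_rank I.b
  have hval := fun t => (easyCWP K).leq_iff_val_le I ⟨z₀, hz₀⟩ t
  have hleq := cosetLeq_shift_iff I 0
  simp only [hI, hammingDist_zero_right] at hleq
  have h0 : CosetInvariant I ((easyCWP K).val I) ∅ 0 ((easyCWP K).val I) := by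
    refine ⟨by simp, ?_, fun z hz => ?_, by simp⟩
    · simpa using (hleq _).1 ((hval _).2 le_rfl)
    · rw [hammingDist_zero_right]
      exact (hval _).1 ((hleq _).2 ⟨z, hz, le_rfl⟩)
  obtain ⟨x, t, hfold, h⟩ := foldl_cosetStep I _ (singles K I.n) ∅ 0 _
    (fun e he => ⟨length_of_mem_singles _ e he, hammingNorm_singles_le _ e he⟩) h0
  have hx : cosetSolution I = List.ofFn x := by
    rw [cosetSolution]
    have hz : List.ofFn (0 : Fin I.n → K) = List.replicate I.n 0 := List.ofFn_const _ _
    rw [hI, hz] at hfold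
    rw [hfold]
  obtain ⟨z, hz, hzt⟩ := h.dist_le
  -- Let `z` be a nearest solution. If it differed from `x` at `j`, adding the single with entry `z
  -- j - x j` would bring `x` strictly closer to `z`, but all singles have been rendered useless by
  -- the pass.
  have hzx : z = x := by
    by_contra hne
    obtain ⟨j, hj⟩ := Function.ne_iff.1 hne
    have h1 := h.le_dist_add (Pi.single j (z j - x j)) (Or.inr (single_mem_singles _ _)) z hz
    have h2 : hammingDist z (x + Pi.single j (z j - x j)) < hammingDist z x := by
      refine Finset.card_lt_card ((Finset.ssubset_iff_of_subset fun i hi => ?_).2 ⟨j, ?_, ?_⟩)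
      · simp only [Finset.mem_filter, Finset.mem_univ, true_and, Pi.add_apply] at hi ⊢
        rcases eq_or_ne i j with rfl | hij
        · exact hj
        · simpa [Pi.single_eq_of_ne hij] using hi
      · simpa using hj
      · simp
    omega
  subst hzx
  exact ⟨z, hz, (Nat.le_add_right _ _).trans h.norm_le, by rw [hx]; rfl⟩

theorem minCWP_allTuringEquivalent : (minCWP K).AllTuringEquivalent :=
  (easyCWP K).allTuringEquivalent (f := cosetSolution) (fun _ h => PolyFun.cosetSolution h)
    fun I _ => cosetSolution_spec I

end CWP

/-! ### MIN-SWP with the zero solution excluded -/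

/-! ### Kernels of lists of rows, and what the rank test says about them -/

section Kernel

variable {K : Type u} [Field K]

/-- The vectors of length `n` that are orthogonal to all rows. -/
def Ker (n : ℕ) (R : List (List K)) : Submodule K (Fin n → K) where
  carrier := {y | ∀ r ∈ R, toVec n r ⬝ᵥ y = 0}
  add_mem' h1 h2 r hr := by rw [dotProduct_add, h1 r hr, h2 r hr, add_zero]
  zero_mem' r _ := dotProduct_zero _
  smul_mem' a y h r hr := by rw [dotProduct_smul, h r hr, smul_zero]

theorem mem_Ker {n : ℕ} {R : List (List K)} {y : Fin n → K} :
    y ∈ Ker n R ↔ ∀ r ∈ R, toVec n r ⬝ᵥ y = 0 := Iff.rfl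

theorem mem_Ker_append {n : ℕ} {R : List (List K)} {e : List K} {y : Fin n → K} :
    y ∈ Ker n (R ++ [e]) ↔ y ∈ Ker n R ∧ toVec n e ⬝ᵥ y = 0 := by
  simp [mem_Ker, or_imp, forall_and]

theorem mem_Ker_rowsOf {m n : ℕ} (A : Matrix (Fin m) (Fin n) K) (y : Fin n → K) :
    y ∈ Ker n (rowsOf A) ↔ A.mulVec y = 0 := by
  rw [mem_Ker, funext_iff, rowsOf, List.forall_mem_ofFn_iff]
  simp only [toVec_ofFn]
  rfl

/-- By duality, a functional that vanishes on the common kernel of finitely many functionals is a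
combination of them. So if `c` vanishes on the kernel, it is a combination of the rows. Conversely,
pairing a relation with a `y` in the kernel isolates the coefficient of `c`. -/
theorem indep_append_iff {n : ℕ} {R : List (List K)} (hR : Indep n R) (c : List K) :
    Indep n (R ++ [c]) ↔ ∃ y ∈ Ker n R, toVec n c ⬝ᵥ y ≠ 0 := by
  have hget : ∀ i < R.length, (R ++ [c]).getD i [] = R.getD i [] := fun i hi =>
    List.getD_append _ _ _ _ hi
  have hlast : (R ++ [c]).getD R.length [] = c := by simp
  have hsum : ∀ a : ℕ → K, ∑ i ∈ Finset.range (R ++ [c]).length,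
      a i • toVec n ((R ++ [c]).getD i []) =
        ∑ i ∈ Finset.range R.length, a i • toVec n (R.getD i []) + a R.length • toVec n c := by
    intro a
    rw [List.length_append, List.length_singleton, Finset.sum_range_succ, hlast]
    congr 1
    exact Finset.sum_congr rfl fun i hi => by rw [hget i (Finset.mem_range.1 hi)]
  constructor
  · intro h
    by_contra! hy
    let L : Fin R.length → ((Fin n → K) →ₗ[K] K) := fun i =>
      dotProductBilin K K (toVec n (R.getD i []))
    have hmem : dotProductBilin K K (toVec n c) ∈ Submodule.span K (Set.range L) := by
      refine mem_span_of_iInf_ker_le_ker fun y hy' => hy y fun r hr => ?_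
      obtain ⟨i, hi, rfl⟩ := List.getElem_of_mem hr
      have := (Submodule.mem_iInf _).1 hy' ⟨i, hi⟩
      simpa [L, List.getElem?_eq_getElem hi] using this
    obtain ⟨a, ha⟩ := (Submodule.mem_span_range_iff_exists_fun K).1 hmem
    have hc : toVec n c = ∑ i, a i • toVec n (R.getD i []) := by
      funext j
      have := LinearMap.congr_fun ha (Pi.single j 1)
      simpa [L, LinearMap.sum_apply, Finset.sum_apply] using this.symm
    -- The combination representing `c`, with coefficient `-1` at `c` itself.
    let b : ℕ → K := fun i => if hi : i < R.length then a ⟨i, hi⟩ else -1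
    have hb := h b (by
      rw [hsum, hc, Finset.sum_range]
      simp [b]) R.length (by simp)
    simp [b] at hb
  · rintro ⟨y, hy, hne⟩ a ha
    rw [hsum] at ha
    have h0 : a R.length = 0 := by
      have := congrArg (fun v => v ⬝ᵥ y) ha
      simp only [add_dotProduct, sum_dotProduct, smul_dotProduct, zero_dotProduct] at this
      rw [Finset.sum_eq_zero fun i hi => ?_, zero_add] at this
      · exact (mul_eq_zero.1 this).resolve_right hne
      · have hi' := Finset.mem_range.1 hi
        rw [List.getD_eq_getElem _ _ hi', hy _ (List.getElem_mem hi'), smul_zero]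
    rw [h0, zero_smul, add_zero] at ha
    intro i hi
    rw [List.length_append, List.length_singleton] at hi
    rcases Nat.lt_succ_iff_lt_or_eq.1 hi with hi | rfl
    · exact hR a ha i hi
    · exact h0

theorem fullRank_append_iff {n : ℕ} {R : List (List K)} (hR : ∀ r ∈ R, r.length = n)
    (hfull : fullRank R = true) {c : List K} (hc : c.length = n) :
    fullRank (R ++ [c]) = true ↔ ∃ y ∈ Ker n R, toVec n c ⬝ᵥ y ≠ 0 := by
  rw [fullRank_iff (n := n) (by simpa [or_imp, forall_and] using ⟨hR, hc⟩),
    indep_append_iff ((fullRank_iff hR).1 hfull)]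

end Kernel

/-! ### Cutting the kernel down to a line through a lightest vector -/

section SWP

open Polynomial

variable {K : Type u} [Field K] [Finite K] [DecidableEq K]

theorem PolyFun.of_subspace {ι : Type w} {orc : Oracles K ι} {Y : Type*} [Rep K Y]
    {f : SubspaceInstance K → Y} (hf : PolyFun orc f) :
    PolyFun (X := (minSWPNonzero K).Inst) orc f := hf

/-- By rank-nullity the kernel has dimension `n - m`, so solvability is a comparison of dimensions.
-/
theorem exists_ne_zero_mulVec_eq_zero_iff {m n : ℕ} {A : Matrix (Fin m) (Fin n) K}
    (hA : A.rank = m) : (∃ y, y ≠ 0 ∧ A.mulVec y = 0) ↔ m ≠ n := by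
  have h := LinearMap.finrank_range_add_finrank_ker A.mulVecLin
  rw [Module.finrank_fin_fun] at h
  have h1 : Module.finrank K (LinearMap.range A.mulVecLin) = m := hA
  have h2 : m ≠ n ↔ LinearMap.ker A.mulVecLin ≠ ⊥ := by
    rw [Ne, Ne, ← Submodule.finrank_eq_zero (R := K)]
    omega
  rw [h2, Submodule.ne_bot_iff]
  exact exists_congr fun y => and_comm

variable (K) in
/-- MIN-SWP with nonzero solutions is easy to handle. -/
noncomputable def easySWPNonzero : EasyMin (minSWPNonzero K) where
  opt_eq := rfl
  bound := SubspaceInstance.n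
  bound_poly _ := PolyFun.of_subspace PolyFun.id.subspaceNum
  measure_le I y _ := hammingNorm_le_card_fintype.trans (Fintype.card_fin _).le
  bound_le I := by
    change I.n ≤ (encMatrix I.A).length
    rw [length_encMatrix]
    exact Nat.le_add_right I.n _
  cand_le I y _ := (length_encVec_le_enc I y).trans eval_X.le
  zero := fun _ => false
  zero_poly _ := PolyFun.const false
  zero_iff I := by
    refine iff_of_false Bool.false_ne_true ?_
    rintro ⟨(y : Fin I.n → K), ⟨h, _⟩, h0⟩
    exact h (hammingNorm_eq_zero.1 h0)
  solvable := fun I : SubspaceInstance K => !(natEq I.rows.length I.n)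
  solvable_poly _ := PolyFun.of_subspace
    (PolyFun.id.subspaceRows.lengthRows.natEq PolyFun.id.subspaceNum).not
  solvable_iff I := by
    change (!(natEq (List.ofFn fun i => List.ofFn (I.A i)).length I.n)) = true ↔ _
    rw [List.length_ofFn, Bool.not_eq_true', ← Bool.not_eq_true, natEq_iff]
    exact (exists_ne_zero_mulVec_eq_zero_iff I.full_rank).symm
  base := (⟨0, 1, 0, by simp⟩ : SubspaceInstance K)
  base_solvable := ⟨(1 : Fin 1 → K), one_ne_zero, Matrix.zero_mulVec _⟩

/-- The instance with an additional row, if this row has the right length and is independent of the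
other rows. -/
noncomputable def SubspaceInstance.extend (J : SubspaceInstance K) (e : List K) :
    SubspaceInstance K :=
  if h : natEq e.length J.n = true ∧ fullRank (J.rows ++ [e]) = true then
    ⟨_, J.n, ofRows J.n (J.rows ++ [e]), by
      have hR : ∀ r ∈ J.rows ++ [e], r.length = J.n := by
        simp only [List.mem_append, List.mem_singleton]
        rintro r (hr | rfl)
        · exact length_of_mem_rowsOf hr
        · exact (natEq_iff _ _).1 h.1
      rw [← fullRank_rowsOf, rowsOf_ofRows hR]
      exact h.2⟩
  else J

theorem SubspaceInstance.n_extend (J : SubspaceInstance K) (e : List K) : (J.extend e).n = J.n := by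
  rw [extend]
  split_ifs <;> rfl

theorem SubspaceInstance.rows_extend (J : SubspaceInstance K) (e : List K) : (J.extend e).rows =
    bif natEq e.length J.n && fullRank (J.rows ++ [e]) then J.rows ++ [e] else J.rows := by
  rw [extend]
  split_ifs with h
  · rw [h.1, h.2]
    refine rowsOf_ofRows ?_
    simp only [List.mem_append, List.mem_singleton]
    rintro r (hr | rfl)
    · exact length_of_mem_rowsOf hr
    · exact (natEq_iff _ _).1 h.1
  · rw [← Bool.and_eq_true, Bool.not_eq_true] at h
    rw [h]
    rfl

@[fun_prop]
theorem PolyFun.extend {ι : Type w} {orc : Oracles K ι} {X : Type*} [Rep K X]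
    {J : X → SubspaceInstance K} {e : X → List K} (hJ : PolyFun orc J) (he : PolyFun orc e) :
    PolyFun orc (fun x => (J x).extend (e x)) := by
  refine subspace_mk (I := fun x => (J x).extend (e x)) ?_ ?_
  · simpa only [SubspaceInstance.n_extend] using hJ.subspaceNum
  · simp only [SubspaceInstance.rows_extend]
    fun_prop

theorem SubspaceInstance.length_enc (J : SubspaceInstance K) :
    J.enc.length = J.n + 1 + (encRows J.rows).length := by
  rw [enc_eq, mkStr]
  simp [encRows_cons]
  omega

theorem SubspaceInstance.length_enc_extend_le (J : SubspaceInstance K) (e : List K) :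
    (J.extend e).enc.length ≤ J.enc.length + (e.length + 1) := by
  rw [length_enc, length_enc, n_extend, rows_extend]
  cases natEq e.length J.n && fullRank (J.rows ++ [e])
  · simp
  · simp [encRows_append, encRows_cons, encRows]
    omega

/-- There is a nonzero solution of weight at most `t`. -/
noncomputable def subspaceLeq (z : SubspaceInstance K × ℕ) : Bool := leq (minSWPNonzero K) z

/-- The number of columns is a separate variable `n` with an equation, so that vectors keep the type
`Fin n → K` while the instance changes along a fold. -/
theorem subspaceLeq_iff {J : SubspaceInstance K} {n : ℕ} (hn : J.n = n) (t : ℕ) :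
    subspaceLeq (J, t) = true ↔ ∃ y ∈ Ker n J.rows, y ≠ 0 ∧ hammingNorm y ≤ t := by
  subst hn
  refine (leq_iff (minSWPNonzero K) J t).trans (exists_congr fun (y : Fin J.n → K) => ?_)
  rw [SubspaceInstance.rows, mem_Ker_rowsOf]
  exact and_congr_left' and_comm |>.trans and_assoc

/-- Add the row if this does not increase the optimal value `d`. -/
noncomputable def subspaceStep (d : ℕ) (J : SubspaceInstance K) (e : List K) : SubspaceInstance K :=
  bif subspaceLeq (J.extend e, d) then J.extend e else J

/-- An instance whose nonzero solutions are optimal solutions of `I`, unique up to scalars. -/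
noncomputable def subspaceReduced (I : SubspaceInstance K) : SubspaceInstance K :=
  (singles K I.n).foldl (subspaceStep ((easySWPNonzero K).val I)) I

/-- A single that does not vanish on the solutions. -/
noncomputable def subspaceSingle (J : SubspaceInstance K) : List K :=
  (singles K J.n).foldl (fun s e => bif fullRank (J.rows ++ [e]) then e else s) []

/-- The coordinates of a solution are found by the tests which singles have value `1` at it. -/
noncomputable def subspaceVector (J : SubspaceInstance K) : List K :=
  (singles K J.n).foldl (fun x e =>
    bif fullRank (J.rows ++ [zipD (fun a b => a - b) 0 (subspaceSingle J) e]) then x else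
      zipD (fun a b => bif codeEq b 0 then a else b⁻¹) 0 x e) (List.replicate J.n 0)

section Poly

variable {ι : Type u} {orc : Oracles K ι}

theorem PolyFun.subspaceReduced (h : PolyFun orc (leq (minSWPNonzero K))) :
    PolyFun orc (subspaceReduced : SubspaceInstance K → SubspaceInstance K) := by
  have hleq : PolyFun orc (subspaceLeq (K := K)) := h
  have hval : PolyFun (X := SubspaceInstance K) orc (easySWPNonzero K).val :=
    (easySWPNonzero K).val_poly h
  refine foldRows_of_le (R := fun I : SubspaceInstance K => CosetWeight.singles K I.n)
    (s₀ := fun I => I) (step := fun I => subspaceStep ((easySWPNonzero K).val I))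
    (by fun_prop) (by fun_prop) ?_ 1 fun I s r => ?_
  · have h1 := hval.comp (f := fun z : (SubspaceInstance K × SubspaceInstance K) × List K => z.1.1)
      (by fun_prop)
    have h2 := hleq.comp (f := fun z : (SubspaceInstance K × SubspaceInstance K) × List K =>
      (z.1.2.extend z.2, (easySWPNonzero K).val z.1.1)) (by fun_prop)
    unfold subspaceStep
    fun_prop
  · rw [subspaceStep, one_mul]
    cases subspaceLeq (s.extend r, (easySWPNonzero K).val I)
    · simp
    · simpa only [cond_true, sz_subspaceInstance] using s.length_enc_extend_le r

theorem PolyFun.subspaceSingle :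
    PolyFun orc (subspaceSingle : SubspaceInstance K → List K) := by
  refine foldRows_of_le (R := fun J : SubspaceInstance K => CosetWeight.singles K J.n)
    (s₀ := fun _ => []) (step := fun J s e => bif CosetWeight.fullRank (J.rows ++ [e]) then e else s)
    (by fun_prop) (by fun_prop) (by fun_prop) 1 fun J s r => ?_
  cases CosetWeight.fullRank (J.rows ++ [r])
  · simp
  · simp
    omega

theorem PolyFun.subspaceVector :
    PolyFun orc (subspaceVector : SubspaceInstance K → List K) := by
  refine foldRows_of_le (R := fun J : SubspaceInstance K => CosetWeight.singles K J.n)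
    (s₀ := fun J => List.replicate J.n 0) (step := fun J x e =>
    bif CosetWeight.fullRank (J.rows ++ [CosetWeight.zipD (fun a b => a - b) 0
      (CosetWeight.subspaceSingle J) e]) then x else
      CosetWeight.zipD (fun a b => bif CosetWeight.codeEq b 0 then a else b⁻¹) 0 x e)
    (by fun_prop) (by fun_prop) ?_ 0 fun J s r => ?_
  · have h0 := PolyFun.subspaceSingle.comp (orc := orc)
      (f := fun z : (SubspaceInstance K × List K) × List K => z.1.1) (by fun_prop)
    have h1 := zipD (orc := orc) (f := fun _ a b => a - b) (d := fun _ => 0) (by fun_prop)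
      (by fun_prop) h0 (m := fun z : (SubspaceInstance K × List K) × List K => z.2) (by fun_prop)
    have h2 := zipD (orc := orc) (f := fun _ a b => bif CosetWeight.codeEq b 0 then a else b⁻¹)
      (d := fun _ => 0) (by fun_prop) (by fun_prop)
      (l := fun z : (SubspaceInstance K × List K) × List K => z.1.2)
      (m := fun z : (SubspaceInstance K × List K) × List K => z.2) (by fun_prop) (by fun_prop)
    fun_prop
  · cases CosetWeight.fullRank (J.rows ++ [CosetWeight.zipD (fun a b => a - b) 0
      (CosetWeight.subspaceSingle J) r])
    · simp [length_zipD]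
    · simp

end Poly

theorem SubspaceInstance.fullRank_append_iff {J : SubspaceInstance K} {n : ℕ} (hn : J.n = n)
    {e : List K} (he : e.length = n) :
    fullRank (J.rows ++ [e]) = true ↔ ∃ y ∈ Ker n J.rows, toVec n e ⬝ᵥ y ≠ 0 := by
  subst hn
  exact CosetWeight.fullRank_append_iff (fun r hr => length_of_mem_rowsOf hr)
    ((fullRank_rowsOf J.A).2 J.full_rank) he

/-- A row of the right length is refused only if it depends on the others. It then vanishes on the
kernel anyway, so the kernel is cut by `e` in either case. -/
theorem mem_Ker_extend {J : SubspaceInstance K} {n : ℕ} (hn : J.n = n) {e : List K}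
    (he : e.length = n) (y : Fin n → K) :
    y ∈ Ker n (J.extend e).rows ↔ y ∈ Ker n J.rows ∧ toVec n e ⬝ᵥ y = 0 := by
  have hlen : natEq e.length J.n = true := (natEq_iff _ _).2 (he.trans hn.symm)
  rw [SubspaceInstance.rows_extend, hlen, Bool.true_and]
  cases h : fullRank (J.rows ++ [e])
  · rw [← Bool.not_eq_true, J.fullRank_append_iff hn he] at h
    push Not at h
    exact ⟨fun hy => ⟨hy, h y hy⟩, And.left⟩
  · exact mem_Ker_append

/-- The nonzero solutions of weight at most `d` of an instance are still among the solutions, and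
the vectors of `P` vanish on all solutions or on no nonzero solution of weight at most `d`. -/
structure SubspaceInvariant (n d : ℕ) (N : Submodule K (Fin n → K)) (P : Set (List K))
    (J : SubspaceInstance K) : Prop where
  n_eq : J.n = n
  ker_le : Ker n J.rows ≤ N
  exists_mem : ∃ y ∈ Ker n J.rows, y ≠ 0 ∧ hammingNorm y ≤ d
  dichotomy : ∀ e ∈ P, (∀ y ∈ Ker n J.rows, toVec n e ⬝ᵥ y = 0) ∨
    ∀ y ∈ Ker n J.rows, y ≠ 0 → hammingNorm y ≤ d → toVec n e ⬝ᵥ y ≠ 0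

/-- An accepted row vanishes on the new kernel. A row is refused because no nonzero kernel vector of
weight at most `d` is orthogonal to it. Both alternatives persist, as the kernel only shrinks. -/
theorem foldl_subspaceStep {n d : ℕ} {N : Submodule K (Fin n → K)} : ∀ (L : List (List K))
    (P : Set (List K)) (J : SubspaceInstance K), (∀ e ∈ L, e.length = n) →
    SubspaceInvariant n d N P J →
    SubspaceInvariant n d N (P ∪ {e | e ∈ L}) (L.foldl (subspaceStep d) J) := by
  intro L
  induction L with
  | nil => intro P J _ h; simpa using h
  | cons e L ih =>
    intro P J hL h
    have he := hL e (by simp)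
    have hP : P ∪ {r | r ∈ e :: L} = insert e P ∪ {r | r ∈ L} := by
      ext r
      simp only [List.mem_cons, Set.mem_union, Set.mem_ofPred_eq, Set.mem_insert_iff]
      tauto
    have hker := mem_Ker_extend h.n_eq he
    have hleq := subspaceLeq_iff ((J.n_extend e).trans h.n_eq) d
    rw [List.foldl_cons, hP]
    refine ih _ _ (fun r hr => hL r (by simp [hr])) ?_
    rw [subspaceStep]
    cases hc : subspaceLeq (J.extend e, d)
    · refine ⟨h.n_eq, h.ker_le, h.exists_mem, ?_⟩
      rintro r (rfl | hr)
      · refine Or.inr fun y hy hy0 hyd h0 => ?_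
        rw [hleq.2 ⟨y, (hker y).2 ⟨hy, h0⟩, hy0, hyd⟩] at hc
        exact absurd hc (by simp)
      · exact h.dichotomy r hr
    · refine ⟨(J.n_extend e).trans h.n_eq, fun y hy => h.ker_le ((hker y).1 hy).1, hleq.1 hc, ?_⟩
      rintro r (rfl | hr)
      · exact Or.inl fun y hy => ((hker y).1 hy).2
      · exact (h.dichotomy r hr).imp (fun h y hy => h y ((hker y).1 hy).1)
          fun h y hy => h y ((hker y).1 hy).1

theorem toVec_single_dotProduct {n : ℕ} (j : Fin n) (a : K) (y : Fin n → K) :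
    toVec n (List.ofFn (Pi.single j a : Fin n → K)) ⬝ᵥ y = a * y j := by
  rw [toVec_ofFn, single_dotProduct]

/-- Let `y` be a lightest vector of the reduced kernel and `y j ≠ 0`. For `z` in this kernel,
subtract the multiple of `y` that cancels coordinate `j`. Where `y` vanishes, the dichotomy makes
all kernel vectors vanish, so the difference has its support strictly inside that of `y`; by
minimality of the weight of `y` it is zero. -/
theorem subspaceReduced_spec (I : SubspaceInstance K) (hI : ((minSWPNonzero K).Sol I).Nonempty) :
    (subspaceReduced I).n = I.n ∧ ∃ y : Fin I.n → K, y ≠ 0 ∧ I.A.mulVec y = 0 ∧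
      hammingNorm y ≤ (easySWPNonzero K).val I ∧ y ∈ Ker I.n (subspaceReduced I).rows ∧
      ∀ z ∈ Ker I.n (subspaceReduced I).rows, ∃ c : K, z = c • y := by
  have hval := fun t => (easySWPNonzero K).leq_iff_val_le I hI t
  have hleq := subspaceLeq_iff (J := I) rfl
  have h := foldl_subspaceStep (d := (easySWPNonzero K).val I) (N := Ker I.n I.rows)
    (singles K I.n) ∅ I (length_of_mem_singles _)
    ⟨rfl, le_rfl, (hleq _).1 ((hval _).2 le_rfl), by simp⟩
  change SubspaceInvariant _ _ _ _ (subspaceReduced I) at h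
  obtain ⟨y, hy, hy0, hyd⟩ := h.exists_mem
  refine ⟨h.n_eq, y, hy0, (mem_Ker_rowsOf _ _).1 (h.ker_le hy), hyd, hy, fun z hz => ?_⟩
  obtain ⟨j, hj⟩ := Function.ne_iff.1 hy0
  rw [Pi.zero_apply] at hj
  refine ⟨z j * (y j)⁻¹, ?_⟩
  by_contra hne
  have hw : z - (z j * (y j)⁻¹) • y ∈ Ker I.n (subspaceReduced I).rows :=
    Submodule.sub_mem _ hz (Submodule.smul_mem _ _ hy)
  have hmin := (hval _).1 ((hleq _).2 ⟨_, h.ker_le hw, sub_ne_zero.2 hne, le_rfl⟩)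
  have hlt : hammingNorm (z - (z j * (y j)⁻¹) • y) < hammingNorm y := by
    refine Finset.card_lt_card ((Finset.ssubset_iff_of_subset fun i hi => ?_).2 ⟨j, ?_, ?_⟩)
    · simp only [Finset.mem_filter, Finset.mem_univ, true_and, Pi.sub_apply, Pi.smul_apply,
        smul_eq_mul] at hi ⊢
      intro hi0
      have := h.dichotomy _ (Or.inr (single_mem_singles i 1))
      simp only [toVec_single_dotProduct, one_mul] at this
      rcases this with h1 | h1
      · rw [h1 z hz, hi0] at hi
        simp at hi
      · exact h1 y hy hy0 hyd hi0
    · simpa using hj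
    · simp [hj]
  omega

/-- The fold keeps the last row that passes the test. Its start value `[]` need not pass, hence the
alternative that a passing row is still to come. -/
theorem foldl_fullRank {R : List (List K)} {n : ℕ} (L : List (List K)) :
    ∀ s : List K, (∀ e ∈ L, e.length = n) →
      (s.length = n ∧ fullRank (R ++ [s]) = true) ∨ (∃ e ∈ L, fullRank (R ++ [e]) = true) →
      (L.foldl (fun s e => bif fullRank (R ++ [e]) then e else s) s).length = n ∧
      fullRank (R ++ [L.foldl (fun s e => bif fullRank (R ++ [e]) then e else s) s]) = true := by
  induction L with
  | nil => intro s _ h; simpa using h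
  | cons e L ih =>
    intro s hL h
    rw [List.foldl_cons]
    refine ih _ (fun r hr => hL r (by simp [hr])) ?_
    cases he : fullRank (R ++ [e])
    · simpa [he] using h
    · exact Or.inl ⟨hL e (by simp), he⟩

/-- A single with entry `a` at `j` fails the test exactly if `a * y j = 1`, and then coordinate `j`
is overwritten by `a⁻¹ = y j`. A coordinate with `y j = 0` is never touched. The alternative in the
conclusion serves the induction: each coordinate is already right or its decisive single is still
ahead. -/
theorem foldl_overwrite {n : ℕ} (y : Fin n → K) {test : List K → Bool} (L : List (List K)) :
    ∀ x : Fin n → K, (∀ e ∈ L, ∃ (j : Fin n) (a : K), e = List.ofFn (Pi.single j a : Fin n → K)) →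
      (∀ e ∈ L, test e = true ↔ toVec n e ⬝ᵥ y ≠ 1) →
      ∃ x', L.foldl (fun x e => bif test e then x else
          zipD (fun a b => bif codeEq b 0 then a else b⁻¹) 0 x e) (List.ofFn x) = List.ofFn x' ∧
        ∀ i, (x i = y i ∨ ∃ a, List.ofFn (Pi.single i a : Fin n → K) ∈ L ∧ a * y i = 1) →
          x' i = y i := by
  induction L with
  | nil => intro x _ _; exact ⟨x, rfl, by simp⟩
  | cons e L ih =>
    intro x hL ht
    obtain ⟨j, a, rfl⟩ := hL e (by simp)
    have ht' := ht _ (List.mem_cons_self)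
    rw [toVec_single_dotProduct] at ht'
    rw [List.foldl_cons]
    cases hc : test (List.ofFn (Pi.single j a : Fin n → K))
    · rw [hc] at ht'
      have hj : a * y j = 1 := by simpa using ht'
      have ha : a ≠ 0 := left_ne_zero_of_mul_eq_one hj
      rw [cond_false, zipD_ofFn]
      obtain ⟨x', h1, h2⟩ := ih (fun i => bif codeEq
          ((List.ofFn (Pi.single j a : Fin n → K)).getD i 0) 0 then x i
          else ((List.ofFn (Pi.single j a : Fin n → K)).getD i 0)⁻¹)
        (fun r hr => hL r (by simp [hr])) (fun r hr => ht r (by simp [hr]))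
      refine ⟨x', h1, fun i hi => h2 i ?_⟩
      rcases eq_or_ne i j with rfl | hij
      · left
        have : codeEq a 0 = false := by rwa [← Bool.not_eq_true, codeEq_iff]
        simp [this, eq_inv_of_mul_eq_one_right hj]
      · refine hi.imp (fun hi => ?_) fun ⟨b, hb, hbi⟩ => ⟨b, ?_, hbi⟩
        · have : codeEq (0 : K) 0 = true := (codeEq_iff _ _).2 rfl
          simp [Pi.single_eq_of_ne hij, this, hi]
        · refine (List.mem_cons.1 hb).resolve_left fun h => ?_
          have := congrFun (List.ofFn_injective h) i
          rw [Pi.single_eq_same, Pi.single_eq_of_ne hij] at this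
          simp [this] at hbi
    · obtain ⟨x', h1, h2⟩ := ih x (fun r hr => hL r (by simp [hr])) (fun r hr => ht r (by simp [hr]))
      refine ⟨x', h1, fun i hi => h2 i (hi.imp_right fun ⟨b, hb, hbi⟩ => ⟨b, ?_, hbi⟩)⟩
      refine (List.mem_cons.1 hb).resolve_left fun h => ?_
      have := (ht _ List.mem_cons_self).1 hc
      rw [← h, toVec_single_dotProduct] at this
      exact this hbi

/-- On the line spanned by `y`, appending a row preserves full rank exactly if the row is not
orthogonal to `y`. Scale `y` so that its product with the chosen single is `1`; then another single
has product `1` exactly if the difference of the two is orthogonal to `y`. These tests reveal the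
coordinates of the scaled vector `b⁻¹ • y`. -/
theorem subspaceVector_spec {J : SubspaceInstance K} {n : ℕ} (hn : J.n = n) {y : Fin n → K}
    (hy : y ∈ Ker n J.rows) (hy0 : y ≠ 0) (hker : ∀ z ∈ Ker n J.rows, ∃ c : K, z = c • y) :
    ∃ c : K, c ≠ 0 ∧ subspaceVector J = List.ofFn (c • y) := by
  subst hn
  obtain ⟨j, hj⟩ := Function.ne_iff.1 hy0
  obtain ⟨hlen, hfull⟩ := foldl_fullRank (R := J.rows) (singles K J.n) []
    (length_of_mem_singles _) (Or.inr ⟨_, single_mem_singles j 1,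
      (J.fullRank_append_iff rfl (by simp)).2 ⟨y, hy, by
        rw [toVec_single_dotProduct, one_mul]; exact hj⟩⟩)
  change (subspaceSingle J).length = _ at hlen
  change fullRank (J.rows ++ [subspaceSingle J]) = _ at hfull
  obtain ⟨z, hz, hz0⟩ := (J.fullRank_append_iff rfl hlen).1 hfull
  obtain ⟨c, rfl⟩ := hker z hz
  rw [dotProduct_smul, smul_eq_mul] at hz0
  have hc := right_ne_zero_of_mul hz0
  set b := toVec J.n (subspaceSingle J) ⬝ᵥ y with hb
  have htest : ∀ e ∈ singles K J.n,
      fullRank (J.rows ++ [zipD (fun a b => a - b) 0 (subspaceSingle J) e]) = true ↔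
        toVec J.n e ⬝ᵥ (b⁻¹ • y) ≠ 1 := by
    intro e he
    rw [J.fullRank_append_iff rfl (by rw [length_zipD, hlen])]
    have hv : toVec J.n (zipD (fun a b => a - b) 0 (subspaceSingle J) e) =
        toVec J.n (subspaceSingle J) - toVec J.n e := by
      rw [← ofFn_toVec hlen, zipD_ofFn, toVec_ofFn, toVec_ofFn]
      rfl
    have h1 : toVec J.n (zipD (fun a b => a - b) 0 (subspaceSingle J) e) ⬝ᵥ (b⁻¹ • y) =
        1 - toVec J.n e ⬝ᵥ (b⁻¹ • y) := by
      rw [hv, sub_dotProduct, dotProduct_smul, ← hb, smul_eq_mul, inv_mul_cancel₀ hc]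
    rw [hv] at h1 ⊢
    constructor
    · rintro ⟨w, hw, hw0⟩ h2
      obtain ⟨a, rfl⟩ := hker w hw
      rw [h2, sub_self, dotProduct_smul, smul_eq_mul] at h1
      rw [dotProduct_smul, smul_eq_mul, (mul_eq_zero.1 h1).resolve_left (inv_ne_zero hc),
        mul_zero] at hw0
      exact hw0 rfl
    · intro h2
      exact ⟨_, Submodule.smul_mem _ b⁻¹ hy, by rw [h1]; exact sub_ne_zero.2 (Ne.symm h2)⟩
  obtain ⟨x', h1, h2⟩ := foldl_overwrite (b⁻¹ • y) (singles K J.n) 0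
    (exists_single_of_mem_singles _) htest
  refine ⟨b⁻¹, inv_ne_zero hc, ?_⟩
  have hx : x' = b⁻¹ • y := by
    funext i
    refine h2 i ?_
    by_cases h0 : (b⁻¹ • y) i = 0
    · exact Or.inl h0.symm
    -- The decisive single carries the inverse of the coordinate to be found.
    · exact Or.inr ⟨_, single_mem_singles i _, inv_mul_cancel₀ h0⟩
  rw [subspaceVector, ← hx, ← h1, Pi.zero_def, List.ofFn_const]

theorem minSWPNonzero_allTuringEquivalent : (minSWPNonzero K).AllTuringEquivalent := by
  refine (easySWPNonzero K).allTuringEquivalent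
    (f := fun I : SubspaceInstance K => subspaceVector (subspaceReduced I))
    (fun _ h => PolyFun.subspaceVector.comp (PolyFun.subspaceReduced h)) fun I hI => ?_
  obtain ⟨hn, y, hy0, hAy, hyd, hy, hker⟩ := subspaceReduced_spec I hI
  obtain ⟨c, hc, h⟩ := subspaceVector_spec hn hy hy0 hker
  refine ⟨c • y, ⟨smul_ne_zero hc hy0, ?_⟩, ?_, ?_⟩
  · rw [Matrix.mulVec_smul, hAy, smul_zero]
  · exact hammingNorm_smul_le_hammingNorm.trans hyd
  · rw [h]
    rfl

/-! ### MIN-SWP -/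

variable (K) in
/-- MIN-SWP is easy to handle. -/
noncomputable def easySWP : EasyMin (minSWP K) where
  opt_eq := rfl
  bound := SubspaceInstance.n
  bound_poly _ := PolyFun.of_subspace PolyFun.id.subspaceNum
  measure_le I y _ := hammingNorm_le_card_fintype.trans (Fintype.card_fin _).le
  bound_le := (easySWPNonzero K).bound_le
  cand_le I y _ := (length_encVec_le_enc I y).trans eval_X.le
  zero := fun _ => true
  zero_poly _ := PolyFun.const true
  zero_iff I := iff_of_true rfl
    ⟨(0 : Fin I.n → K), Matrix.mulVec_zero I.A, hammingNorm_zero (β := fun _ : Fin I.n => K)⟩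
  solvable := fun _ => true
  solvable_poly _ := PolyFun.const true
  solvable_iff I := iff_of_true rfl ⟨(0 : Fin I.n → K), Matrix.mulVec_zero I.A⟩
  base := (⟨0, 0, 0, by simp⟩ : SubspaceInstance K)
  base_solvable := ⟨(0 : Fin 0 → K), Matrix.mulVec_zero _⟩

/-- The zero vector is always feasible and has weight zero, so the optimal solution is written down
without the oracle. -/
theorem minSWP_allTuringEquivalent : (minSWP K).AllTuringEquivalent :=
  (easySWP K).allTuringEquivalent (f := fun I : SubspaceInstance K => List.replicate I.n 0)
    (fun orc _ => PolyFun.of_subspace (orc := orc)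
      (f := fun I : SubspaceInstance K => List.replicate I.n (0 : K)) (by fun_prop))
    fun I _ => ⟨(0 : Fin I.n → K), Matrix.mulVec_zero I.A,
      (hammingNorm_zero (β := fun _ : Fin I.n => K)).le.trans (Nat.zero_le _),
      congrArg (List.map Sym.elt) (List.ofFn_const I.n (0 : K))⟩

end SWP

end CosetWeight

theorem mainTheorem7 {F : Type*} [Field F] [Finite F] [DecidableEq F] :
    -- the optimization problems are NPO problems
    ((CosetWeight.minCWP F).IsNPO ∧ (CosetWeight.minSWP F).IsNPO ∧
      (CosetWeight.minSWPNonzero F).IsNPO) ∧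
    -- CWP and SWP, on matrices of full row rank, are their decision problems
    ((∀ (I : CosetWeight.CosetInstance F) (t : ℕ), 0 < t →
        ((CosetWeight.minCWP F).Decides I t ↔ CosetWeight.CWP I.A I.b t)) ∧
      (∀ (I : CosetWeight.SubspaceInstance F) (t : ℕ), 0 < t →
        ((CosetWeight.minSWP F).Decides I t ↔ CosetWeight.SWP I.A t)) ∧
      (∀ (I : CosetWeight.SubspaceInstance F) (t : ℕ), 0 < t →
        ((CosetWeight.minSWPNonzero F).Decides I t ↔ CosetWeight.SWPNonzero I.A t))) ∧
    -- their constructive, evaluation and decision problems are Turing-equivalent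
    ((CosetWeight.minCWP F).AllTuringEquivalent ∧ (CosetWeight.minSWP F).AllTuringEquivalent ∧
      (CosetWeight.minSWPNonzero F).AllTuringEquivalent) :=
  ⟨⟨CosetWeight.minCWP_isNPO, CosetWeight.minSWP_isNPO, CosetWeight.minSWPNonzero_isNPO⟩,
    ⟨fun I t _ => CosetWeight.minCWP_decides_iff I t,
      fun I t _ => CosetWeight.minSWP_decides_iff I t,
      fun I t _ => CosetWeight.minSWPNonzero_decides_iff I t⟩,
    CosetWeight.minCWP_allTuringEquivalent, CosetWeight.minSWP_allTuringEquivalent,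
    CosetWeight.minSWPNonzero_allTuringEquivalent⟩
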